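/- Let $(V,J)$ be a connected complex manifold with a holomorphic action of a compact torus $\mathbb T$ with Lie algebra $\mathfrak t$; elements of $\mathfrak t$ are identified with the vector fields they induce on $V$. Put $d^cf=-df\circ J$. For $Y\in\mathfrak t$, let $\mathcal R_Y(V,J)$ be the set of \emph{cone potentials} for $Y$: smooth functions $r:V\to\mathbb R^+$ with $\mathcal L_Yr=0$, $\mathcal L_{-JY}r=r$ and $dd^cr>0$; let $\mathcal R_Y(V,J)^{\mathbb T}$ be the set of $\mathbb T$-invariant ones. Let $\mathfrak t_+$ be the set of $Y\in\mathfrak t$ for which there is a surjective $r:V\to\mathbb R^+$ in $\mathcal R_Y(V,J)$. When $-JY$ is complete and the quotient manifold $\pi_Y:V\to N^Y$ of $V$ by its flow exists, $Y$ descends to $N^Y$, and $J$ descends to a transversal holomorphic structure $J^Y$ on $TN^Y/\langle Y\rangle$. A $1$-form $\eta$ on $N^Y$ is the contact form of a Sasaki structure compatible with $(Y,J^Y)$ if $\eta(Y)=1$, $\mathcal L_Y\eta=0$ and $d\eta$ is $J^Y$-invariant and $J^Y$-positive; it induces on $N^Y$ the CR structure given by $\ker\eta\cong TN^Y/\langle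 Y\rangle$ with the complex structure $J^Y$. For $r\in\mathcal R_Y(V,J)$ let $\eta_r$ be the $1$-form on $N^Y$ with $\pi_Y^*\eta_r=d^cr/r$. For a contact form $\eta_0$ of this kind, let $\hat\Xi(Y,J^Y,\eta_0)^{\mathbb T}$ be the set of \emph{$\mathbb T$-invariant Sasaki potentials}: smooth $\mathbb T$-invariant functions $\varphi$ on $N^Y$ (with $d\varphi(Y)=0$) such that $\eta_0+d^c\varphi$ is again such a contact form, where $\pi_Y^*(d^c\varphi)=d^c(\varphi\circ\pi_Y)$. Let $X\in\mathfrak t$ be such that $(V,J,X)$ is the polarized complex cone of a compact $\mathbb T$-invariant Sasaki manifold, i.e. $-JX$ is complete, $V$ has a compact quotient manifold $\pi_X:V\to N^X$ by its flow, and $\mathcal R_X(V,J)^{\mathbb T}\neq\emptyset$. Let $K\in\mathfrak t_+$. Then: (1) There is a bijection $\Theta:\mathcal R_X(V,J)^{\mathbb T}\to\mathcal R_K(V,J)^{\mathbb T}$ such that $\Theta(r)=\tilde r$ if and only if $\tilde r^{-1}(1)=r^{-1}(1)$. (2) $-JK$ is complete, and the quotient manifold $\pi_K:V\to N^K$ of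 $V$ by its flow exists and is diffeomorphic to $N^X$. For each $r\in\mathcal R_X(V,J)^{\mathbb T}$ there is a diffeomorphism $\Psi_r:N^K\to N^X$ with $\Psi_r(\pi_K(p))=\pi_X(p)$ whenever $r(p)=1$. The function $\eta_r(K)$ has no zeros, $$\eta_{\Theta(r)}=\Psi_r^*\Bigl(\frac{\eta_r}{\eta_r(K)}\Bigr),$$ and $\Psi_r$ is an isomorphism from the CR structure induced by $\eta_{\Theta(r)}$ on $N^K$ to the one induced by $\eta_r$ on $N^X$. (3) $\Theta$ maps smooth (finite-dimensional) families to smooth families. If $r_t$ is a smooth curve in $\mathcal R_X(V,J)^{\mathbb T}$ and $\tilde r_t=\Theta(r_t)$, then $\partial_t\log r_t=\pi_X^*\dot r_t$ for a smooth $\mathbb T$-invariant function $\dot r_t$ on $N^X$, and $\partial_t\log\tilde r_t=\pi_K^*\dot{\tilde r}_t$ with $$\dot{\tilde r}_t=\Psi_{r_t}^*\Bigl(\frac{\dot r_t}{\eta_{r_t}(K)}\Bigr).$$ (4) Let $r_0\in\mathcal R_X(V,J)^{\mathbb T}$, $\tilde r_0=\Theta(r_0)$, $\eta^X_0=\eta_{r_0}$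 and $\eta^K_0=\eta_{\tilde r_0}$. There is a bijection $\hat\Theta:\hat\Xi(X,J^X,\eta^X_0)^{\mathbb T}\to\hat\Xi(K,J^K,\eta^K_0)^{\mathbb T}$, $\varphi\mapsto\psi$, with $r:=e^{\pi_X^*\varphi}r_0\in\mathcal R_X(V,J)^{\mathbb T}$ and $\Theta(e^{\pi_X^*\varphi}r_0)=e^{\pi_K^*\psi}\tilde r_0$ for all $\varphi$. It is smooth, in the sense that it maps smooth (finite-dimensional) families to smooth families. With $\eta^X_\varphi=\eta^X_0+d^c\varphi$, $\eta^K_\psi=\eta^K_0+d^c\psi$ and $\Psi=\Psi_r$, the function $\eta^X_\varphi(K)$ has no zeros, $$\eta^K_\psi=\Psi^*\Bigl(\frac{\eta^X_\varphi}{\eta^X_\varphi(K)}\Bigr),$$ and $\Psi$ is an isomorphism between the CR structures induced by $\eta^K_\psi$ and $\eta^X_\varphi$. For every smooth $\mathbb T$-invariant function $\dot\varphi$ on $N^X$, $\varphi+s\dot\varphi$ is a $\mathbb T$-invariant Sasaki potential for all small $s$, and the derivative of $\hat\Theta$ along any smooth curve of $\mathbb T$-invariant Sasaki potentials through $\varphi$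 with velocity $\dot\varphi$ is $$\dot\psi=\Psi^*\Bigl(\frac{\dot\varphi}{\eta^X_\varphi(K)}\Bigr).$$ -/

import Mathlib

open scoped Manifold ContDiff Topology

noncomputable section

namespace SasakiCone

section Forms

variable {F : Type*} [NormedAddCommGroup F] [NormedSpace ℝ F]
variable {F' : Type*} [NormedAddCommGroup F'] [NormedSpace ℝ F']
variable {M : Type*} [TopologicalSpace M] [ChartedSpace F M]
variable {M' : Type*} [TopologicalSpace M'] [ChartedSpace F' M']

/-- (Not necessarily smooth) vector fields on a manifold `M` modelled on the real space `F`.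
By definition `TangentSpace 𝓘(ℝ, F) x` is `F` (via the preferred chart around `x`), for every
`x`. -/
abbrev VField (F : Type*) (M : Type*) : Type _ := M → F

/-- (Not necessarily smooth) `1`-forms on a manifold `M` modelled on the real space `F`. The fibre
over `x` is the dual of `TangentSpace 𝓘(ℝ, F) x`, which is `F` by definition. -/
abbrev OneForm (F : Type*) [NormedAddCommGroup F] [NormedSpace ℝ F] (M : Type*) : Type _ :=
  M → (F →L[ℝ] ℝ)

/-- The differential `T_x M → T_{f x} M'` of a map between manifolds modelled on `F` and `F'`. -/
def diff (F : Type*) [NormedAddCommGroup F] [NormedSpace ℝ F]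
    (F' : Type*) [NormedAddCommGroup F'] [NormedSpace ℝ F']
    {M : Type*} [TopologicalSpace M] [ChartedSpace F M]
    {M' : Type*} [TopologicalSpace M'] [ChartedSpace F' M'] (f : M → M') (x : M) : F →L[ℝ] F' :=
  mfderiv 𝓘(ℝ, F) 𝓘(ℝ, F') f x

/-- The expression of a `1`-form in the preferred chart around `x₀`. -/
def OneForm.inChart (α : OneForm F M) (x₀ : M) : F → (F →L[ℝ] ℝ) := fun y =>
  (α ((extChartAt 𝓘(ℝ, F) x₀).symm y)).comp (diff F F (extChartAt 𝓘(ℝ, F) x₀).symm y)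

/-- A `1`-form is smooth if all its chart expressions are. -/
def OneForm.IsSmooth (α : OneForm F M) : Prop :=
  ∀ x₀ : M, ContDiffOn ℝ ∞ (OneForm.inChart α x₀) (extChartAt 𝓘(ℝ, F) x₀).target

/-- The exterior derivative `dα (v, w) = D_v α (w) - D_w α (v)` of a `1`-form, computed at `x` in
the preferred chart around `x`. -/
def OneForm.extDer (α : OneForm F M) (x : M) (v w : F) : ℝ :=
  let e := extChartAt 𝓘(ℝ, F) x
  let D := fderiv ℝ (OneForm.inChart α x) (e x)
  D (diff F F e x v) (diff F F e x w) - D (diff F F e x w) (diff F F e x v)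

/-- The pullback `f^* β` of a `1`-form. -/
def OneForm.pullback (f : M → M') (β : OneForm F' M') : OneForm F M := fun p =>
  (β (f p)).comp (diff F F' f p)

open Classical in
/-- The `1`-form `β` on `M'` with `π^* β = α`. It is unique when `π` is a surjective submersion;
the value is `0` if there is none. -/
def OneForm.descend (π : M → M') (α : OneForm F M) : OneForm F' M' :=
  if h : ∃ β : OneForm F' M', OneForm.pullback π β = α then h.choose else 0

open Classical in
/-- The vector field on `M'` which is `π`-related to the vector field `ζ` on `M`. It is unique when
`π` is surjective; the value is `0` if there is none. -/
def VField.descend (π : M → M') (ζ : VField F M) : VField F' M' :=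
  if h : ∃ W : VField F' M', ∀ p : M, W (π p) = diff F F' π p (ζ p) then h.choose else 0

/-- `γ` is an integral curve, defined for all times, of the vector field `Z`. -/
def IsIntegralCurveOf (Z : VField F M) (γ : ℝ → M) : Prop :=
  IsMIntegralCurve (I := 𝓘(ℝ, F)) γ Z

/-- `(M', π)` is the quotient manifold of `M` by the `ℝ`-action (equivalently the action of the
multiplicative group of positive reals) generated by the vector field `Z`: `Z` is complete and `π`
is a surjective submersion whose fibres are exactly the orbits of the flow of `Z`. -/
structure IsOrbitSpace (F' : Type*) [NormedAddCommGroup F'] [NormedSpace ℝ F']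
    {M' : Type*} [TopologicalSpace M'] [ChartedSpace F' M']
    (Z : VField F M) (π : M → M') : Prop where
  smooth : ContMDiff 𝓘(ℝ, F) 𝓘(ℝ, F') ∞ π
  surjective : Function.Surjective π
  submersion : ∀ p : M, Function.Surjective (diff F F' π p)
  complete : ∀ p : M, ∃ γ : ℝ → M, IsIntegralCurveOf Z γ ∧ γ 0 = p
  fibre : ∀ p q : M, π p = π q ↔
    ∃ γ : ℝ → M, IsIntegralCurveOf Z γ ∧ γ 0 = p ∧ ∃ t : ℝ, γ t = q

/-- Smooth families `(f_s)`, `s ∈ U`, of functions on `M`: `(s, x) ↦ f_s x` is smooth on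
`U × M`. -/
def SmoothFamilyOn (F : Type*) [NormedAddCommGroup F] [NormedSpace ℝ F]
    {M : Type*} [TopologicalSpace M] [ChartedSpace F M]
    {P : Type*} [NormedAddCommGroup P] [NormedSpace ℝ P] (U : Set P) (f : P → M → ℝ) : Prop :=
  ContMDiffOn (𝓘(ℝ, P).prod 𝓘(ℝ, F)) 𝓘(ℝ, ℝ) ∞ (fun q : P × M => f q.1 q.2) (U ×ˢ Set.univ)

end Forms

section Cone

variable {E : Type*} [NormedAddCommGroup E] [NormedSpace ℂ E]
variable {V : Type*} [TopologicalSpace V] [ChartedSpace E V]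
variable {F : Type*} [NormedAddCommGroup F] [NormedSpace ℝ F]
variable {N : Type*} [TopologicalSpace N] [ChartedSpace F N]

/-- The complex structure `J` on the tangent spaces of a complex manifold modelled on `E`:
multiplication by `i` (in any holomorphic chart). -/
def J : E →L[ℝ] E := (Complex.I • ContinuousLinearMap.id ℂ E).restrictScalars ℝ

/-- `d^c f = J df`, that is `(d^c f) (v) = - df (J v)`. -/
def dc (E : Type*) [NormedAddCommGroup E] [NormedSpace ℂ E]
    {V : Type*} [TopologicalSpace V] [ChartedSpace E V] (f : V → ℝ) : OneForm E V :=
  fun p => -(diff E ℝ f p).comp J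

/-- The radial vector field `Z = - J ξ`. -/
def radial (ξ : VField E V) : VField E V := fun p => -J (ξ p)

/-- Cone potentials for `ξ`: smooth positive functions `r` with `L_ξ r = 0`, `L_{-Jξ} r = r` and
`d d^c r > 0` (positivity of the `(1,1)`-form). -/
structure IsConePotential (ξ : VField E V) (r : V → ℝ) : Prop where
  smooth : ContMDiff 𝓘(ℝ, E) 𝓘(ℝ, ℝ) ∞ r
  pos : ∀ p, 0 < r p
  invariant : ∀ p, diff E ℝ r p (ξ p) = 0
  homogeneous : ∀ p, diff E ℝ r p (radial ξ p) = r p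
  psh : ∀ (p : V) (v : E), v ≠ 0 → 0 < OneForm.extDer (dc E r) p v (J v)

/-- `ξ` is a polarization: it admits a surjective cone potential `V → (0, ∞)`. -/
def IsPolarization (ξ : VField E V) : Prop :=
  ∃ r : V → ℝ, IsConePotential ξ r ∧ Set.range r = Set.Ioi 0

/-- The compact torus of dimension `d`; its Lie algebra is `Fin d → ℝ`. -/
abbrev Torus (d : ℕ) : Type := Fin d → Circle

/-- The exponential map of the torus. -/
def torusExp {d : ℕ} (Y : Fin d → ℝ) : Torus d := fun i => Circle.exp (Y i)

/-- The torus acts on `V` smoothly and by biholomorphisms (smoothness on the torus is tested on its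
universal cover). -/
structure IsHolomorphicTorusAction (E : Type*) [NormedAddCommGroup E] [NormedSpace ℂ E]
    (V : Type*) [TopologicalSpace V] [ChartedSpace E V] (d : ℕ) [MulAction (Torus d) V] :
    Prop where
  smooth : ContMDiff (𝓘(ℝ, Fin d → ℝ).prod 𝓘(ℝ, E)) 𝓘(ℝ, E) ∞
    (fun q : (Fin d → ℝ) × V => torusExp q.1 • q.2)
  holomorphic : ∀ g : Torus d, MDifferentiable 𝓘(ℂ, E) 𝓘(ℂ, E) (fun p : V => g • p)

/-- The vector field on `V` induced by the element `Y` of the Lie algebra of the torus. -/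
def field (E : Type*) [NormedAddCommGroup E] [NormedSpace ℂ E]
    (V : Type*) [TopologicalSpace V] [ChartedSpace E V] {d : ℕ} [MulAction (Torus d) V]
    (Y : Fin d → ℝ) : VField E V :=
  fun p => diff ℝ E (fun s : ℝ => torusExp (s • Y) • p) 0 1

/-- The torus-invariant cone potentials for the vector field induced by `Y`. -/
def conePotentials (E : Type*) [NormedAddCommGroup E] [NormedSpace ℂ E]
    (V : Type*) [TopologicalSpace V] [ChartedSpace E V] {d : ℕ} [MulAction (Torus d) V]
    (Y : Fin d → ℝ) : Set (V → ℝ) :=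
  {r | IsConePotential (field E V Y) r ∧ ∀ (g : Torus d) (p : V), r (g • p) = r p}

/-- The Reeb cone: the elements of the Lie algebra of the torus which are polarizations. -/
def reebCone (E : Type*) [NormedAddCommGroup E] [NormedSpace ℂ E]
    (V : Type*) [TopologicalSpace V] [ChartedSpace E V] (d : ℕ) [MulAction (Torus d) V] :
    Set (Fin d → ℝ) :=
  {Y | IsPolarization (field E V Y)}

/-- The smooth functions on the quotient `N` which are invariant under the induced torus action. -/
def invariantFunctions (F : Type*) [NormedAddCommGroup F] [NormedSpace ℝ F]
    {V : Type*} {N : Type*} [TopologicalSpace N] [ChartedSpace F N]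
    (d : ℕ) [MulAction (Torus d) V] (π : V → N) : Set (N → ℝ) :=
  {φ | ContMDiff 𝓘(ℝ, F) 𝓘(ℝ, ℝ) ∞ φ ∧ ∀ (g : Torus d) (p : V), φ (π (g • p)) = φ (π p)}

/-- The `1`-form `η_r` on the quotient `N` with `π^* η_r = d^c r / r`. -/
def contactForm (E : Type*) [NormedAddCommGroup E] [NormedSpace ℂ E]
    (F : Type*) [NormedAddCommGroup F] [NormedSpace ℝ F]
    {V : Type*} [TopologicalSpace V] [ChartedSpace E V]
    {N : Type*} [TopologicalSpace N] [ChartedSpace F N]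
    (π : V → N) (r : V → ℝ) : OneForm F N :=
  OneForm.descend π (fun p => (r p)⁻¹ • dc E r p)

/-- For a function `φ` on `N` which is basic (constant along the Reeb field), the `1`-form `d^c φ`
of the transversal holomorphic structure induced by `J` on the quotient `N`; it is the form with
`π^* (d^c φ) = d^c (π^* φ)`. -/
def dcQuot (E : Type*) [NormedAddCommGroup E] [NormedSpace ℂ E]
    (F : Type*) [NormedAddCommGroup F] [NormedSpace ℝ F]
    {V : Type*} [TopologicalSpace V] [ChartedSpace E V]
    {N : Type*} [TopologicalSpace N] [ChartedSpace F N]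
    (π : V → N) (φ : N → ℝ) : OneForm F N :=
  OneForm.descend π (dc E (fun p => φ (π p)))

/-- The `1`-form `η_φ = η₀ + d^c φ` on the quotient `N`. -/
def potentialForm (E : Type*) [NormedAddCommGroup E] [NormedSpace ℂ E]
    {F : Type*} [NormedAddCommGroup F] [NormedSpace ℝ F]
    {V : Type*} [TopologicalSpace V] [ChartedSpace E V]
    {N : Type*} [TopologicalSpace N] [ChartedSpace F N]
    (π : V → N) (η₀ : OneForm F N) (φ : N → ℝ) : OneForm F N :=
  fun x => η₀ x + dcQuot E F π φ x

/-- The contact forms of the Sasaki structures on `N` compatible with the vector field `ξ_N` induced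
by `ξ` and the transversal holomorphic structure `J^ξ` on `TN / ⟨ξ_N⟩` induced by `J`:
`η (ξ_N) = 1`, `L_{ξ_N} η = 0` (as `η (ξ_N)` is constant, the Lie derivative is the contraction
of `dη` with `ξ_N`), and `dη` is `J^ξ`-invariant and `J^ξ`-positive. Here `J^ξ` sends the class of
`dπ v` to the class of `dπ (J v)`. -/
structure IsSasakiForm (ξ : VField E V) (π : V → N) (η : OneForm F N) : Prop where
  smooth : OneForm.IsSmooth η
  reeb : ∀ x, η x (VField.descend π ξ x) = 1
  lie : ∀ x w, OneForm.extDer η x (VField.descend π ξ x) w = 0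
  invariant : ∀ (p : V) (v w : E),
    OneForm.extDer η (π p) (diff E F π p (J v)) (diff E F π p (J w)) =
      OneForm.extDer η (π p) (diff E F π p v) (diff E F π p w)
  positive : ∀ (p : V) (v : E), (¬ ∃ c : ℝ, diff E F π p v = c • VField.descend π ξ (π p)) →
    0 < OneForm.extDer η (π p) (diff E F π p v) (diff E F π p (J v))

/-- Torus-invariant Sasaki potentials with respect to the contact form `η₀`: smooth invariant
basic functions `φ` on `N` such that `η₀ + d^c φ` is the contact form of a compatible Sasaki
structure. -/
def sasakiPotentials (E : Type*) [NormedAddCommGroup E] [NormedSpace ℂ E]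
    {F : Type*} [NormedAddCommGroup F] [NormedSpace ℝ F]
    {V : Type*} [TopologicalSpace V] [ChartedSpace E V]
    {N : Type*} [TopologicalSpace N] [ChartedSpace F N]
    {d : ℕ} [MulAction (Torus d) V] (Y : Fin d → ℝ) (π : V → N)
    (η₀ : OneForm F N) : Set (N → ℝ) :=
  {φ | φ ∈ invariantFunctions F d π ∧
    (∀ x, diff F ℝ φ x (VField.descend π (field E V Y) x) = 0) ∧
    IsSasakiForm (field E V Y) π (potentialForm E π η₀ φ)}

/-- `w' = J_η w`, where `J_η` is the complex structure on the contact distribution `ker η` at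
`π p` corresponding to the transversal holomorphic structure `J^ξ`: both `w` and `w'` lie in
`ker η`, and the class of `w'` modulo `ξ_N` is the image under `J^ξ` of the class of `w`. -/
def CRRelated (ξ : VField E V) (π : V → N) (η : OneForm F N) (p : V) (w w' : F) : Prop :=
  η (π p) w = 0 ∧ η (π p) w' = 0 ∧
    ∃ (v : E) (c : ℝ), w = diff E F π p v ∧
      w' = diff E F π p (J v) + c • diff E F π p (ξ p)

/-- The map `Ψ : N' → N` (a diffeomorphism in the applications) is an isomorphism of the CR
structures which the `1`-forms `η'` and `η` induce on the quotients `π' : V → N'` and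
`π : V → N` : its differential matches the contact distributions and their complex structures. -/
def IsCRIso {N' : Type*} [TopologicalSpace N'] [ChartedSpace F N']
    (ξ' : VField E V) (π' : V → N') (η' : OneForm F N')
    (ξ : VField E V) (π : V → N) (η : OneForm F N) (Ψ : N' → N) : Prop :=
  ∀ p q : V, Ψ (π' p) = π q → ∀ w w' : F,
    CRRelated ξ' π' η' p w w' ↔
      CRRelated ξ π η q (diff F F Ψ (π' p) w) (diff F F Ψ (π' p) w')

/-- The function `η (ζ)` on the quotient `N`, for a vector field `ζ` on `V` that descends to `N`. -/
def evalField (π : V → N) (η : OneForm F N) (ζ : VField E V) (x : N) : ℝ :=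
  η x (VField.descend π ζ x)

/-- The `1`-form `η / η (ζ)` on the quotient `N`. -/
def rescale (π : V → N) (η : OneForm F N) (ζ : VField E V) : OneForm F N := fun x =>
  (evalField π η ζ x)⁻¹ • η x

end Cone

end SasakiCone

end

open SasakiCone

/-! A cone potential r for X grows like e^t along the flow of -JX, so it is determined by its level
set M = {r = 1}. Suppose that -JK is complete and that r changes along it at a definite rate. Then
every orbit of -JK meets M exactly once, at a time `hitTime` which is smooth by the implicit
function theorem. The function `transfer`, equal to 1 on M and growing like e^t along -JK, is the
potential Θ(r). Exchanging the roles of X and K gives the inverse.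

Completeness of -JK holds because its orbits have a uniform lifetime on the compact set M, and the
flow of -JX, which preserves -JK, carries this to all of V (`isCompleteField_radial`). For
positivity of the Levi form, dr and the differential of Θ(r) are proportional on M with factor
dr(-JK) (`diff_eq_of_level`). Along ker dr ∩ ker d^c r the Levi forms are then proportional with the
same factor (`extDer_eq_of_level`), and homogeneity settles the remaining directions.

The heart of the matter is that dr(-JK) has no zeros (`diff_radial_ne_zero`). The quotient dr(-JK)/r
is constant along the flow of -JX, so it attains a minimum c, at some x in M. There the contraction
of dd^c r with K - cX vanishes, hence K = cX at x. A potential u for K satisfies u = c·du(-JX) at x,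
so c ≠ 0. If c < 0, then u tends to infinity along the flow of -JX towards the apex, contradicting
the maximum principle `le_of_le_on_level`, by which u on r ≤ 1 is bounded by its maximum on M. That
principle needs complex dimension at least two. On a curve K is a real multiple of X at each point,
and the multiple may be negative: r and 1/r on the punctured plane are potentials for opposite
fields. This is why `IsTransverse` admits both signs.

Both orbit spaces are copies of M through the sections `sec`, and Ψ_r is the resulting
identification (`levelDiffeo`). The formulas for contact forms and CR structures compare vectors
tangent to M. The derivative of Θ comes from differentiating the equation that defines the hitting
time (`hasDerivAt_log_transfer`). Sasaki potentials φ correspond to the cone potentials e^{π^*φ} r₀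
(`mem_sasakiPotentials_iff`), so the bijection between them is Θ in logarithmic form. -/

noncomputable section

namespace SasakiCone

/-! ### Smooth dependence of solutions of differential equations on time and initial value. -/

section ODE

open Set

universe u

variable {E G : Type u} [NormedAddCommGroup E] [NormedSpace ℝ E]
  [NormedAddCommGroup G] [NormedSpace ℝ G]

/-- Pointwise application of a bilinear map to two curves. -/
def pointwiseBilin {H : Type u} [NormedAddCommGroup H] [NormedSpace ℝ H]
    (B : H →L[ℝ] E →L[ℝ] G) :
    C(unitInterval, H) →L[ℝ] C(unitInterval, E) →L[ℝ] C(unitInterval, G) :=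
  LinearMap.mkContinuous₂
    (LinearMap.mk₂ ℝ (fun (A : C(unitInterval, H)) (h : C(unitInterval, E)) =>
        (⟨fun t => B (A t) (h t), (B.continuous.comp A.continuous).clm_apply h.continuous⟩ :
          C(unitInterval, G)))
      (fun _ _ _ => by ext; simp) (fun _ _ _ => by ext; simp)
      (fun _ _ _ => by ext; simp) (fun _ _ _ => by ext; simp)) ‖B‖
    (fun A h => by
      rw [ContinuousMap.norm_le _ (by positivity)]
      intro t
      simp only [LinearMap.mk₂_apply, ContinuousMap.coe_mk]
      refine (B.le_opNorm₂ _ _).trans ?_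
      gcongr
      · exact A.norm_coe_le_norm t
      · exact h.norm_coe_le_norm t)

@[simp] lemma pointwiseBilin_apply {H : Type u} [NormedAddCommGroup H] [NormedSpace ℝ H]
    (B : H →L[ℝ] E →L[ℝ] G) (A : C(unitInterval, H)) (h : C(unitInterval, E))
    (t : unitInterval) : pointwiseBilin B A h t = B (A t) (h t) := rfl

/-- The superposition operator of a `C¹` map is differentiable. -/
lemma hasFDerivAt_postcomp {H : Type u} [NormedAddCommGroup H] [NormedSpace ℝ H]
    (B : H →L[ℝ] E →L[ℝ] G) (v : C(E, G)) (w : C(E, H)) (hv : ∀ x, HasFDerivAt v (B (w x)) x)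
    (γ : C(unitInterval, E)) :
    HasFDerivAt (fun c : C(unitInterval, E) => v.comp c) (pointwiseBilin B (w.comp γ)) γ := by
  rw [hasFDerivAt_iff_isLittleO_nhds_zero, Asymptotics.isLittleO_iff]
  intro ε hε
  have hcont := (ContinuousMap.continuous_postcomp (X := unitInterval) w).continuousAt (x := γ)
  obtain ⟨δ, hδ, hd⟩ := Metric.continuousAt_iff.1 hcont (ε / (‖B‖ + 1)) (by positivity)
  filter_upwards [Metric.ball_mem_nhds _ hδ] with h hh
  rw [mem_ball_zero_iff] at hh
  rw [ContinuousMap.norm_le _ (by positivity)]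
  intro t
  -- Mean value inequality on the segment from γ(t) to γ(t) + h(t), relative to the derivative at
  -- γ(t). The bound is uniform in t because composition with `w` is continuous for the sup norm.
  have key := Convex.norm_image_sub_le_of_norm_hasFDerivWithin_le' (𝕜 := ℝ) (f := v)
    (f' := fun x => B (w x)) (s := segment ℝ (γ t) (γ t + h t)) (x := γ t) (y := γ t + h t)
    (φ := B (w (γ t))) (C := ε)
    (fun x _ => (hv x).hasFDerivWithinAt) ?_
    (convex_segment _ _) (left_mem_segment _ _ _) (right_mem_segment _ _ _)
  · simp only [add_sub_cancel_left] at key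
    refine le_trans (le_of_eq ?_) (key.trans ?_)
    · simp
    · exact mul_le_mul_of_nonneg_left (h.norm_coe_le_norm t) hε.le
  · intro x hx
    rw [segment_eq_image'] at hx
    obtain ⟨θ, hθ, rfl⟩ := hx
    have h1 : dist (γ + θ • h) γ < δ := by
      rw [dist_eq_norm, add_sub_cancel_left, norm_smul, Real.norm_of_nonneg hθ.1]
      exact lt_of_le_of_lt (mul_le_of_le_one_left (norm_nonneg _) hθ.2) hh
    have h2 := ((ContinuousMap.dist_lt_iff (by positivity)).1 (hd h1) t).le
    rw [dist_eq_norm, le_div_iff₀ (by positivity)] at h2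
    have h3 : ‖B (w (γ t + θ • h t)) - B (w (γ t))‖ ≤ ‖B‖ * ‖w (γ t + θ • h t) - w (γ t)‖ := by
      rw [← map_sub]
      exact B.le_opNorm _
    simp only [ContinuousMap.comp_apply, ContinuousMap.add_apply, ContinuousMap.smul_apply] at h2
    simp only [add_sub_cancel_left]
    nlinarith [norm_nonneg (w (γ t + θ • h t) - w (γ t))]

/-- The derivative of superposition by `v` is superposition by `fderiv ℝ v` followed by a continuous
linear map, so one order is gained at each step. That derivative takes values in `E →L[ℝ] G`; hence
the target is quantified inside the induction and all spaces share a universe. -/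
lemma contDiff_postcomp (n : ℕ) : ∀ (G : Type u) [NormedAddCommGroup G] [NormedSpace ℝ G]
    {v : E → G} (hv : ContDiff ℝ ∞ v),
    ContDiff ℝ n (fun c : C(unitInterval, E) => (⟨v, hv.continuous⟩ : C(E, G)).comp c) := by
  induction n with
  | zero =>
    intro G _ _ v hv
    exact contDiff_zero.2 (ContinuousMap.continuous_postcomp _)
  | succ n ih =>
    have aux {G H : Type u} [NormedAddCommGroup G] [NormedSpace ℝ G] [NormedAddCommGroup H]
        [NormedSpace ℝ H] (B : H →L[ℝ] E →L[ℝ] G) (v : C(E, G)) {w : E → H}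
        (hw : ContDiff ℝ ∞ w) (hv : ∀ x, HasFDerivAt v (B (w x)) x) :
        ContDiff ℝ (n + 1) (fun c : C(unitInterval, E) => v.comp c) := by
      rw [contDiff_succ_iff_hasFDerivAt]
      have hB : ContDiff ℝ n (pointwiseBilin B) :=
        ContinuousLinearMap.contDiff (F := C(unitInterval, E) →L[ℝ] C(unitInterval, G)) _
      exact ⟨fun γ => pointwiseBilin B ((⟨w, hw.continuous⟩ : C(E, H)).comp γ),
        hB.comp (ih H hw),
        fun γ => hasFDerivAt_postcomp B v ⟨w, hw.continuous⟩ hv γ⟩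
    intro G _ _ v hv
    have hd : ContDiff ℝ ∞ (fderiv ℝ v) := hv.fderiv_right (by simp)
    exact aux (ContinuousLinearMap.id ℝ (E →L[ℝ] G)) ⟨v, hv.continuous⟩ hd
      fun x => (hv.differentiable (by simp) x).hasFDerivAt

/-- Constant curves. -/
def constCurve (E : Type u) [NormedAddCommGroup E] [NormedSpace ℝ E] :
    E →L[ℝ] C(unitInterval, E) :=
  LinearMap.mkContinuous
    { toFun := fun x => ContinuousMap.const _ x
      map_add' := fun _ _ => by ext; simp
      map_smul' := fun _ _ => by ext; simp } 1
    (fun x => by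
      rw [one_mul, ContinuousMap.norm_le _ (norm_nonneg _)]
      intro t
      simp)

@[simp] lemma constCurve_apply (x : E) (t : unitInterval) : constCurve E x t = x := rfl

variable [CompleteSpace E]

/-- The primitive vanishing at `0` of a curve. -/
def primitive (E : Type u) [NormedAddCommGroup E] [NormedSpace ℝ E] [CompleteSpace E] :
    C(unitInterval, E) →L[ℝ] C(unitInterval, E) :=
  LinearMap.mkContinuous
    { toFun := fun c => ⟨fun t => ∫ s in (0 : ℝ)..t, c (projIcc 0 1 zero_le_one s), by
        have hc : Continuous fun s => c (projIcc 0 1 zero_le_one s) :=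
          c.continuous.comp continuous_projIcc
        exact (intervalIntegral.continuous_primitive
          (fun a b => hc.intervalIntegrable a b) 0).comp continuous_subtype_val⟩
      map_add' := fun c c' => by
        ext t
        have hc (c : C(unitInterval, E)) : Continuous fun s => c (projIcc 0 1 zero_le_one s) :=
          c.continuous.comp continuous_projIcc
        simpa using intervalIntegral.integral_add ((hc c).intervalIntegrable 0 t)
          ((hc c').intervalIntegrable 0 t)
      map_smul' := fun a c => by
        ext t
        simp } 1
    (fun c => by
      rw [one_mul, ContinuousMap.norm_le _ (norm_nonneg _)]
      intro t
      refine (intervalIntegral.norm_integral_le_of_norm_le_const (C := ‖c‖)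
        (fun s _ => c.norm_coe_le_norm _)).trans ?_
      rw [sub_zero, abs_of_nonneg t.2.1]
      exact mul_le_of_le_one_right (norm_nonneg _) t.2.2)

@[simp] lemma primitive_apply (c : C(unitInterval, E)) (t : unitInterval) :
    primitive E c t = ∫ s in (0 : ℝ)..t, c (projIcc 0 1 zero_le_one s) := rfl

/-- Smooth dependence of the solution of `c' = τ v (c)`, `c 0 = x`, at time `1` on `τ` and `x`. -/
lemma exists_contDiffAt_endpoint {v : E → E} (hv : ContDiff ℝ ∞ v) (x₀ : E) (n : ℕ) (hn : n ≠ 0) :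
    ∃ g : ℝ × E → E, ContDiffAt ℝ n g (0, x₀) ∧ ∀ᶠ q in 𝓝 ((0 : ℝ), x₀),
      ∃ c : ℝ → E, c 0 = q.2 ∧ c 1 = g q ∧ Continuous c ∧
        ∀ t ∈ Icc (0 : ℝ) 1, HasDerivAt c (q.1 • v (c t)) t := by
  let Nv : C(unitInterval, E) → C(unitInterval, E) := fun c =>
    (⟨v, hv.continuous⟩ : C(E, E)).comp c
  have hNv : ContDiff ℝ n Nv := contDiff_postcomp n E hv
  -- The integral form of the initial value problem, as an equation for an unknown curve. Time
  -- enters as a factor in front of the field, so all curves live on the fixed interval [0, 1].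
  let f : (ℝ × E) × C(unitInterval, E) → C(unitInterval, E) := fun q =>
    q.2 - constCurve E q.1.2 - q.1.1 • primitive E (Nv q.2)
  have hf : ContDiff ℝ n f := by
    refine (contDiff_snd.sub ((constCurve E).contDiff.comp (contDiff_snd.comp contDiff_fst))).sub ?_
    exact (contDiff_fst.comp contDiff_fst).smul ((primitive E).contDiff.comp (hNv.comp contDiff_snd))
  have hn' : (n : WithTop ℕ∞) ≠ 0 := by exact_mod_cast hn
  let u : (ℝ × E) × C(unitInterval, E) := ((0, x₀), constCurve E x₀)
  -- At time factor 0 the nonlinear term disappears, so the partial derivative in the curve is the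
  -- identity and no smallness estimate is needed.
  have hder : fderiv ℝ f u ∘L .inr ℝ (ℝ × E) C(unitInterval, E) = ContinuousLinearMap.id ℝ _ := by
    have h1 : HasFDerivAt (fun c => f ((0, x₀), c))
        (fderiv ℝ f u ∘L .inr ℝ (ℝ × E) C(unitInterval, E)) (constCurve E x₀) :=
      ((hf.differentiable hn' u).hasFDerivAt).comp (constCurve E x₀)
        (hasFDerivAt_prodMk_right ((0 : ℝ), x₀) (constCurve E x₀))
    have h2 : HasFDerivAt (fun c => f ((0, x₀), c))
        (ContinuousLinearMap.id ℝ C(unitInterval, E)) (constCurve E x₀) := by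
      simpa [f] using (hasFDerivAt_id (𝕜 := ℝ) (constCurve E x₀)).sub_const (constCurve E x₀)
    exact h1.unique h2
  have hinv : (fderiv ℝ f u ∘L .inr ℝ (ℝ × E) C(unitInterval, E)).IsInvertible := by
    rw [hder]
    exact ⟨ContinuousLinearEquiv.refl ℝ _, rfl⟩
  have hfu : f u = 0 := by simp [f, u]
  have hfa : ContDiffAt ℝ n f u := hf.contDiffAt
  refine ⟨fun q => hfa.implicitFunction hn' hinv q 1, ?_, ?_⟩
  · exact (ContinuousMap.evalCLM ℝ (1 : unitInterval)).contDiff.contDiffAt.comp _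
      (hfa.contDiffAt_implicitFunction hn' hinv)
  · filter_upwards [hfa.eventually_apply_implicitFunction hn' hinv] with q hq
    set ψ := hfa.implicitFunction hn' hinv q
    rw [hfu] at hq
    have hψ (t : unitInterval) : ψ t = q.2 + q.1 • ∫ s in (0 : ℝ)..t,
        v (ψ (projIcc 0 1 zero_le_one s)) := by
      have := congrArg (fun c => c t) hq
      simp only [f, ContinuousMap.sub_apply, constCurve_apply, ContinuousMap.smul_apply,
        primitive_apply, ContinuousMap.zero_apply] at this
      rw [sub_sub, sub_eq_zero] at this
      exact this
    have hc : Continuous fun s => v (ψ (projIcc 0 1 zero_le_one s)) :=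
      hv.continuous.comp (ψ.continuous.comp continuous_projIcc)
    have hd (t : ℝ) : HasDerivAt (fun t => q.2 + q.1 • ∫ s in (0 : ℝ)..t,
        v (ψ (projIcc 0 1 zero_le_one s))) (q.1 • v (ψ (projIcc 0 1 zero_le_one t))) t :=
      ((hc.integral_hasStrictDerivAt 0 t).hasDerivAt.const_smul q.1).const_add q.2
    refine ⟨fun t => q.2 + q.1 • ∫ s in (0 : ℝ)..t,
        v (ψ (projIcc 0 1 zero_le_one s)), by simp, (hψ 1).symm,
        continuous_iff_continuousAt.2 fun t => (hd t).continuousAt, ?_⟩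
    intro t ht
    have := hd t
    rw [projIcc_of_mem zero_le_one ht] at this
    rw [hψ ⟨t, ht⟩] at this
    exact this

variable [FiniteDimensional ℝ E]

/-- The local flow of a smooth vector field on an open subset of `E`, as a map of class `C^n`. -/
lemma exists_local_flow_vectorSpace {v : E → E} {U : Set E} (hU : IsOpen U)
    (hv : ContDiffOn ℝ ∞ v U) {x₀ : E} (hx₀ : x₀ ∈ U) (n : ℕ) :
    ∃ ε > 0, ∃ W : Set E, IsOpen W ∧ x₀ ∈ W ∧ ∃ Φ : ℝ × E → E,
      ContDiffOn ℝ n Φ (Ioo (-ε) ε ×ˢ W) ∧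
      ∀ x ∈ W, Φ (0, x) = x ∧ ∀ s ∈ Ioo (-ε) ε, Φ (s, x) ∈ U ∧
        HasDerivAt (fun s => Φ (s, x)) (v (Φ (s, x))) s := by
  obtain ⟨ρ, hρ, hρU⟩ := Metric.isOpen_iff.1 hU x₀ hx₀
  -- The cut-off makes the field globally smooth and Lipschitz. Nothing changes while the solution
  -- stays in the ball of radius ρ/4, where the bump equals 1.
  let b : ContDiffBump x₀ := ⟨ρ / 4, ρ / 2, by positivity, by linarith⟩
  have hvb : ContDiff ℝ ∞ (fun x => b x • v x) := by
    rw [contDiff_iff_contDiffAt]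
    intro x
    by_cases hx : x ∈ Metric.ball x₀ ρ
    · exact b.contDiffAt.smul (hv.contDiffAt (hU.mem_nhds (hρU hx)))
    · have : (fun x => b x • v x) =ᶠ[𝓝 x] fun _ => 0 := by
        have hcl : IsClosed (Metric.closedBall x₀ (ρ / 2)) := Metric.isClosed_closedBall
        have hx' : x ∈ (Metric.closedBall x₀ (ρ / 2))ᶜ := by
          simp only [Metric.mem_ball, not_lt] at hx
          simp only [mem_compl_iff, Metric.mem_closedBall, not_le]
          linarith
        filter_upwards [hcl.isOpen_compl.mem_nhds hx'] with y hy
        simp only [mem_compl_iff, Metric.mem_closedBall, not_le] at hy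
        have : b y = 0 := b.zero_of_le_dist hy.le
        simp [this]
      exact contDiffAt_const.congr_of_eventuallyEq this
  have hsupp : HasCompactSupport (fun x => b x • v x) := b.hasCompactSupport.smul_right
  obtain ⟨Kc, hK⟩ := ContDiff.lipschitzWith_of_hasCompactSupport (𝕂 := ℝ) hsupp hvb (by simp)
  obtain ⟨g, hg, hgc⟩ := exists_contDiffAt_endpoint hvb x₀ (n + 1) (Nat.succ_ne_zero n)
  obtain ⟨r, hr, ε, hε, hα⟩ :=
    ContDiffAt.exists_forall_mem_closedBall_exists_eq_forall_mem_Ioo_hasDerivAt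
    (hvb.of_le (by exact_mod_cast le_top) : ContDiff ℝ 1 _).contDiffAt (x₀ := x₀) 0
  choose! α hα0 hα using hα
  simp only [zero_sub, zero_add] at hα
  -- Uniqueness identifies the Picard–Lindelöf solution at time s with the time-one value of the
  -- rescaled problem, so the smoothness of `g` passes to α.
  have key : ∀ᶠ q in 𝓝 ((0 : ℝ), x₀), α q.2 q.1 = g q := by
    have h1 : ∀ᶠ q in 𝓝 ((0 : ℝ), x₀), q.1 ∈ Ioo (-ε) ε ∧ q.2 ∈ Metric.closedBall x₀ r := by
      rw [nhds_prod_eq]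
      exact Filter.prod_mem_prod (Ioo_mem_nhds (neg_lt_zero.2 hε) hε)
        (Metric.closedBall_mem_nhds _ hr)
    filter_upwards [hgc, h1] with q hq h1
    obtain ⟨c, hc0, hc1, hcc, hcd⟩ := hq
    have hmem (t : ℝ) (ht : t ∈ Icc (0 : ℝ) 1) : q.1 * t ∈ Ioo (-ε) ε := by
      have : |q.1 * t| ≤ |q.1| := by
        rw [abs_mul, abs_of_nonneg ht.1]
        exact mul_le_of_le_one_right (abs_nonneg _) ht.2
      exact abs_lt.1 (lt_of_le_of_lt this (abs_lt.2 h1.1))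
    have hd (t : ℝ) (ht : t ∈ Icc (0 : ℝ) 1) : HasDerivAt (fun t => α q.2 (q.1 * t))
        (q.1 • (b (α q.2 (q.1 * t)) • v (α q.2 (q.1 * t)))) t := by
      have h2 : HasDerivAt (fun t => q.1 * t) q.1 t := by
        simpa using (hasDerivAt_id t).const_mul q.1
      exact (hα q.2 h1.2 (q.1 * t) (hmem t ht)).scomp t h2
    have := ODE_solution_unique (v := fun _ x => q.1 • (b x • v x)) (K := ‖q.1‖₊ * Kc)
      (f := fun t => α q.2 (q.1 * t)) (g := c) (a := 0) (b := 1)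
      (fun t => (lipschitzWith_smul q.1).comp hK)
      (fun t ht => (hd t ht).continuousAt.continuousWithinAt)
      (fun t ht => (hd t (Ico_subset_Icc_self ht)).hasDerivWithinAt)
      hcc.continuousOn
      (fun t ht => (hcd t (Ico_subset_Icc_self ht)).hasDerivWithinAt)
      (by simp [hc0, hα0 q.2 h1.2])
    have := this (right_mem_Icc.2 zero_le_one)
    simpa [hc1] using this
  let Φ : ℝ × E → E := fun q => α q.2 q.1
  have hΦ : ContDiffAt ℝ (n + 1 : ℕ) Φ (0, x₀) := hg.congr_of_eventuallyEq key
  have hΦ0 : Φ (0, x₀) = x₀ := hα0 x₀ (Metric.mem_closedBall_self hr.le)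
  have hev1 : ∀ᶠ q in 𝓝 ((0 : ℝ), x₀), ContDiffAt ℝ n Φ q :=
    (hΦ.of_le (by exact_mod_cast n.le_succ)).eventually (by simp)
  have hev2 : ∀ᶠ q in 𝓝 ((0 : ℝ), x₀), Φ q ∈ Metric.ball x₀ (ρ / 4) := by
    have := hΦ.continuousAt.tendsto
    rw [hΦ0] at this
    exact this.eventually (Metric.ball_mem_nhds _ (by positivity))
  obtain ⟨δ, hδ, H⟩ := Metric.eventually_nhds_iff_ball.1 (hev1.and hev2)
  have hsub (s : ℝ) (x : E) (hs : s ∈ Ioo (-min δ ε) (min δ ε))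
      (hx : x ∈ Metric.ball x₀ (min δ r)) : (s, x) ∈ Metric.ball ((0 : ℝ), x₀) δ := by
    rw [← ball_prod_same]
    refine ⟨?_, Metric.ball_subset_ball (min_le_left _ _) hx⟩
    rw [Metric.mem_ball, dist_zero_right, Real.norm_eq_abs, abs_lt]
    exact ⟨by linarith [hs.1, min_le_left δ ε], by linarith [hs.2, min_le_left δ ε]⟩
  refine ⟨min δ ε, by positivity, Metric.ball x₀ (min δ r), Metric.isOpen_ball,
    Metric.mem_ball_self (by positivity), Φ, ?_, ?_⟩
  · rintro ⟨s, x⟩ ⟨hs, hx⟩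
    exact (H _ (hsub s x hs hx)).1.contDiffWithinAt
  · intro x hx
    have hxr : x ∈ Metric.closedBall x₀ r :=
      Metric.ball_subset_closedBall (Metric.ball_subset_ball (min_le_right _ _) hx)
    refine ⟨hα0 x hxr, fun s hs => ?_⟩
    have h4 := (H _ (hsub s x hs hx)).2
    refine ⟨hρU (Metric.ball_subset_ball (by linarith) h4), ?_⟩
    have h5 := hα x hxr s ⟨by linarith [hs.1, min_le_right δ ε], by linarith [hs.2, min_le_right δ ε]⟩
    have h6 : b (α x s) = 1 := b.one_of_mem_closedBall (Metric.ball_subset_closedBall h4)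
    rw [h6, one_smul] at h5
    exact h5

end ODE

end SasakiCone

end

noncomputable section

namespace SasakiCone

/-! ### Complex linearity of the spatial derivative of a flow. -/

section ComplexODE

open Set

variable {E : Type*} [NormedAddCommGroup E] [NormedSpace ℂ E]

/-- The local flow of a vector field with complex linear derivative is holomorphic in the space
variable. -/
lemma local_flow_complex_linear {v : E → E} {U : Set E} (hU : IsOpen U)
    (hv : ContDiffOn ℝ ∞ v U)
    (hI : ∀ y ∈ U, ∀ w, fderiv ℝ v y (Complex.I • w) = Complex.I • fderiv ℝ v y w)
    {ε : ℝ} {W : Set E} (hW : IsOpen W) {Φ : ℝ × E → E}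
    (hΦ : ContDiffOn ℝ 2 Φ (Ioo (-ε) ε ×ˢ W))
    (hflow : ∀ x ∈ W, Φ (0, x) = x ∧ ∀ s ∈ Ioo (-ε) ε, Φ (s, x) ∈ U ∧
        HasDerivAt (fun s => Φ (s, x)) (v (Φ (s, x))) s)
    {x : E} (hx : x ∈ W) {s : ℝ} (hs : s ∈ Ioo (-ε) ε) (w : E) :
    fderiv ℝ Φ (s, x) (0, Complex.I • w) = Complex.I • fderiv ℝ Φ (s, x) (0, w) := by
  have hopen : IsOpen (Ioo (-ε) ε ×ˢ W) := isOpen_Ioo.prod hW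
  have hΦat {t : ℝ} {y : E} (ht : t ∈ Ioo (-ε) ε) (hy : y ∈ W) : ContDiffAt ℝ 2 Φ (t, y) :=
    hΦ.contDiffAt (hopen.mem_nhds ⟨ht, hy⟩)
  have hΦd {t : ℝ} {y : E} (ht : t ∈ Ioo (-ε) ε) (hy : y ∈ W) :
      HasFDerivAt Φ (fderiv ℝ Φ (t, y)) (t, y) :=
    ((hΦat ht hy).differentiableAt two_ne_zero).hasFDerivAt
  have hvat {y : E} (hy : y ∈ U) : HasFDerivAt v (fderiv ℝ v y) y :=
    ((hv.contDiffAt (hU.mem_nhds hy)).differentiableAt (by simp)).hasFDerivAt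
  have hspace {t : ℝ} {y : E} (ht : t ∈ Ioo (-ε) ε) (hy : y ∈ W) :
      HasFDerivAt (fun y => Φ (t, y)) ((fderiv ℝ Φ (t, y)).comp (.inr ℝ ℝ E)) y :=
    (hΦd ht hy).comp y (hasFDerivAt_prodMk_right t y)
  have htime {t : ℝ} {y : E} (ht : t ∈ Ioo (-ε) ε) (hy : y ∈ W) :
      fderiv ℝ Φ (t, y) (1, 0) = v (Φ (t, y)) := by
    have h1 : HasDerivAt (fun t => Φ (t, y)) (fderiv ℝ Φ (t, y) (1, 0)) t :=
      (hΦd ht hy).comp_hasDerivAt t ((hasDerivAt_id t).prodMk (hasDerivAt_const t y))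
    exact h1.unique ((hflow y hy).2 t ht).2
  -- The linearized equation along the orbit: the flow equation is differentiated in space and the
  -- two derivatives are exchanged, which uses that Φ is C².
  have hvar (w : E) {t : ℝ} (ht : t ∈ Ioo (-ε) ε) :
      HasDerivAt (fun t => fderiv ℝ Φ (t, x) (0, w))
        (fderiv ℝ v (Φ (t, x)) (fderiv ℝ Φ (t, x) (0, w))) t := by
    set D := fderiv ℝ (fderiv ℝ Φ) (t, x) with hD
    have hDd : HasFDerivAt (fderiv ℝ Φ) D (t, x) :=
      (((hΦat ht hx).fderiv_right (m := 1) (by norm_num)).differentiableAt one_ne_zero).hasFDerivAt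
    have h1 : HasDerivAt (fun t => fderiv ℝ Φ (t, x)) (D (1, 0)) t :=
      hDd.comp_hasDerivAt t ((hasDerivAt_id t).prodMk (hasDerivAt_const t x))
    have h2 : HasDerivAt (fun t => fderiv ℝ Φ (t, x) (0, w)) (D (1, 0) (0, w)) t := by
      simpa using h1.clm_apply (hasDerivAt_const t ((0 : ℝ), w))
    have hsymm : D (1, 0) (0, w) = D (0, w) (1, 0) :=
      (hΦat ht hx).isSymmSndFDerivAt (by simp) _ _
    have h3 : HasFDerivAt (fun y => fderiv ℝ Φ (t, y) (1, 0))
        ((D.comp (.inr ℝ ℝ E)).flip (1, 0)) x := by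
      have := (hDd.comp x (hasFDerivAt_prodMk_right t x)).clm_apply
        (hasFDerivAt_const ((1 : ℝ), (0 : E)) x)
      simpa using this
    have h4 : HasFDerivAt (fun y => v (Φ (t, y)))
        ((fderiv ℝ v (Φ (t, x))).comp ((fderiv ℝ Φ (t, x)).comp (.inr ℝ ℝ E))) x :=
      (hvat ((hflow x hx).2 t ht).1).comp x (hspace ht hx)
    have h5 := h3.unique (h4.congr_of_eventuallyEq (by
      filter_upwards [hW.mem_nhds hx] with y hy using htime ht hy))
    have h6 := congrArg (fun A => A w) h5
    simp only [ContinuousLinearMap.flip_apply, ContinuousLinearMap.comp_apply,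
      ContinuousLinearMap.inr_apply] at h6
    rw [hsymm, h6] at h2
    exact h2
  have hzero (w : E) (h0 : (0 : ℝ) ∈ Ioo (-ε) ε) : fderiv ℝ Φ (0, x) (0, w) = w := by
    have h1 : HasFDerivAt (fun y => Φ (0, y)) (ContinuousLinearMap.id ℝ E) x :=
      (hasFDerivAt_id x).congr_of_eventuallyEq (by
        filter_upwards [hW.mem_nhds hx] with y hy using (hflow y hy).1)
    have h2 := congrArg (fun A => A w) ((hspace h0 hx).unique h1)
    simpa using h2
  obtain ⟨ε', hsε', hε'⟩ := exists_between (abs_lt.2 hs)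
  have hsub : Icc (-ε') ε' ⊆ Ioo (-ε) ε := fun t ht => ⟨by linarith [ht.1], by linarith [ht.2]⟩
  have hε'0 : 0 < ε' := (abs_nonneg s).trans_lt hsε'
  have hcont : ContinuousOn (fun t => ‖fderiv ℝ v (Φ (t, x))‖) (Icc (-ε') ε') := by
    intro t ht
    have h1 : ContinuousAt (fderiv ℝ v) (Φ (t, x)) :=
      ((hv.contDiffAt (hU.mem_nhds ((hflow x hx).2 t (hsub ht)).1)).fderiv_right
        (m := 0) (by simp)).continuousAt
    have h2 : ContinuousAt (fun t => Φ (t, x)) t := ((hflow x hx).2 t (hsub ht)).2.continuousAt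
    exact (ContinuousAt.comp (f := fun t => Φ (t, x)) h1 h2).norm.continuousWithinAt
  obtain ⟨C, hC⟩ := isCompact_Icc.bddAbove_image hcont
  have hlip (t : ℝ) (ht : t ∈ Ioo (-ε') ε') :
      LipschitzOnWith C.toNNReal (fun a => fderiv ℝ v (Φ (t, x)) a) univ := by
    have h1 := (fderiv ℝ v (Φ (t, x))).lipschitz.weaken (K' := C.toNNReal) (by
      rw [← NNReal.coe_le_coe]
      exact (hC ⟨t, Ioo_subset_Icc_self ht, rfl⟩).trans (Real.le_coe_toNNReal C))
    exact h1.lipschitzOnWith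
  have hlt := abs_lt.1 hsε'
  -- Since dv is complex linear, both curves solve the linearized equation, and they have the same
  -- value at time 0.
  have := ODE_solution_unique_of_mem_Ioo (v := fun t a => fderiv ℝ v (Φ (t, x)) a)
    (s := fun _ => univ) (a := -ε') (b := ε') (t₀ := 0)
    (f := fun t => fderiv ℝ Φ (t, x) (0, Complex.I • w))
    (g := fun t => Complex.I • fderiv ℝ Φ (t, x) (0, w)) hlip ⟨by linarith, hε'0⟩
    (fun t ht => ⟨hvar _ (hsub (Ioo_subset_Icc_self ht)), trivial⟩)
    (fun t ht => ⟨by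
      have h1 := (hvar w (hsub (Ioo_subset_Icc_self ht))).const_smul Complex.I
      rw [← hI _ ((hflow x hx).2 t (hsub (Ioo_subset_Icc_self ht))).1] at h1
      exact h1, trivial⟩)
    (by
      have h0 : (0 : ℝ) ∈ Ioo (-ε) ε := hsub ⟨by linarith, hε'0.le⟩
      simp only [hzero _ h0])
  exact this ⟨hlt.1, hlt.2⟩

end ComplexODE

/-! ### The real manifold underlying a complex manifold. -/

section RealStructure

variable {E : Type*} [NormedAddCommGroup E] [NormedSpace ℂ E]
variable {V : Type*} [TopologicalSpace V] [ChartedSpace E V]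
variable {E' : Type*} [NormedAddCommGroup E'] [NormedSpace ℂ E']
variable {V' : Type*} [TopologicalSpace V'] [ChartedSpace E' V']

/-- The real smooth manifold underlying a complex manifold. -/
instance isManifold_real [IsManifold 𝓘(ℂ, E) ω V] : IsManifold 𝓘(ℝ, E) ∞ V := by
  refine isManifold_of_contDiffOn _ _ _ fun e e' he he' => ?_
  have h := (contDiffGroupoid ω 𝓘(ℂ, E)).compatible he he'
  rw [contDiffGroupoid, mem_groupoid_of_pregroupoid] at h
  have h2 : ContDiffOn ℂ ω (𝓘(ℂ, E) ∘ (e.symm ≫ₕ e') ∘ 𝓘(ℂ, E).symm)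
    (𝓘(ℂ, E).symm ⁻¹' (e.symm ≫ₕ e').source ∩ Set.range 𝓘(ℂ, E)) := h.1
  exact (h2.restrict_scalars ℝ).of_le le_top

@[simp] lemma J_apply (v : E) : (J : E →L[ℝ] E) v = Complex.I • v := rfl

lemma J_J (v : E) : (J : E →L[ℝ] E) (J v) = -v := by
  simp [smul_smul]

/-- The real differential of a holomorphic map commutes with `J`. -/
lemma diff_J_of_mdifferentiableAt {f : V → V'} {p : V}
    (hf : MDifferentiableAt 𝓘(ℂ, E) 𝓘(ℂ, E') f p) (v : E) :
    diff E E' f p (J v) = J (diff E E' f p v) := by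
  have h := hf.hasMFDerivAt
  set A : E →L[ℂ] E' := mfderiv 𝓘(ℂ, E) 𝓘(ℂ, E') f p with hA
  have h2 : HasMFDerivAt 𝓘(ℝ, E) 𝓘(ℝ, E') f p (A.restrictScalars ℝ : E →L[ℝ] E') :=
    ⟨h.1, HasFDerivWithinAt.restrictScalars ℝ (f' := A) h.2⟩
  have h3 : diff E E' f p = A.restrictScalars ℝ := h2.mfderiv
  rw [h3]
  simp

end RealStructure

end SasakiCone

end

noncomputable section

set_option linter.unusedSectionVars false

namespace SasakiCone

/-! ### Differentials, pullbacks and the exterior derivative in charts. -/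

section Calculus

variable {F : Type*} [NormedAddCommGroup F] [NormedSpace ℝ F]
variable {F' : Type*} [NormedAddCommGroup F'] [NormedSpace ℝ F']
variable {F'' : Type*} [NormedAddCommGroup F''] [NormedSpace ℝ F'']
variable {M : Type*} [TopologicalSpace M] [ChartedSpace F M]
variable {M' : Type*} [TopologicalSpace M'] [ChartedSpace F' M']
variable {M'' : Type*} [TopologicalSpace M''] [ChartedSpace F'' M'']

lemma diff_comp {g : M' → M''} {f : M → M'} {x : M}
    (hg : MDifferentiableAt 𝓘(ℝ, F') 𝓘(ℝ, F'') g (f x))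
    (hf : MDifferentiableAt 𝓘(ℝ, F) 𝓘(ℝ, F') f x) :
    diff F F'' (fun x => g (f x)) x = (diff F' F'' g (f x)).comp (diff F F' f x) :=
  mfderiv_comp x hg hf

lemma diff_comp_apply {g : M' → M''} {f : M → M'} {x : M}
    (hg : MDifferentiableAt 𝓘(ℝ, F') 𝓘(ℝ, F'') g (f x))
    (hf : MDifferentiableAt 𝓘(ℝ, F) 𝓘(ℝ, F') f x) (v : F) :
    diff F F'' (fun x => g (f x)) x v = diff F' F'' g (f x) (diff F F' f x v) := by
  rw [diff_comp hg hf]; rfl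

lemma diff_congr {f g : M → M'} {x : M} (h : f =ᶠ[𝓝 x] g) : diff F F' f x = diff F F' g x :=
  h.mfderiv_eq

lemma diff_id (x : M) : diff F F (fun x : M => x) x = ContinuousLinearMap.id ℝ F :=
  mfderiv_id

lemma diff_const (c : M') (x : M) : diff F F' (fun _ : M => c) x = 0 :=
  mfderiv_const

lemma diff_eq_fderiv (f : F → F') (x : F) : diff F F' f x = fderiv ℝ f x :=
  mfderiv_eq_fderiv

lemma mdiffAt {f : M → M'} (hf : ContMDiff 𝓘(ℝ, F) 𝓘(ℝ, F') ∞ f) (x : M) :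
    MDifferentiableAt 𝓘(ℝ, F) 𝓘(ℝ, F') f x :=
  (hf x).mdifferentiableAt (by simp)

/-- The derivative of a function along a curve. -/
lemma hasDerivAt_comp_curve {f : M → ℝ} {γ : ℝ → M} {t : ℝ}
    (hf : MDifferentiableAt 𝓘(ℝ, F) 𝓘(ℝ, ℝ) f (γ t))
    (hγ : MDifferentiableAt 𝓘(ℝ, ℝ) 𝓘(ℝ, F) γ t) :
    HasDerivAt (fun s => f (γ s)) (diff F ℝ f (γ t) (diff ℝ F γ t 1)) t := by
  have h := (hf.hasMFDerivAt.comp t hγ.hasMFDerivAt)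
  have h2 : HasFDerivAt (fun s => f (γ s)) ((diff F ℝ f (γ t)).comp (diff ℝ F γ t)) t :=
    hasMFDerivAt_iff_hasFDerivAt.1 h
  exact h2.hasDerivAt

variable [IsManifold 𝓘(ℝ, F) ∞ M] [IsManifold 𝓘(ℝ, F') ∞ M'] [IsManifold 𝓘(ℝ, F'') ∞ M'']

lemma diff_extChartAt_self (x : M) :
    diff F F (extChartAt 𝓘(ℝ, F) x) x = ContinuousLinearMap.id ℝ F :=
  mfderiv_extChartAt_self

lemma mdiffAt_extChartAt {x₀ x : M} (hx : x ∈ (extChartAt 𝓘(ℝ, F) x₀).source) :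
    MDifferentiableAt 𝓘(ℝ, F) 𝓘(ℝ, F) (extChartAt 𝓘(ℝ, F) x₀) x :=
  mdifferentiableAt_extChartAt (by simpa using hx)

lemma contMDiffAt_extChartAt_symm {x₀ : M} {y : F} (hy : y ∈ (extChartAt 𝓘(ℝ, F) x₀).target) :
    ContMDiffAt 𝓘(ℝ, F) 𝓘(ℝ, F) ∞ (extChartAt 𝓘(ℝ, F) x₀).symm y :=
  (contMDiffOn_extChartAt_symm x₀).contMDiffAt ((isOpen_extChartAt_target x₀).mem_nhds hy)

lemma mdiffAt_extChartAt_symm {x₀ : M} {y : F} (hy : y ∈ (extChartAt 𝓘(ℝ, F) x₀).target) :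
    MDifferentiableAt 𝓘(ℝ, F) 𝓘(ℝ, F) (extChartAt 𝓘(ℝ, F) x₀).symm y :=
  (contMDiffAt_extChartAt_symm hy).mdifferentiableAt (by simp)

lemma diff_extChartAt_symm_diff {x₀ x : M} (hx : x ∈ (extChartAt 𝓘(ℝ, F) x₀).source) (v : F) :
    diff F F (extChartAt 𝓘(ℝ, F) x₀).symm (extChartAt 𝓘(ℝ, F) x₀ x)
      (diff F F (extChartAt 𝓘(ℝ, F) x₀) x v) = v := by
  have hy := (extChartAt 𝓘(ℝ, F) x₀).map_source hx
  rw [← diff_comp_apply (mdiffAt_extChartAt_symm hy) (mdiffAt_extChartAt hx),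
    diff_congr (g := fun x => x) (by
      filter_upwards [(isOpen_extChartAt_source x₀).mem_nhds hx] with z hz
      exact (extChartAt 𝓘(ℝ, F) x₀).left_inv hz), diff_id]
  rfl

/-- The expression of a smooth map in two charts is smooth. -/
lemma contDiffAt_inCharts {f : M → M'} {x₀ : M} {z₀ : M'} {y : F} {n : WithTop ℕ∞} (hn : n ≤ ∞)
    (hy : y ∈ (extChartAt 𝓘(ℝ, F) x₀).target)
    (hf : ContMDiffAt 𝓘(ℝ, F) 𝓘(ℝ, F') n f ((extChartAt 𝓘(ℝ, F) x₀).symm y))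
    (hz : f ((extChartAt 𝓘(ℝ, F) x₀).symm y) ∈ (extChartAt 𝓘(ℝ, F') z₀).source) :
    ContDiffAt ℝ n (fun y => extChartAt 𝓘(ℝ, F') z₀ (f ((extChartAt 𝓘(ℝ, F) x₀).symm y))) y := by
  rw [← contMDiffAt_iff_contDiffAt]
  have h1 : ContMDiffAt 𝓘(ℝ, F') 𝓘(ℝ, F') n (extChartAt 𝓘(ℝ, F') z₀)
      (f ((extChartAt 𝓘(ℝ, F) x₀).symm y)) :=
    (contMDiffAt_extChartAt' (n := ∞) (by simpa using hz)).of_le hn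
  exact h1.comp y (hf.comp y ((contMDiffAt_extChartAt_symm hy).of_le hn))

/-- The expression of a smooth function in a chart is smooth. -/
lemma contDiffAt_comp_extChartAt_symm {f : M → F'} {x₀ : M} {y : F} {n : WithTop ℕ∞} (hn : n ≤ ∞)
    (hy : y ∈ (extChartAt 𝓘(ℝ, F) x₀).target)
    (hf : ContMDiffAt 𝓘(ℝ, F) 𝓘(ℝ, F') n f ((extChartAt 𝓘(ℝ, F) x₀).symm y)) :
    ContDiffAt ℝ n (fun y => f ((extChartAt 𝓘(ℝ, F) x₀).symm y)) y := by
  rw [← contMDiffAt_iff_contDiffAt]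
  exact hf.comp y ((contMDiffAt_extChartAt_symm hy).of_le hn)

namespace OneForm

/-- The antisymmetrized derivative of a family of linear forms. -/
def alt (D : F →L[ℝ] F →L[ℝ] ℝ) (v w : F) : ℝ := D v w - D w v

lemma extDer_eq (α : OneForm F M) (x : M) (v w : F) :
    OneForm.extDer α x v w =
      alt (fderiv ℝ (OneForm.inChart α x) (extChartAt 𝓘(ℝ, F) x x)) v w := by
  simp only [OneForm.extDer, alt, diff_extChartAt_self]
  rfl

/-- The extra term in the derivative of the pullback is β applied to the second derivative of `g`;
it is symmetric, so antisymmetrization removes it. -/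
lemma alt_fderiv_pullback {g : F → F'} {β : F' → F' →L[ℝ] ℝ} {y : F} (hg : ContDiffAt ℝ 2 g y)
    (hβ : DifferentiableAt ℝ β (g y)) (v w : F) :
    alt (fderiv ℝ (fun y => (β (g y)).comp (fderiv ℝ g y)) y) v w =
      alt (fderiv ℝ β (g y)) (fderiv ℝ g y v) (fderiv ℝ g y w) := by
  have hg1 : HasFDerivAt g (fderiv ℝ g y) y := (hg.differentiableAt two_ne_zero).hasFDerivAt
  have hg2 : HasFDerivAt (fderiv ℝ g) (fderiv ℝ (fderiv ℝ g) y) y :=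
    ((hg.fderiv_right (m := 1) (by norm_num)).differentiableAt one_ne_zero).hasFDerivAt
  have h := (hβ.hasFDerivAt.comp y hg1).clm_comp hg2
  have hs := hg.isSymmSndFDerivAt (by simp) v w
  have h' := h.fderiv
  simp only [Function.comp_def] at h'
  rw [h']
  simp only [alt, add_apply, ContinuousLinearMap.comp_apply,
    ContinuousLinearMap.compL_apply, ContinuousLinearMap.flip_apply]
  rw [hs]
  ring

lemma inChart_pullback {f : M → M'} (hf : ContMDiff 𝓘(ℝ, F) 𝓘(ℝ, F') ∞ f) (β : OneForm F' M')
    {x₀ : M} {z₀ : M'} {y : F} (hy : y ∈ (extChartAt 𝓘(ℝ, F) x₀).target)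
    (hz : f ((extChartAt 𝓘(ℝ, F) x₀).symm y) ∈ (extChartAt 𝓘(ℝ, F') z₀).source) :
    OneForm.inChart (OneForm.pullback f β) x₀ y =
      (OneForm.inChart β z₀ (extChartAt 𝓘(ℝ, F') z₀ (f ((extChartAt 𝓘(ℝ, F) x₀).symm y)))).comp
        (fderiv ℝ (fun y => extChartAt 𝓘(ℝ, F') z₀ (f ((extChartAt 𝓘(ℝ, F) x₀).symm y))) y) := by
  ext v
  simp only [OneForm.inChart, OneForm.pullback, ContinuousLinearMap.comp_apply]
  rw [PartialEquiv.left_inv _ hz]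
  congr 1
  have hfy := mdiffAt hf ((extChartAt 𝓘(ℝ, F) x₀).symm y)
  have h1 : MDifferentiableAt 𝓘(ℝ, F) 𝓘(ℝ, F')
      (fun y => f ((extChartAt 𝓘(ℝ, F) x₀).symm y)) y := hfy.comp y (mdiffAt_extChartAt_symm hy)
  rw [← diff_eq_fderiv, diff_comp_apply (f := fun y => f ((extChartAt 𝓘(ℝ, F) x₀).symm y)) (mdiffAt_extChartAt hz) h1,
    diff_extChartAt_symm_diff hz, diff_comp_apply hfy (mdiffAt_extChartAt_symm hy)]

lemma IsSmooth.pullback {f : M → M'} (hf : ContMDiff 𝓘(ℝ, F) 𝓘(ℝ, F') ∞ f) {β : OneForm F' M'}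
    (hβ : OneForm.IsSmooth β) : OneForm.IsSmooth (OneForm.pullback f β : OneForm F M) := by
  intro x₀ y hy
  let z₀ : M' := f ((extChartAt 𝓘(ℝ, F) x₀).symm y)
  have hz : f ((extChartAt 𝓘(ℝ, F) x₀).symm y) ∈ (extChartAt 𝓘(ℝ, F') z₀).source := by
    exact mem_extChartAt_source z₀
  have hg := contDiffAt_inCharts le_rfl hy (hf _) hz
  have hev : ∀ᶠ y' in 𝓝 y, y' ∈ (extChartAt 𝓘(ℝ, F) x₀).target ∧
      f ((extChartAt 𝓘(ℝ, F) x₀).symm y') ∈ (extChartAt 𝓘(ℝ, F') z₀).source := by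
    refine Filter.Eventually.and ((isOpen_extChartAt_target x₀).mem_nhds hy) ?_
    have hc : ContinuousAt (fun y => f ((extChartAt 𝓘(ℝ, F) x₀).symm y)) y :=
      ContinuousAt.comp (f := (extChartAt 𝓘(ℝ, F) x₀).symm) hf.continuous.continuousAt
        (contMDiffAt_extChartAt_symm hy).continuousAt
    exact hc.eventually ((isOpen_extChartAt_source z₀).mem_nhds hz)
  have hβ' : ContDiffAt ℝ ∞ (OneForm.inChart β z₀)
      (extChartAt 𝓘(ℝ, F') z₀ (f ((extChartAt 𝓘(ℝ, F) x₀).symm y))) :=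
    (hβ z₀).contDiffAt ((isOpen_extChartAt_target z₀).mem_nhds
      ((extChartAt 𝓘(ℝ, F') z₀).map_source hz))
  have h2 := (hβ'.comp y hg).clm_comp (hg.fderiv_right (m := ∞) (by simp))
  refine (h2.congr_of_eventuallyEq ?_).contDiffWithinAt
  filter_upwards [hev] with y' hy'
  exact inChart_pullback hf β hy'.1 hy'.2

/-- The exterior derivative commutes with pullback, and can be computed in any chart. -/
lemma extDer_pullback_chart {f : M → M'} (hf : ContMDiff 𝓘(ℝ, F) 𝓘(ℝ, F') ∞ f) {β : OneForm F' M'}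
    (hβ : OneForm.IsSmooth β) {x : M} {z₀ : M'} (hz : f x ∈ (extChartAt 𝓘(ℝ, F') z₀).source)
    (v w : F) :
    OneForm.extDer (OneForm.pullback f β) x v w =
      alt (fderiv ℝ (OneForm.inChart β z₀) (extChartAt 𝓘(ℝ, F') z₀ (f x)))
        (diff F' F' (extChartAt 𝓘(ℝ, F') z₀) (f x) (diff F F' f x v))
        (diff F' F' (extChartAt 𝓘(ℝ, F') z₀) (f x) (diff F F' f x w)) := by
  rw [extDer_eq]
  set y := extChartAt 𝓘(ℝ, F) x x with hy'
  have hy : y ∈ (extChartAt 𝓘(ℝ, F) x).target := mem_extChartAt_target x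
  have hsymm : (extChartAt 𝓘(ℝ, F) x).symm y = x := extChartAt_to_inv x
  have hz' : f ((extChartAt 𝓘(ℝ, F) x).symm y) ∈ (extChartAt 𝓘(ℝ, F') z₀).source := by
    rwa [hsymm]
  have hg := contDiffAt_inCharts le_rfl hy (hf _) hz'
  have hev : ∀ᶠ y' in 𝓝 y, y' ∈ (extChartAt 𝓘(ℝ, F) x).target ∧
      f ((extChartAt 𝓘(ℝ, F) x).symm y') ∈ (extChartAt 𝓘(ℝ, F') z₀).source := by
    refine Filter.Eventually.and ((isOpen_extChartAt_target x).mem_nhds hy) ?_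
    have hc : ContinuousAt (fun y => f ((extChartAt 𝓘(ℝ, F) x).symm y)) y :=
      ContinuousAt.comp (f := (extChartAt 𝓘(ℝ, F) x).symm) hf.continuous.continuousAt
        (contMDiffAt_extChartAt_symm hy).continuousAt
    exact hc.eventually ((isOpen_extChartAt_source z₀).mem_nhds hz')
  have hβ' : ContDiffAt ℝ ∞ (OneForm.inChart β z₀)
      (extChartAt 𝓘(ℝ, F') z₀ (f ((extChartAt 𝓘(ℝ, F) x).symm y))) :=
    (hβ z₀).contDiffAt ((isOpen_extChartAt_target z₀).mem_nhds
      ((extChartAt 𝓘(ℝ, F') z₀).map_source hz'))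
  have h1 : OneForm.inChart (OneForm.pullback f β) x =ᶠ[𝓝 y] fun y =>
      (OneForm.inChart β z₀ (extChartAt 𝓘(ℝ, F') z₀ (f ((extChartAt 𝓘(ℝ, F) x).symm y)))).comp
        (fderiv ℝ (fun y => extChartAt 𝓘(ℝ, F') z₀ (f ((extChartAt 𝓘(ℝ, F) x).symm y))) y) := by
    filter_upwards [hev] with y' hy'
    exact inChart_pullback hf β hy'.1 hy'.2
  rw [h1.fderiv_eq, alt_fderiv_pullback (hg.of_le (WithTop.coe_le_coe.2 le_top))
    (hβ'.differentiableAt (by simp))]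
  have hd (v : F) : fderiv ℝ (fun y => extChartAt 𝓘(ℝ, F') z₀ (f ((extChartAt 𝓘(ℝ, F) x).symm y))) y v
      = diff F' F' (extChartAt 𝓘(ℝ, F') z₀) (f x) (diff F F' f x v) := by
    have hfy := mdiffAt hf ((extChartAt 𝓘(ℝ, F) x).symm y)
    have h1 : MDifferentiableAt 𝓘(ℝ, F) 𝓘(ℝ, F')
      (fun y => f ((extChartAt 𝓘(ℝ, F) x).symm y)) y := hfy.comp y (mdiffAt_extChartAt_symm hy)
    have h3 : diff F F (extChartAt 𝓘(ℝ, F) x).symm y v = v := by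
      have := diff_extChartAt_symm_diff (mem_extChartAt_source (I := 𝓘(ℝ, F)) x) v
      rwa [diff_extChartAt_self] at this
    rw [← diff_eq_fderiv, diff_comp_apply (f := fun y => f ((extChartAt 𝓘(ℝ, F) x).symm y)) (mdiffAt_extChartAt hz') h1,
      diff_comp_apply hfy (mdiffAt_extChartAt_symm hy), h3, hsymm]
  rw [hd v, hd w, hsymm]

lemma extDer_pullback {f : M → M'} (hf : ContMDiff 𝓘(ℝ, F) 𝓘(ℝ, F') ∞ f) {β : OneForm F' M'}
    (hβ : OneForm.IsSmooth β) (x : M) (v w : F) :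
    OneForm.extDer (OneForm.pullback f β) x v w =
      OneForm.extDer β (f x) (diff F F' f x v) (diff F F' f x w) := by
  rw [extDer_pullback_chart hf hβ (mem_extChartAt_source (f x)), extDer_eq]
  simp only [diff_extChartAt_self]
  rfl

lemma pullback_id (α : OneForm F M) : OneForm.pullback (fun x : M => x) α = α := by
  funext x
  ext v
  simp only [OneForm.pullback, diff_id]
  rfl

lemma extDer_eq_chart {α : OneForm F M} (hα : OneForm.IsSmooth α) {x x₀ : M}
    (hx : x ∈ (extChartAt 𝓘(ℝ, F) x₀).source) (v w : F) :
    OneForm.extDer α x v w =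
      alt (fderiv ℝ (OneForm.inChart α x₀) (extChartAt 𝓘(ℝ, F) x₀ x))
        (diff F F (extChartAt 𝓘(ℝ, F) x₀) x v) (diff F F (extChartAt 𝓘(ℝ, F) x₀) x w) := by
  have h := extDer_pullback_chart (f := fun x : M => x) contMDiff_id hα hx v w
  simp only [diff_id] at h
  rw [pullback_id] at h
  exact h

lemma inChart_smul (h : M → ℝ) (α : OneForm F M) (x₀ : M) :
    OneForm.inChart (fun p => h p • α p : OneForm F M) x₀ =
      fun y => h ((extChartAt 𝓘(ℝ, F) x₀).symm y) • OneForm.inChart α x₀ y := by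
  funext y
  simp [OneForm.inChart, ContinuousLinearMap.smul_comp]

lemma IsSmooth.smul {h : M → ℝ} (hh : ContMDiff 𝓘(ℝ, F) 𝓘(ℝ, ℝ) ∞ h) {α : OneForm F M}
    (hα : OneForm.IsSmooth α) : OneForm.IsSmooth (fun p => h p • α p : OneForm F M) := by
  intro x₀ y hy
  rw [inChart_smul]
  exact (contDiffAt_comp_extChartAt_symm le_rfl hy (hh _)).contDiffWithinAt.smul (hα x₀ y hy)

lemma extDer_smul {h : M → ℝ} (hh : ContMDiff 𝓘(ℝ, F) 𝓘(ℝ, ℝ) ∞ h) {α : OneForm F M}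
    (hα : OneForm.IsSmooth α) (x : M) (v w : F) :
    OneForm.extDer (fun p => h p • α p : OneForm F M) x v w =
      diff F ℝ h x v * α x w - diff F ℝ h x w * α x v + h x * OneForm.extDer α x v w := by
  rw [extDer_eq, extDer_eq, inChart_smul]
  set y := extChartAt 𝓘(ℝ, F) x x with hy'
  have hy : y ∈ (extChartAt 𝓘(ℝ, F) x).target := mem_extChartAt_target x
  have hsymm : (extChartAt 𝓘(ℝ, F) x).symm y = x := extChartAt_to_inv x
  have h3 (v : F) : diff F F (extChartAt 𝓘(ℝ, F) x).symm y v = v := by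
    have := diff_extChartAt_symm_diff (mem_extChartAt_source (I := 𝓘(ℝ, F)) x) v
    rwa [diff_extChartAt_self] at this
  have h1 := (contDiffAt_comp_extChartAt_symm le_rfl hy (hh _)).differentiableAt (by simp)
  have h2 : DifferentiableAt ℝ (OneForm.inChart α x) y :=
    ((hα x).contDiffAt ((isOpen_extChartAt_target x).mem_nhds hy)).differentiableAt (by simp)
  have hd (v : F) : fderiv ℝ (fun y => h ((extChartAt 𝓘(ℝ, F) x).symm y)) y v = diff F ℝ h x v := by
    rw [← diff_eq_fderiv, diff_comp_apply (mdiffAt hh _) (mdiffAt_extChartAt_symm hy), h3, hsymm]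
  have hα' (v : F) : OneForm.inChart α x y v = α x v := by
    simp only [OneForm.inChart, ContinuousLinearMap.comp_apply, h3, hsymm]
  rw [fderiv_fun_smul h1 h2]
  simp only [alt, add_apply, smul_apply,
    ContinuousLinearMap.smulRight_apply, hd, hα', hsymm, smul_eq_mul]
  ring

end OneForm

end Calculus

end SasakiCone

end

noncomputable section

set_option linter.unusedSectionVars false

namespace SasakiCone

section Bilinear

variable {F : Type*} [NormedAddCommGroup F] [NormedSpace ℝ F]
variable {M : Type*} [TopologicalSpace M] [ChartedSpace F M]

lemma extDer_add_left (α : OneForm F M) (x : M) (v v' w : F) :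
    OneForm.extDer α x (v + v') w = OneForm.extDer α x v w + OneForm.extDer α x v' w := by
  simp only [OneForm.extDer, map_add, add_apply]
  ring

lemma extDer_smul_left (α : OneForm F M) (x : M) (c : ℝ) (v w : F) :
    OneForm.extDer α x (c • v) w = c * OneForm.extDer α x v w := by
  simp only [OneForm.extDer, map_smul, smul_apply, smul_eq_mul]
  ring

lemma extDer_swap (α : OneForm F M) (x : M) (v w : F) :
    OneForm.extDer α x v w = -OneForm.extDer α x w v := by
  simp only [OneForm.extDer]
  ring

end Bilinear

/-! ### The Levi form and holomorphic vector fields. -/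

section Levi

variable {E : Type*} [NormedAddCommGroup E] [NormedSpace ℂ E]
variable {V : Type*} [TopologicalSpace V] [ChartedSpace E V] [IsManifold 𝓘(ℂ, E) ω V]

/-- The preferred chart is the same map over ℝ and over ℂ, and over ℂ it is holomorphic. -/
lemma diff_extChartAt_J {x₀ x : V} (hx : x ∈ (extChartAt 𝓘(ℝ, E) x₀).source) (v : E) :
    diff E E (extChartAt 𝓘(ℝ, E) x₀) x (J v) = J (diff E E (extChartAt 𝓘(ℝ, E) x₀) x v) := by
  have h : MDifferentiableAt 𝓘(ℂ, E) 𝓘(ℂ, E) (extChartAt 𝓘(ℂ, E) x₀) x :=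
    mdifferentiableAt_extChartAt (by simpa using hx)
  exact diff_J_of_mdifferentiableAt (f := extChartAt 𝓘(ℂ, E) x₀) h v

lemma diff_extChartAt_symm_J {x₀ : V} {y : E} (hy : y ∈ (extChartAt 𝓘(ℝ, E) x₀).target) (v : E) :
    diff E E (extChartAt 𝓘(ℝ, E) x₀).symm y (J v) =
      J (diff E E (extChartAt 𝓘(ℝ, E) x₀).symm y v) := by
  have h : MDifferentiableAt 𝓘(ℂ, E) 𝓘(ℂ, E) (extChartAt 𝓘(ℂ, E) x₀).symm y :=
    ((contMDiffOn_extChartAt_symm (I := 𝓘(ℂ, E)) (n := ω) x₀).contMDiffAt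
      ((isOpen_extChartAt_target (I := 𝓘(ℂ, E)) x₀).mem_nhds hy)).mdifferentiableAt (by simp)
  exact diff_J_of_mdifferentiableAt (f := (extChartAt 𝓘(ℂ, E) x₀).symm) h v

lemma fderiv_comp_extChartAt_symm {f : V → ℝ} (hf : ContMDiff 𝓘(ℝ, E) 𝓘(ℝ, ℝ) ∞ f) {x₀ : V} {y : E}
    (hy : y ∈ (extChartAt 𝓘(ℝ, E) x₀).target) (v : E) :
    fderiv ℝ (fun y => f ((extChartAt 𝓘(ℝ, E) x₀).symm y)) y v =
      diff E ℝ f ((extChartAt 𝓘(ℝ, E) x₀).symm y)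
        (diff E E (extChartAt 𝓘(ℝ, E) x₀).symm y v) := by
  rw [← diff_eq_fderiv, diff_comp_apply (mdiffAt hf _) (mdiffAt_extChartAt_symm hy)]

lemma dc_apply (f : V → ℝ) (p : V) (v : E) : dc E f p v = -diff E ℝ f p (J v) := rfl

lemma inChart_dc {f : V → ℝ} (hf : ContMDiff 𝓘(ℝ, E) 𝓘(ℝ, ℝ) ∞ f) {x₀ : V} {y : E}
    (hy : y ∈ (extChartAt 𝓘(ℝ, E) x₀).target) :
    OneForm.inChart (dc E f) x₀ y =
      -(fderiv ℝ (fun y => f ((extChartAt 𝓘(ℝ, E) x₀).symm y)) y).comp J := by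
  ext v
  simp only [OneForm.inChart, ContinuousLinearMap.comp_apply, neg_apply]
  rw [dc_apply, fderiv_comp_extChartAt_symm hf hy, diff_extChartAt_symm_J hy]

lemma isSmooth_dc {f : V → ℝ} (hf : ContMDiff 𝓘(ℝ, E) 𝓘(ℝ, ℝ) ∞ f) :
    OneForm.IsSmooth (dc E f) := by
  intro x₀ y hy
  have h1 := (contDiffAt_comp_extChartAt_symm le_rfl hy (hf _)).fderiv_right (m := ∞) (by simp)
  have h2 := (h1.clm_comp (contDiffAt_const (c := (J : E →L[ℝ] E)))).neg
  refine (h2.congr_of_eventuallyEq ?_).contDiffWithinAt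
  filter_upwards [(isOpen_extChartAt_target x₀).mem_nhds hy] with y' hy'
  exact inChart_dc hf hy'

/-- The second derivative of a function in a chart. -/
def chartHess (f : V → ℝ) (x₀ : V) (y : E) : E →L[ℝ] E →L[ℝ] ℝ :=
  fderiv ℝ (fderiv ℝ (fun y => f ((extChartAt 𝓘(ℝ, E) x₀).symm y))) y

lemma chartHess_symm {f : V → ℝ} (hf : ContMDiff 𝓘(ℝ, E) 𝓘(ℝ, ℝ) ∞ f) {x₀ : V} {y : E}
    (hy : y ∈ (extChartAt 𝓘(ℝ, E) x₀).target) (v w : E) :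
    chartHess f x₀ y v w = chartHess f x₀ y w v :=
  (contDiffAt_comp_extChartAt_symm le_rfl hy (hf _)).isSymmSndFDerivAt
    (by rw [minSmoothness_of_isRCLikeNormedField]; exact WithTop.coe_le_coe.2 le_top) v w

/-- The form `d d^c f` in a chart. -/
lemma extDer_dc_chart {f : V → ℝ} (hf : ContMDiff 𝓘(ℝ, E) 𝓘(ℝ, ℝ) ∞ f) {x₀ x : V}
    (hx : x ∈ (extChartAt 𝓘(ℝ, E) x₀).source) (v w : E) :
    OneForm.extDer (dc E f) x v w =
      chartHess f x₀ (extChartAt 𝓘(ℝ, E) x₀ x) (diff E E (extChartAt 𝓘(ℝ, E) x₀) x w)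
          (J (diff E E (extChartAt 𝓘(ℝ, E) x₀) x v)) -
        chartHess f x₀ (extChartAt 𝓘(ℝ, E) x₀ x) (diff E E (extChartAt 𝓘(ℝ, E) x₀) x v)
          (J (diff E E (extChartAt 𝓘(ℝ, E) x₀) x w)) := by
  rw [OneForm.extDer_eq_chart (isSmooth_dc hf) hx]
  set y := extChartAt 𝓘(ℝ, E) x₀ x
  have hy : y ∈ (extChartAt 𝓘(ℝ, E) x₀).target := (extChartAt 𝓘(ℝ, E) x₀).map_source hx
  have h1 : HasFDerivAt (fderiv ℝ (fun y => f ((extChartAt 𝓘(ℝ, E) x₀).symm y)))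
      (chartHess f x₀ y) y :=
    (((contDiffAt_comp_extChartAt_symm le_rfl hy (hf _)).fderiv_right
      (m := ∞) (by simp)).differentiableAt (by simp)).hasFDerivAt
  have h2 := (h1.clm_comp (hasFDerivAt_const (J : E →L[ℝ] E) y)).neg
  have h3 := (h2.congr_of_eventuallyEq (f₁ := OneForm.inChart (dc E f) x₀) (by
    filter_upwards [(isOpen_extChartAt_target x₀).mem_nhds hy] with y' hy'
    exact inChart_dc hf hy')).fderiv
  rw [h3]
  simp [OneForm.alt]
  ring

lemma extDer_dc {f : V → ℝ} (hf : ContMDiff 𝓘(ℝ, E) 𝓘(ℝ, ℝ) ∞ f) (x : V) (v w : E) :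
    OneForm.extDer (dc E f) x v w =
      chartHess f x (extChartAt 𝓘(ℝ, E) x x) w (J v) -
        chartHess f x (extChartAt 𝓘(ℝ, E) x x) v (J w) := by
  rw [extDer_dc_chart hf (mem_extChartAt_source x)]
  simp only [diff_extChartAt_self, ContinuousLinearMap.coe_id', id_eq]

/-- The form dd^c f has type (1,1), by the symmetry of the Hessian and J² = -1. -/
lemma extDer_dc_J_J {f : V → ℝ} (hf : ContMDiff 𝓘(ℝ, E) 𝓘(ℝ, ℝ) ∞ f) (x : V) (v w : E) :
    OneForm.extDer (dc E f) x (J v) (J w) = OneForm.extDer (dc E f) x v w := by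
  rw [extDer_dc hf, extDer_dc hf, J_J, J_J,
    chartHess_symm hf (mem_extChartAt_target x) (J w), chartHess_symm hf (mem_extChartAt_target x) (J v)]
  simp
  ring

/-- The vector field in the chart around `x₀`. -/
def chartField (Y : VField E V) (x₀ : V) (y : E) : E :=
  diff E E (extChartAt 𝓘(ℝ, E) x₀) ((extChartAt 𝓘(ℝ, E) x₀).symm y)
    (Y ((extChartAt 𝓘(ℝ, E) x₀).symm y))

/-- Real holomorphic vector fields: smooth in charts, with complex linear derivative. -/
def IsHolField (Y : VField E V) : Prop :=
  ∀ x₀ : V, ContDiffOn ℝ ∞ (chartField Y x₀) (extChartAt 𝓘(ℝ, E) x₀).target ∧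
    ∀ y ∈ (extChartAt 𝓘(ℝ, E) x₀).target, ∀ v,
      fderiv ℝ (chartField Y x₀) y (J v) = J (fderiv ℝ (chartField Y x₀) y v)

lemma IsHolField.radial {Y : VField E V} (hY : IsHolField Y) : IsHolField (radial Y) := by
  intro x₀
  have h1 : Set.EqOn (chartField (SasakiCone.radial Y) x₀) (fun y => -J (chartField Y x₀ y))
      (extChartAt 𝓘(ℝ, E) x₀).target := by
    intro y hy
    simp only [chartField, SasakiCone.radial, map_neg]
    rw [diff_extChartAt_J ((extChartAt 𝓘(ℝ, E) x₀).map_target hy)]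
  refine ⟨?_, fun y hy v => ?_⟩
  · exact ((J : E →L[ℝ] E).contDiff.comp_contDiffOn (hY x₀).1).neg.congr h1
  · have h2 : HasFDerivAt (chartField Y x₀) (fderiv ℝ (chartField Y x₀) y) y :=
      (((hY x₀).1.contDiffAt ((isOpen_extChartAt_target x₀).mem_nhds hy)).differentiableAt
        (by simp)).hasFDerivAt
    have h3 : HasFDerivAt (chartField (SasakiCone.radial Y) x₀)
        (-(J.comp (fderiv ℝ (chartField Y x₀) y))) y :=
      ((J : E →L[ℝ] E).hasFDerivAt.comp y h2).neg.congr_of_eventuallyEq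
        (h1.eventuallyEq_of_mem ((isOpen_extChartAt_target x₀).mem_nhds hy))
    rw [h3.fderiv]
    simp only [neg_apply, ContinuousLinearMap.comp_apply, (hY x₀).2 y hy, map_neg]

lemma diff_apply_chart {f : V → ℝ} (hf : ContMDiff 𝓘(ℝ, E) 𝓘(ℝ, ℝ) ∞ f) (Y : VField E V) {x₀ : V}
    {y : E} (hy : y ∈ (extChartAt 𝓘(ℝ, E) x₀).target) :
    diff E ℝ f ((extChartAt 𝓘(ℝ, E) x₀).symm y) (Y ((extChartAt 𝓘(ℝ, E) x₀).symm y)) =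
      fderiv ℝ (fun y => f ((extChartAt 𝓘(ℝ, E) x₀).symm y)) y (chartField Y x₀ y) := by
  have hx := (extChartAt 𝓘(ℝ, E) x₀).map_target hy
  have h := diff_extChartAt_symm_diff hx (Y ((extChartAt 𝓘(ℝ, E) x₀).symm y))
  rw [(extChartAt 𝓘(ℝ, E) x₀).right_inv hy] at h
  rw [fderiv_comp_extChartAt_symm hf hy, chartField, h]

/-- A function is smooth as soon as it is smooth in all preferred charts. -/
lemma contMDiff_of_charts {f : V → ℝ}
    (h : ∀ x, ContDiffAt ℝ ∞ (fun y => f ((extChartAt 𝓘(ℝ, E) x).symm y))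
      (extChartAt 𝓘(ℝ, E) x x)) : ContMDiff 𝓘(ℝ, E) 𝓘(ℝ, ℝ) ∞ f := by
  intro x
  have h1 := (contMDiffAt_iff_contDiffAt.2 (h x)).comp x
    (contMDiffAt_extChartAt (I := 𝓘(ℝ, E)) (n := ∞) (x := x))
  refine h1.congr_of_eventuallyEq ?_
  filter_upwards [(isOpen_extChartAt_source x).mem_nhds (mem_extChartAt_source (I := 𝓘(ℝ, E)) x)]
    with z hz
  simp only [Function.comp]
  rw [(extChartAt 𝓘(ℝ, E) x).left_inv hz]

lemma contMDiff_diff_apply {f : V → ℝ} (hf : ContMDiff 𝓘(ℝ, E) 𝓘(ℝ, ℝ) ∞ f) {Y : VField E V}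
    (hY : IsHolField Y) : ContMDiff 𝓘(ℝ, E) 𝓘(ℝ, ℝ) ∞ (fun p => diff E ℝ f p (Y p)) := by
  refine contMDiff_of_charts fun x => ?_
  have hy := mem_extChartAt_target (I := 𝓘(ℝ, E)) x
  have h1 := (contDiffAt_comp_extChartAt_symm le_rfl hy (hf _)).fderiv_right (m := ∞) (by simp)
  have h2 := h1.clm_apply ((hY x).1.contDiffAt ((isOpen_extChartAt_target x).mem_nhds hy))
  refine h2.congr_of_eventuallyEq ?_
  filter_upwards [(isOpen_extChartAt_target x).mem_nhds hy] with y' hy'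
  exact diff_apply_chart hf Y hy'

/-- If `f` is invariant under the holomorphic field `Y`, then `ι_Y d d^c f = d (df (J Y))`. -/
lemma extDer_dc_field {f : V → ℝ} (hf : ContMDiff 𝓘(ℝ, E) 𝓘(ℝ, ℝ) ∞ f) {Y : VField E V}
    (hY : IsHolField Y) (hfY : ∀ p, diff E ℝ f p (Y p) = 0) (p : V) (w : E) :
    OneForm.extDer (dc E f) p (Y p) w = -diff E ℝ (fun q => diff E ℝ f q (radial Y q)) p w := by
  set y := extChartAt 𝓘(ℝ, E) p p with hydef
  have hy : y ∈ (extChartAt 𝓘(ℝ, E) p).target := mem_extChartAt_target p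
  have hsymm : (extChartAt 𝓘(ℝ, E) p).symm y = p := extChartAt_to_inv p
  have hnhds := (isOpen_extChartAt_target (I := 𝓘(ℝ, E)) p).mem_nhds hy
  have hid (v : E) : diff E E (extChartAt 𝓘(ℝ, E) p).symm y v = v := by
    have := diff_extChartAt_symm_diff (mem_extChartAt_source (I := 𝓘(ℝ, E)) p) v
    rwa [diff_extChartAt_self] at this
  have hk0 : chartField Y p y = Y p := by
    rw [chartField, hsymm, diff_extChartAt_self]
    rfl
  have hkd : HasFDerivAt (chartField Y p) (fderiv ℝ (chartField Y p) y) y :=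
    (((hY p).1.contDiffAt hnhds).differentiableAt (by simp)).hasFDerivAt
  have hgd : HasFDerivAt (fderiv ℝ (fun y => f ((extChartAt 𝓘(ℝ, E) p).symm y)))
      (chartHess f p y) y :=
    (((contDiffAt_comp_extChartAt_symm le_rfl hy (hf _)).fderiv_right
      (m := ∞) (by simp)).differentiableAt (by simp)).hasFDerivAt
  set g := fun y => f ((extChartAt 𝓘(ℝ, E) p).symm y) with hg
  -- Obtained by differentiating df(Y) = 0 in the direction u.
  have h0 (u : E) : chartHess f p y u (Y p) = -fderiv ℝ g y (fderiv ℝ (chartField Y p) y u) := by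
    have h1 := hgd.clm_apply hkd
    have h2 : HasFDerivAt (fun y => fderiv ℝ g y (chartField Y p y)) (0 : E →L[ℝ] ℝ) y := by
      refine (hasFDerivAt_const (0 : ℝ) y).congr_of_eventuallyEq ?_
      filter_upwards [hnhds] with y' hy'
      rw [← diff_apply_chart hf Y hy', hfY]
    have h3 := congrArg (fun A => A u) (h1.unique h2)
    simp only [add_apply, ContinuousLinearMap.comp_apply, ContinuousLinearMap.flip_apply,
      zero_apply, hk0] at h3
    linarith
  have hrad : ∀ᶠ y' in 𝓝 y, chartField (radial Y) p y' = -J (chartField Y p y') := by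
    filter_upwards [hnhds] with y' hy'
    simp only [chartField, radial, map_neg]
    rw [diff_extChartAt_J ((extChartAt 𝓘(ℝ, E) p).map_target hy')]
  have h4 : diff E ℝ (fun q => diff E ℝ f q (radial Y q)) p w =
      -(chartHess f p y w (J (Y p)) + fderiv ℝ g y (J (fderiv ℝ (chartField Y p) y w))) := by
    have hsm := contMDiff_diff_apply hf hY.radial
    have h5 := fderiv_comp_extChartAt_symm hsm hy w
    rw [hid, hsymm] at h5
    rw [← h5]
    have h6 := hgd.clm_apply ((J : E →L[ℝ] E).hasFDerivAt.comp y hkd).neg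
    have h7 : (fun y => diff E ℝ f ((extChartAt 𝓘(ℝ, E) p).symm y)
        (radial Y ((extChartAt 𝓘(ℝ, E) p).symm y))) =ᶠ[𝓝 y]
        fun y => fderiv ℝ g y ((-⇑J ∘ chartField Y p) y) := by
      filter_upwards [hnhds, hrad] with y' hy' hr
      rw [diff_apply_chart hf (radial Y) hy', hr]
      rfl
    rw [h7.fderiv_eq, h6.fderiv]
    simp [hk0]
  -- Holomorphy of Y moves J out of the derivative of Y, and the first order term from `h0` becomes
  -- the one in `h4`.
  rw [h4, extDer_dc hf, ← hydef, chartHess_symm hf hy (Y p) (J w), h0 (J w), (hY p).2 y hy]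
  ring

end Levi

end SasakiCone

end

noncomputable section

set_option linter.unusedSectionVars false

namespace SasakiCone

/-! ### Smoothness and local flows of holomorphic fields. -/

section Fields

open Set

variable {E : Type*} [NormedAddCommGroup E] [NormedSpace ℂ E]
variable {V : Type*} [TopologicalSpace V] [ChartedSpace E V] [IsManifold 𝓘(ℂ, E) ω V]

lemma contMDiffAt_prod_iff_contDiffAt {F F' F'' : Type*} [NormedAddCommGroup F] [NormedSpace ℝ F]
    [NormedAddCommGroup F'] [NormedSpace ℝ F'] [NormedAddCommGroup F''] [NormedSpace ℝ F'']
    {f : F × F' → F''} {n : WithTop ℕ∞} {x : F × F'} :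
    ContMDiffAt (𝓘(ℝ, F).prod 𝓘(ℝ, F')) 𝓘(ℝ, F'') n f x ↔ ContDiffAt ℝ n f x := by
  rw [← contMDiffAt_iff_contDiffAt, modelWithCornersSelf_prod, ← chartedSpaceSelf_prod]

/-- A holomorphic vector field is a smooth section of the tangent bundle. -/
lemma IsHolField.contMDiff {Y : VField E V} (hY : IsHolField Y) :
    ContMDiff 𝓘(ℝ, E) 𝓘(ℝ, E).tangent 1
      (fun x => (⟨x, Y x⟩ : TangentBundle 𝓘(ℝ, E) V)) := by
  intro x₀
  refine (Bundle.contMDiffAt_section (IB := 𝓘(ℝ, E)) (F := E) (E := (TangentSpace 𝓘(ℝ, E) : V → Type _)) (s := Y) x₀).2 ?_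
  have h1 : ContMDiffAt 𝓘(ℝ, E) 𝓘(ℝ, E) 1
      (fun x => chartField Y x₀ (extChartAt 𝓘(ℝ, E) x₀ x)) x₀ := by
    have h2 : ContDiffAt ℝ 1 (chartField Y x₀) (extChartAt 𝓘(ℝ, E) x₀ x₀) :=
      ((hY x₀).1.contDiffAt ((isOpen_extChartAt_target x₀).mem_nhds
        (mem_extChartAt_target x₀))).of_le (WithTop.coe_le_coe.2 le_top)
    exact (contMDiffAt_iff_contDiffAt.2 h2).comp x₀ contMDiffAt_extChartAt
  refine h1.congr_of_eventuallyEq ?_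
  filter_upwards [(isOpen_extChartAt_source x₀).mem_nhds
    (mem_extChartAt_source (I := 𝓘(ℝ, E)) x₀)] with x hx
  have hx' : x ∈ (chartAt E x₀).source := by simpa using hx
  have h3 := TangentBundle.continuousLinearMapAt_trivializationAt (I := 𝓘(ℝ, E)) hx'
  rw [chartField, (extChartAt 𝓘(ℝ, E) x₀).left_inv hx]
  have h4 := congrArg (fun A => A (Y x)) h3
  refine Eq.trans ?_ h4
  rw [Bundle.Trivialization.continuousLinearMapAt_apply,
    Bundle.Trivialization.coe_linearMapAt_of_mem]
  simpa using hx

section LocalFlow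

variable [FiniteDimensional ℂ E]

/-- Transports the flow in a vector space through the chart at `p₀`. Two extra orders of
differentiability are requested there, because complex linearity of the differential needs a C² flow
even when n = 0. -/
lemma exists_local_flow {Z : VField E V} (hZ : IsHolField Z) (p₀ : V) (n : ℕ) :
    ∃ ε > 0, ∃ W : Set V, IsOpen W ∧ p₀ ∈ W ∧ ∃ Φ : ℝ → V → V,
      ContMDiffOn (𝓘(ℝ, ℝ).prod 𝓘(ℝ, E)) 𝓘(ℝ, E) n (fun q : ℝ × V => Φ q.1 q.2)
        (Ioo (-ε) ε ×ˢ W) ∧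
      ∀ p ∈ W, Φ 0 p = p ∧
        IsMIntegralCurveOn (I := 𝓘(ℝ, E)) (fun s => Φ s p) Z (Ioo (-ε) ε) ∧
        ∀ s ∈ Ioo (-ε) ε, ∀ v, diff E E (Φ s) p (J v) = J (diff E E (Φ s) p v) := by
  have : CompleteSpace E := FiniteDimensional.complete ℂ E
  set e := extChartAt 𝓘(ℝ, E) p₀ with he
  have hU : IsOpen e.target := isOpen_extChartAt_target p₀
  obtain ⟨ε, hε, W, hW, hpW, Φ, hΦ, hflow⟩ := exists_local_flow_vectorSpace hU (hZ p₀).1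
    (mem_extChartAt_target p₀) (n + 2)
  have hopen : IsOpen (Ioo (-ε) ε ×ˢ W) := isOpen_Ioo.prod hW
  have hWopen : IsOpen (e.source ∩ e ⁻¹' W) :=
    (continuousOn_extChartAt p₀).isOpen_inter_preimage (isOpen_extChartAt_source p₀) hW
  refine ⟨ε, hε, e.source ∩ e ⁻¹' W, hWopen, ⟨mem_extChartAt_source p₀, hpW⟩,
    fun s p => e.symm (Φ (s, e p)), ?_, ?_⟩
  · rintro ⟨s, p⟩ ⟨hs, hp, (hpW : e p ∈ W)⟩
    have h1 : ContDiffAt ℝ n Φ (s, e p) :=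
      (hΦ.contDiffAt (hopen.mem_nhds ⟨hs, hpW⟩)).of_le (by exact_mod_cast Nat.le_add_right n 2)
    have h2 : ContMDiffAt (𝓘(ℝ, ℝ).prod 𝓘(ℝ, E)) 𝓘(ℝ, E) n Φ (s, e p) :=
      contMDiffAt_prod_iff_contDiffAt.2 h1
    have h3 : ContMDiffAt 𝓘(ℝ, E) 𝓘(ℝ, E) n e p :=
      (contMDiffAt_extChartAt' (n := ∞) (by simpa [he] using hp)).of_le
        (WithTop.coe_le_coe.2 le_top)
    have h4 : ContMDiffAt (𝓘(ℝ, ℝ).prod 𝓘(ℝ, E)) (𝓘(ℝ, ℝ).prod 𝓘(ℝ, E)) n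
        (fun q : ℝ × V => (q.1, e q.2)) (s, p) :=
      contMDiffAt_fst.prodMk (ContMDiffAt.comp (s, p) h3 contMDiffAt_snd)
    have h5 : ContMDiffAt 𝓘(ℝ, E) 𝓘(ℝ, E) n e.symm (Φ (s, e p)) :=
      (contMDiffAt_extChartAt_symm ((hflow _ hpW).2 s hs).1).of_le (WithTop.coe_le_coe.2 le_top)
    exact (ContMDiffAt.comp (s, p) h5 (ContMDiffAt.comp (s, p) h2 h4)).contMDiffWithinAt
  · rintro p ⟨hp, (hpW : e p ∈ W)⟩
    refine ⟨?_, ?_, ?_⟩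
    · change e.symm (Φ (0, e p)) = p
      rw [(hflow _ hpW).1, e.left_inv hp]
    · intro s hs
      obtain ⟨hmem, hder⟩ := (hflow _ hpW).2 s hs
      have h1 : HasMFDerivAt 𝓘(ℝ, ℝ) 𝓘(ℝ, E) (fun s => Φ (s, e p)) s
          (ContinuousLinearMap.smulRight (1 : ℝ →L[ℝ] ℝ) (chartField Z p₀ (Φ (s, e p))) :
            ℝ →L[ℝ] E) := by
        refine hasMFDerivAt_iff_hasFDerivAt.2 ?_
        have := hder.hasFDerivAt
        convert! this using 1
      have h2 := (mdiffAt_extChartAt_symm hmem).hasMFDerivAt.comp s h1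
      have h3 : HasMFDerivAt 𝓘(ℝ, ℝ) 𝓘(ℝ, E) (fun s => e.symm (Φ (s, e p))) s
          (ContinuousLinearMap.smulRight (1 : ℝ →L[ℝ] ℝ) (Z (e.symm (Φ (s, e p)))) :
            ℝ →L[ℝ] E) := by
        have h4 := diff_extChartAt_symm_diff (e.map_target hmem) (Z (e.symm (Φ (s, e p))))
        rw [← he, e.right_inv hmem] at h4
        have h5 : (ContinuousLinearMap.smulRight (1 : ℝ →L[ℝ] ℝ) (Z (e.symm (Φ (s, e p)))) :
            ℝ →L[ℝ] E) = (diff E E e.symm (Φ (s, e p))).comp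
            (ContinuousLinearMap.smulRight (1 : ℝ →L[ℝ] ℝ) (chartField Z p₀ (Φ (s, e p))) :
            ℝ →L[ℝ] E) := by
          ext
          simp only [ContinuousLinearMap.smulRight_apply, ContinuousLinearMap.comp_apply,
            one_apply_eq_self, one_smul]
          exact h4.symm
        rw [h5]
        exact h2
      exact h3.hasMFDerivWithinAt
    · intro s hs v
      obtain ⟨hmem, hder⟩ := (hflow _ hpW).2 s hs
      have h1 : HasFDerivAt (fun y => Φ (s, y)) ((fderiv ℝ Φ (s, e p)).comp (.inr ℝ ℝ E)) (e p) :=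
        (((hΦ.contDiffAt (hopen.mem_nhds ⟨hs, hpW⟩)).differentiableAt
          (by norm_num)).hasFDerivAt).comp (e p) (hasFDerivAt_prodMk_right s (e p))
      have h1' : MDifferentiableAt 𝓘(ℝ, E) 𝓘(ℝ, E) (fun y => Φ (s, y)) (e p) :=
        mdifferentiableAt_iff_differentiableAt.2 h1.differentiableAt
      have h2 : MDifferentiableAt 𝓘(ℝ, E) 𝓘(ℝ, E) (fun p => Φ (s, e p)) p :=
        h1'.comp p (mdiffAt_extChartAt hp)
      have h3 (v : E) : diff E E (fun p => e.symm (Φ (s, e p))) p v =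
          diff E E e.symm (Φ (s, e p)) (fderiv ℝ Φ (s, e p) (0, diff E E e p v)) := by
        rw [diff_comp_apply (f := fun p => Φ (s, e p)) (mdiffAt_extChartAt_symm hmem) h2,
          diff_comp_apply (g := fun y => Φ (s, y)) h1' (mdiffAt_extChartAt hp), diff_eq_fderiv,
          h1.fderiv]
        rfl
      have h4 := local_flow_complex_linear hU (hZ p₀).1 (fun y hy w => (hZ p₀).2 y hy w) hW
        (hΦ.of_le (by exact_mod_cast Nat.le_add_left 2 n)) hflow hpW hs (diff E E e p v)
      rw [h3, h3, diff_extChartAt_J hp, J_apply, h4, ← J_apply, diff_extChartAt_symm_J hmem]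

end LocalFlow

/-! ### Vector fields induced by the torus action. -/

section Torus

variable {d : ℕ} [MulAction (Torus d) V]

lemma torusExp_zero : torusExp (0 : Fin d → ℝ) = 1 := by
  funext i
  simp [torusExp]

lemma torusExp_surjective (g : Torus d) : ∃ Y : Fin d → ℝ, torusExp Y = g :=
  ⟨fun i => Complex.arg (g i), by funext i; simp [torusExp, Circle.exp_arg]⟩

variable (hT : IsHolomorphicTorusAction E V d)
include hT

lemma contMDiff_action (Y : Fin d → ℝ) :
    ContMDiff (𝓘(ℝ, ℝ).prod 𝓘(ℝ, E)) 𝓘(ℝ, E) ∞ (fun q : ℝ × V => torusExp (q.1 • Y) • q.2) := by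
  have h1 : ContMDiff 𝓘(ℝ, ℝ) 𝓘(ℝ, Fin d → ℝ) ∞ (fun s : ℝ => s • Y) :=
    contMDiff_iff_contDiff.2 (contDiff_id.smul contDiff_const)
  exact hT.smooth.comp ((h1.comp contMDiff_fst).prodMk contMDiff_snd)

lemma contMDiff_smul_torus (g : Torus d) : ContMDiff 𝓘(ℝ, E) 𝓘(ℝ, E) ∞ (fun p : V => g • p) := by
  obtain ⟨Y, rfl⟩ := torusExp_surjective g
  exact hT.smooth.comp (contMDiff_const.prodMk contMDiff_id)

lemma diff_smul_torus_J (g : Torus d) (p : V) (v : E) :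
    diff E E (fun p : V => g • p) p (J v) = J (diff E E (fun p : V => g • p) p v) :=
  diff_J_of_mdifferentiableAt (hT.holomorphic g p) v

lemma contMDiff_orbit (Y : Fin d → ℝ) (p : V) :
    ContMDiff 𝓘(ℝ, ℝ) 𝓘(ℝ, E) ∞ (fun s : ℝ => torusExp (s • Y) • p) :=
  (contMDiff_action hT Y).comp (contMDiff_id.prodMk contMDiff_const)

/-- If `f` intertwines the torus actions, its differential preserves the induced fields. -/
lemma diff_field_of_commute {f : V → V} (Y : Fin d → ℝ) {p : V}
    (hf : MDifferentiableAt 𝓘(ℝ, E) 𝓘(ℝ, E) f p)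
    (hc : ∀ s : ℝ, f (torusExp (s • Y) • p) = torusExp (s • Y) • f p) :
    diff E E f p (field E V Y p) = field E V Y (f p) := by
  have h0 : torusExp ((0 : ℝ) • Y) • p = p := by rw [zero_smul, torusExp_zero, one_smul]
  have h := diff_comp_apply (g := f) (f := fun s : ℝ => torusExp (s • Y) • p) (x := 0)
    (by rwa [h0]) (mdiffAt (contMDiff_orbit hT Y p) 0) 1
  rw [h0] at h
  rw [field, field, ← h]
  simp only [hc]

lemma diff_smul_torus_field (g : Torus d) (Y : Fin d → ℝ) (p : V) :
    diff E E (fun p : V => g • p) p (field E V Y p) = field E V Y (g • p) :=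
  diff_field_of_commute hT Y (mdiffAt (contMDiff_smul_torus hT g) p) fun s => by
    rw [smul_smul, smul_smul, mul_comm]

lemma diff_smul_torus_radial (g : Torus d) (Y : Fin d → ℝ) (p : V) :
    diff E E (fun p : V => g • p) p (radial (field E V Y) p) = radial (field E V Y) (g • p) := by
  rw [radial, map_neg, diff_smul_torus_J hT, diff_smul_torus_field hT]
  rfl

/-- Torus-invariant functions are constant along the induced fields. -/
lemma diff_field_of_invariant {F : Type*} [NormedAddCommGroup F] [NormedSpace ℝ F]
    {N : Type*} [TopologicalSpace N] [ChartedSpace F N] {f : V → N} (Y : Fin d → ℝ) {p : V}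
    (hf : MDifferentiableAt 𝓘(ℝ, E) 𝓘(ℝ, F) f p) (hi : ∀ g : Torus d, f (g • p) = f p) :
    diff E F f p (field E V Y p) = 0 := by
  have h0 : torusExp ((0 : ℝ) • Y) • p = p := by rw [zero_smul, torusExp_zero, one_smul]
  have h := diff_comp_apply (g := f) (f := fun s : ℝ => torusExp (s • Y) • p) (x := 0)
    (by rwa [h0]) (mdiffAt (contMDiff_orbit hT Y p) 0) 1
  rw [h0] at h
  rw [field, ← h]
  simp only [hi]
  rw [diff_const]
  rfl

/-- The vector fields induced by the torus action are holomorphic. -/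
lemma isHolField_field (Y : Fin d → ℝ) : IsHolField (field E V Y) := by
  intro x₀
  set e := extChartAt 𝓘(ℝ, E) x₀ with he
  -- The one-parameter group in the chart; the field is its time derivative at s = 0.
  let A : ℝ × E → E := fun q => e (torusExp (q.1 • Y) • e.symm q.2)
  have h0 (p : V) : torusExp ((0 : ℝ) • Y) • p = p := by rw [zero_smul, torusExp_zero, one_smul]
  have hcont {y : E} (hy : y ∈ e.target) : ContMDiffAt (𝓘(ℝ, ℝ).prod 𝓘(ℝ, E)) 𝓘(ℝ, E) ∞
      (fun q : ℝ × E => torusExp (q.1 • Y) • e.symm q.2) (0, y) := by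
    have h1 : ContMDiffAt (𝓘(ℝ, ℝ).prod 𝓘(ℝ, E)) (𝓘(ℝ, ℝ).prod 𝓘(ℝ, E)) ∞
        (fun q : ℝ × E => (q.1, e.symm q.2)) (0, y) :=
      contMDiffAt_fst.prodMk (ContMDiffAt.comp (0, y) (contMDiffAt_extChartAt_symm hy)
        contMDiffAt_snd)
    exact ContMDiffAt.comp (0, y) (contMDiff_action hT Y _) h1
  have hsrc {y : E} (hy : y ∈ e.target) : ∀ᶠ q in 𝓝 ((0 : ℝ), y), q.2 ∈ e.target ∧
      torusExp (q.1 • Y) • e.symm q.2 ∈ e.source := by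
    refine Filter.Eventually.and ?_ ?_
    · exact continuousAt_snd.eventually ((isOpen_extChartAt_target x₀).mem_nhds hy)
    · refine (hcont hy).continuousAt.eventually ((isOpen_extChartAt_source x₀).mem_nhds ?_)
      simp only [h0]
      exact e.map_target hy
  have hA {y : E} (hy : y ∈ e.target) : ContDiffAt ℝ ∞ A (0, y) := by
    rw [← contMDiffAt_prod_iff_contDiffAt]
    refine ContMDiffAt.comp (0, y) (contMDiffAt_extChartAt' ?_) (hcont hy)
    simpa [he] using (hsrc hy).self_of_nhds.2
  have hAd {y : E} (hy : y ∈ e.target) : HasFDerivAt A (fderiv ℝ A (0, y)) (0, y) :=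
    ((hA hy).differentiableAt (by simp)).hasFDerivAt
  have hk {y : E} (hy : y ∈ e.target) : chartField (field E V Y) x₀ y = fderiv ℝ A (0, y) (1, 0) := by
    have h1 : HasDerivAt (fun s => A (s, y)) (fderiv ℝ A (0, y) (1, 0)) 0 :=
      HasFDerivAt.comp_hasDerivAt (f := fun s : ℝ => (s, y)) (0 : ℝ) (hAd hy)
        ((hasDerivAt_id (0 : ℝ)).prodMk (hasDerivAt_const (0 : ℝ) y))
    have h2 : MDifferentiableAt 𝓘(ℝ, E) 𝓘(ℝ, E) e (torusExp ((0 : ℝ) • Y) • e.symm y) := by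
      rw [h0]; exact mdiffAt_extChartAt (e.map_target hy)
    have h3 := diff_comp_apply (g := e) (f := fun s : ℝ => torusExp (s • Y) • e.symm y) (x := 0)
      h2 (mdiffAt (contMDiff_orbit hT Y (e.symm y)) 0) 1
    rw [h0] at h3
    rw [chartField, field, ← he, ← h3, diff_eq_fderiv, ← h1.deriv]
    rfl
  have hD {y : E} (hy : y ∈ e.target) : HasFDerivAt (fderiv ℝ A) (fderiv ℝ (fderiv ℝ A) (0, y)) (0, y) :=
    (((hA hy).fderiv_right (m := ∞) (by simp)).differentiableAt (by simp)).hasFDerivAt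
  refine ⟨fun y hy => ?_, fun y hy v => ?_⟩
  · have h1 : ContDiffAt ℝ ∞ (fun y => fderiv ℝ A (0, y)) y :=
      ContDiffAt.comp (g := fderiv ℝ A) (f := fun y : E => ((0 : ℝ), y)) y
        ((hA hy).fderiv_right (m := ∞) (by simp)) (contDiffAt_const.prodMk contDiffAt_id)
    have h2 := h1.clm_apply (contDiffAt_const (c := ((1 : ℝ), (0 : E))))
    refine (h2.congr_of_eventuallyEq ?_).contDiffWithinAt
    filter_upwards [(isOpen_extChartAt_target x₀).mem_nhds hy] with y' hy'
    exact hk hy'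
  -- The derivative of the field is a mixed second derivative of `A`. With the order exchanged it is
  -- the time derivative at 0 of the spatial differentials, which are complex linear because the
  -- torus acts holomorphically.
  · set D := fderiv ℝ (fderiv ℝ A) (0, y)
    have hfd (v : E) : fderiv ℝ (chartField (field E V Y) x₀) y v = D (1, 0) (0, v) := by
      have h1 : HasFDerivAt (fun y => fderiv ℝ A (0, y) (1, 0))
          ((D.comp (.inr ℝ ℝ E)).flip (1, 0)) y := by
        have := ((hD hy).comp y (hasFDerivAt_prodMk_right (0 : ℝ) y)).clm_apply
          (hasFDerivAt_const ((1 : ℝ), (0 : E)) y)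
        simpa using this
      have h2 := h1.congr_of_eventuallyEq (f₁ := chartField (field E V Y) x₀) (by
        filter_upwards [(isOpen_extChartAt_target x₀).mem_nhds hy] with y' hy'
        exact hk hy')
      rw [h2.fderiv]
      simp only [ContinuousLinearMap.flip_apply, ContinuousLinearMap.comp_apply,
        ContinuousLinearMap.inr_apply]
      exact (hA hy).isSymmSndFDerivAt
        (by rw [minSmoothness_of_isRCLikeNormedField]; exact WithTop.coe_le_coe.2 le_top) _ _
    have hder (v : E) : HasDerivAt (fun s => fderiv ℝ A (s, y) (0, v)) (D (1, 0) (0, v)) 0 := by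
      have h1 : HasDerivAt (fun s => fderiv ℝ A (s, y)) (D (1, 0)) 0 :=
        HasFDerivAt.comp_hasDerivAt (f := fun s : ℝ => (s, y)) (0 : ℝ) (hD hy)
          ((hasDerivAt_id (0 : ℝ)).prodMk (hasDerivAt_const (0 : ℝ) y))
      simpa using h1.clm_apply (hasDerivAt_const 0 ((0 : ℝ), v))
    have hlin : ∀ᶠ s in 𝓝 (0 : ℝ), fderiv ℝ A (s, y) (0, J v) = J (fderiv ℝ A (s, y) (0, v)) := by
      have hev : ∀ᶠ q in 𝓝 ((0 : ℝ), y), DifferentiableAt ℝ A q :=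
        (((hA hy).of_le (m := 1) (WithTop.coe_le_coe.2 le_top)).eventually (by simp)).mono
          fun q hq => hq.differentiableAt one_ne_zero
      have hc : Filter.Tendsto (fun s : ℝ => (s, y)) (𝓝 0) (𝓝 (0, y)) :=
        (Continuous.prodMk_left y).continuousAt
      filter_upwards [hc.eventually hev, hc.eventually (hsrc hy)] with s hs hs2
      have hsp : HasFDerivAt (fun y => A (s, y)) ((fderiv ℝ A (s, y)).comp (.inr ℝ ℝ E)) y :=
        hs.hasFDerivAt.comp y (hasFDerivAt_prodMk_right s y)
      have hg := mdiffAt (contMDiff_smul_torus hT (torusExp (s • Y)))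
      have h5 (v : E) : fderiv ℝ A (s, y) (0, v) = diff E E e (torusExp (s • Y) • e.symm y)
          (diff E E (fun p : V => torusExp (s • Y) • p) (e.symm y) (diff E E e.symm y v)) := by
        have h6 : fderiv ℝ A (s, y) (0, v) = fderiv ℝ (fun y => A (s, y)) y v := by
          rw [hsp.fderiv]; rfl
        rw [h6, ← diff_eq_fderiv, diff_comp_apply (g := e)
          (f := fun y => torusExp (s • Y) • e.symm y) (mdiffAt_extChartAt hs2.2)
          ((hg _).comp y (mdiffAt_extChartAt_symm hy)),
          diff_comp_apply (g := fun p : V => torusExp (s • Y) • p) (f := e.symm) (hg _)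
            (mdiffAt_extChartAt_symm hy)]
      rw [h5, h5, diff_extChartAt_symm_J hy, diff_smul_torus_J hT, diff_extChartAt_J hs2.2]
    rw [hfd, hfd]
    have h7 := ((J : E →L[ℝ] E).hasFDerivAt.comp_hasDerivAt (0 : ℝ) (hder v)).congr_of_eventuallyEq hlin
    exact (hder (J v)).unique h7

end Torus

end Fields

end SasakiCone

end

noncomputable section

set_option linter.unusedSectionVars false

namespace SasakiCone

/-! ### Global flows of complete holomorphic fields. -/

section GlobalFlow

open Set

variable {E : Type*} [NormedAddCommGroup E] [NormedSpace ℂ E]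
variable {V : Type*} [TopologicalSpace V] [ChartedSpace E V]

/-- Completeness of a vector field. -/
def IsCompleteField (Z : VField E V) : Prop :=
  ∀ p : V, ∃ γ : ℝ → V, IsIntegralCurveOf Z γ ∧ γ 0 = p

/-- The flow of a complete vector field. -/
def flow {Z : VField E V} (hc : IsCompleteField Z) (t : ℝ) (p : V) : V := (hc p).choose t

lemma flow_isMIntegralCurve {Z : VField E V} (hc : IsCompleteField Z) (p : V) :
    IsMIntegralCurve (I := 𝓘(ℝ, E)) (fun t => flow hc t p) Z := (hc p).choose_spec.1

lemma flow_zero {Z : VField E V} (hc : IsCompleteField Z) (p : V) : flow hc 0 p = p :=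
  (hc p).choose_spec.2

lemma mdiffAt_flow {Z : VField E V} (hc : IsCompleteField Z) (p : V) (t : ℝ) :
    MDifferentiableAt 𝓘(ℝ, ℝ) 𝓘(ℝ, E) (fun t => flow hc t p) t :=
  (flow_isMIntegralCurve hc p t).mdifferentiableAt

lemma diff_flow_time {Z : VField E V} (hc : IsCompleteField Z) (p : V) (t : ℝ) :
    diff ℝ E (fun t => flow hc t p) t 1 = Z (flow hc t p) := by
  rw [diff, (flow_isMIntegralCurve hc p t).mfderiv]
  exact one_smul ℝ (Z (flow hc t p))

lemma hasDerivAt_comp_flow {Z : VField E V} (hc : IsCompleteField Z) {f : V → ℝ} {p : V} {t : ℝ}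
    (hf : MDifferentiableAt 𝓘(ℝ, E) 𝓘(ℝ, ℝ) f (flow hc t p)) :
    HasDerivAt (fun t => f (flow hc t p))
      (diff E ℝ f (flow hc t p) (Z (flow hc t p))) t := by
  have h := hasDerivAt_comp_curve (γ := fun t => flow hc t p) hf (mdiffAt_flow hc p t)
  rwa [diff_flow_time] at h

/-- Related vector fields have related integral curves. -/
lemma isMIntegralCurve_map {F F' : Type*} [NormedAddCommGroup F] [NormedSpace ℝ F]
    [NormedAddCommGroup F'] [NormedSpace ℝ F']
    {M : Type*} [TopologicalSpace M] [ChartedSpace F M]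
    {M' : Type*} [TopologicalSpace M'] [ChartedSpace F' M'] {Z : VField F M} {Z' : VField F' M'}
    {f : M → M'} (hf : ∀ p, MDifferentiableAt 𝓘(ℝ, F) 𝓘(ℝ, F') f p)
    (hZ : ∀ p, diff F F' f p (Z p) = Z' (f p)) {γ : ℝ → M} {s : Set ℝ}
    (hγ : IsMIntegralCurveOn (I := 𝓘(ℝ, F)) γ Z s) :
    IsMIntegralCurveOn (I := 𝓘(ℝ, F')) (fun t => f (γ t)) Z' s := by
  intro t ht
  have h := (hf (γ t)).hasMFDerivAt.comp_hasMFDerivWithinAt t (hγ t ht)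
  have h5 : (ContinuousLinearMap.smulRight (1 : ℝ →L[ℝ] ℝ) (Z' (f (γ t))) : ℝ →L[ℝ] F') =
      (diff F F' f (γ t)).comp
        (ContinuousLinearMap.smulRight (1 : ℝ →L[ℝ] ℝ) (Z (γ t)) : ℝ →L[ℝ] F) := by
    ext
    simp [hZ]
  change HasMFDerivWithinAt 𝓘(ℝ, ℝ) 𝓘(ℝ, F') (fun t => f (γ t)) s t
    (ContinuousLinearMap.smulRight (1 : ℝ →L[ℝ] ℝ) (Z' (f (γ t))) : ℝ →L[ℝ] F')
  rw [h5]
  exact h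

variable [IsManifold 𝓘(ℂ, E) ω V] [FiniteDimensional ℂ E] [T2Space V]

lemma isMIntegralCurve_unique {Z : VField E V} (hZ : IsHolField Z) {γ γ' : ℝ → V}
    (hγ : IsMIntegralCurve (I := 𝓘(ℝ, E)) γ Z) (hγ' : IsMIntegralCurve (I := 𝓘(ℝ, E)) γ' Z)
    {t₀ : ℝ} (h : γ t₀ = γ' t₀) : γ = γ' := by
  have : CompleteSpace E := FiniteDimensional.complete ℂ E
  exact isMIntegralCurve_Ioo_eq_of_contMDiff_boundaryless hZ.contMDiff hγ hγ' h

section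

variable {Z : VField E V} (hZ : IsHolField Z) (hc : IsCompleteField Z)
include hZ

lemma flow_eq_of_isMIntegralCurve {γ : ℝ → V} (hγ : IsMIntegralCurve (I := 𝓘(ℝ, E)) γ Z) (t : ℝ) :
    flow hc t (γ 0) = γ t :=
  congrFun (isMIntegralCurve_unique hZ (flow_isMIntegralCurve hc (γ 0)) hγ (t₀ := 0)
    (flow_zero hc _)) t

lemma flow_add (s t : ℝ) (p : V) : flow hc (s + t) p = flow hc s (flow hc t p) := by
  have h := flow_eq_of_isMIntegralCurve hZ hc ((flow_isMIntegralCurve hc p).comp_add t) s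
  simp only [Function.comp_apply, zero_add] at h
  exact h.symm

lemma flow_neg_flow (t : ℝ) (p : V) : flow hc (-t) (flow hc t p) = p := by
  rw [← flow_add hZ, neg_add_cancel, flow_zero]

lemma flow_flow_neg (t : ℝ) (p : V) : flow hc t (flow hc (-t) p) = p := by
  rw [← flow_add hZ, add_neg_cancel, flow_zero]

lemma flow_eq_local {Φ : ℝ → V} {ε : ℝ} (hε : 0 < ε)
    (hΦ : IsMIntegralCurveOn (I := 𝓘(ℝ, E)) Φ Z (Ioo (-ε) ε)) {s : ℝ} (hs : s ∈ Ioo (-ε) ε) :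
    flow hc s (Φ 0) = Φ s := by
  have : CompleteSpace E := FiniteDimensional.complete ℂ E
  exact isMIntegralCurveOn_Ioo_eqOn_of_contMDiff_boundaryless (t₀ := 0) ⟨by linarith, hε⟩
    hZ.contMDiff ((flow_isMIntegralCurve hc (Φ 0)).isMIntegralCurveOn _) hΦ (flow_zero hc _) hs

/-- The clopen argument for the regularity of the flow. -/
lemma flow_regular (n : ℕ) (hn : n ≠ 0) (t : ℝ) (p : V) :
    ContMDiffAt (𝓘(ℝ, ℝ).prod 𝓘(ℝ, E)) 𝓘(ℝ, E) n (fun q : ℝ × V => flow hc q.1 q.2) (t, p) ∧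
      ∀ v, diff E E (flow hc t) p (J v) = J (diff E E (flow hc t) p v) := by
  have hn' : (n : WithTop ℕ∞) ≠ 0 := by exact_mod_cast hn
  have hJ0 (q : V) (v : E) : diff E E (flow hc 0) q (J v) = J (diff E E (flow hc 0) q v) := by
    have h0 : flow hc 0 = fun q => q := funext (flow_zero hc)
    rw [h0, diff_id]; rfl
  let S : Set ℝ := {t | ContMDiffAt 𝓘(ℝ, E) 𝓘(ℝ, E) n (flow hc t) p ∧
    ∀ v, diff E E (flow hc t) p (J v) = J (diff E E (flow hc t) p v)}
  -- Within a window around t₁, regularity at one time gives regularity at all times, since the two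
  -- flow maps differ by a local flow near the orbit point. This makes `S` both open and closed.
  have key (t₁ : ℝ) : ∃ δ > 0, ∀ t ∈ Ioo (t₁ - δ) (t₁ + δ), t ∈ S →
      ∀ t' ∈ Ioo (t₁ - δ) (t₁ + δ),
      ContMDiffAt (𝓘(ℝ, ℝ).prod 𝓘(ℝ, E)) 𝓘(ℝ, E) n (fun q : ℝ × V => flow hc q.1 q.2) (t', p) ∧
      ∀ v, diff E E (flow hc t') p (J v) = J (diff E E (flow hc t') p v) := by
    obtain ⟨ε, hε, W, hW, hpW, Φ, hΦ, hflow⟩ := exists_local_flow hZ (flow hc t₁ p) n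
    have hloc (s : ℝ) (hs : s ∈ Ioo (-ε) ε) (q : V) (hq : q ∈ W) : flow hc s q = Φ s q := by
      have := flow_eq_local hZ hc hε (hflow q hq).2.1 hs
      simpa [(hflow q hq).1] using this
    have h1 : ∀ᶠ t in 𝓝 t₁, flow hc t p ∈ W :=
      (mdiffAt_flow hc p t₁).continuousAt.eventually (hW.mem_nhds hpW)
    obtain ⟨δ₁, hδ₁, h2⟩ := Metric.eventually_nhds_iff_ball.1 h1
    refine ⟨min δ₁ (ε / 2), by positivity, fun t ht htS t' ht' => ?_⟩
    have hδa : min δ₁ (ε / 2) ≤ δ₁ := min_le_left _ _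
    have hδb : min δ₁ (ε / 2) ≤ ε / 2 := min_le_right _ _
    have htW : flow hc t p ∈ W := h2 t (by
      rw [Real.ball_eq_Ioo]; exact ⟨by linarith [ht.1], by linarith [ht.2]⟩)
    have hs : t' - t ∈ Ioo (-ε) ε :=
      ⟨by linarith [ht.1, ht.2, ht'.1, ht'.2], by linarith [ht.1, ht.2, ht'.1, ht'.2]⟩
    have hopen : IsOpen (Ioo (-ε) ε ×ˢ W) := isOpen_Ioo.prod hW
    have hmap : ContMDiffAt (𝓘(ℝ, ℝ).prod 𝓘(ℝ, E)) (𝓘(ℝ, ℝ).prod 𝓘(ℝ, E)) n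
        (fun q : ℝ × V => (q.1 - t, flow hc t q.2)) (t', p) := by
      refine ContMDiffAt.prodMk ?_ (ContMDiffAt.comp (t', p) htS.1 contMDiffAt_snd)
      have : ContMDiff 𝓘(ℝ, ℝ) 𝓘(ℝ, ℝ) n (fun x : ℝ => x - t) :=
        contMDiff_iff_contDiff.2 (contDiff_id.sub contDiff_const)
      exact this.contMDiffAt.comp (t', p) contMDiffAt_fst
    have hev : ∀ᶠ q : ℝ × V in 𝓝 (t', p), (q.1 - t, flow hc t q.2) ∈ Ioo (-ε) ε ×ˢ W :=
      hmap.continuousAt.eventually (hopen.mem_nhds ⟨hs, htW⟩)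
    have heq : (fun q : ℝ × V => flow hc q.1 q.2) =ᶠ[𝓝 (t', p)]
        fun q => Φ (q.1 - t) (flow hc t q.2) := by
      filter_upwards [hev] with q hq
      rw [← hloc _ hq.1 _ hq.2, ← flow_add hZ, sub_add_cancel]
    refine ⟨?_, fun v => ?_⟩
    · refine ContMDiffAt.congr_of_eventuallyEq ?_ heq
      exact ContMDiffAt.comp (t', p) (hΦ.contMDiffAt (hopen.mem_nhds ⟨hs, htW⟩)) hmap
    · have heq' : flow hc t' =ᶠ[𝓝 p] fun q => Φ (t' - t) (flow hc t q) :=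
        (Continuous.prodMk_right t').continuousAt.eventually heq
      have hΦ' : MDifferentiableAt 𝓘(ℝ, E) 𝓘(ℝ, E) (Φ (t' - t)) (flow hc t p) :=
        ((hΦ.contMDiffAt (hopen.mem_nhds (x := (t' - t, flow hc t p)) ⟨hs, htW⟩)).comp _
          (contMDiffAt_const.prodMk contMDiffAt_id)).mdifferentiableAt hn'
      rw [diff_congr heq', diff_comp_apply hΦ' (htS.1.mdifferentiableAt hn'),
        diff_comp_apply hΦ' (htS.1.mdifferentiableAt hn'), htS.2, ((hflow _ htW).2.2 _ hs)]
  have hSsub (t : ℝ) (h : ContMDiffAt (𝓘(ℝ, ℝ).prod 𝓘(ℝ, E)) 𝓘(ℝ, E) n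
      (fun q : ℝ × V => flow hc q.1 q.2) (t, p) ∧
      ∀ v, diff E E (flow hc t) p (J v) = J (diff E E (flow hc t) p v)) : t ∈ S :=
    ⟨h.1.comp p (contMDiffAt_const.prodMk contMDiffAt_id), h.2⟩
  have hS : S = univ := by
    refine IsClopen.eq_univ ⟨?_, ?_⟩ ⟨0, ?_, hJ0 p⟩
    · refine isOpen_compl_iff.1 (isOpen_iff_mem_nhds.2 fun t₁ ht₁ => ?_)
      obtain ⟨δ, hδ, h⟩ := key t₁
      filter_upwards [Ioo_mem_nhds (show t₁ - δ < t₁ by linarith) (show t₁ < t₁ + δ by linarith)]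
        with t ht htS
      exact ht₁ (hSsub _ (h t ht htS t₁ ⟨by linarith, by linarith⟩))
    · refine isOpen_iff_mem_nhds.2 fun t₁ ht₁ => ?_
      obtain ⟨δ, hδ, h⟩ := key t₁
      filter_upwards [Ioo_mem_nhds (show t₁ - δ < t₁ by linarith) (show t₁ < t₁ + δ by linarith)]
        with t ht
      exact hSsub _ (h t₁ ⟨by linarith, by linarith⟩ ht₁ t ht)
    · have h0 : flow hc 0 = fun q => q := funext (flow_zero hc)
      rw [h0]
      exact contMDiffAt_id
  obtain ⟨δ, hδ, h⟩ := key t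
  exact h t ⟨by linarith, by linarith⟩ (hS ▸ mem_univ t) t ⟨by linarith, by linarith⟩

/-- The flow is smooth in all variables. -/
lemma contMDiff_flow :
    ContMDiff (𝓘(ℝ, ℝ).prod 𝓘(ℝ, E)) 𝓘(ℝ, E) ∞ (fun q : ℝ × V => flow hc q.1 q.2) := by
  rw [contMDiff_infty]
  intro n q
  exact (flow_regular hZ hc (n + 1) (by simp) q.1 q.2).1.of_le
    (by exact_mod_cast Nat.le_add_right n 1)

lemma contMDiff_flow_right (t : ℝ) : ContMDiff 𝓘(ℝ, E) 𝓘(ℝ, E) ∞ (flow hc t) :=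
  (contMDiff_flow hZ hc).comp (contMDiff_const.prodMk contMDiff_id)

/-- The flow of a holomorphic vector field is holomorphic. -/
lemma diff_flow_J (t : ℝ) (p : V) (v : E) :
    diff E E (flow hc t) p (J v) = J (diff E E (flow hc t) p v) :=
  (flow_regular hZ hc 1 (by simp) t p).2 v

lemma diff_flow_neg_diff_flow (t : ℝ) (p : V) (v : E) :
    diff E E (flow hc (-t)) (flow hc t p) (diff E E (flow hc t) p v) = v := by
  rw [← diff_comp_apply (mdiffAt (contMDiff_flow_right hZ hc _) _)
    (mdiffAt (contMDiff_flow_right hZ hc _) _)]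
  simp only [flow_neg_flow hZ, diff_id]
  rfl

lemma diff_flow_surjective (t : ℝ) (p : V) (w : E) : ∃ v, diff E E (flow hc t) p v = w := by
  have h := diff_flow_neg_diff_flow hZ hc (-t) (flow hc t p) w
  rw [flow_neg_flow hZ, neg_neg] at h
  exact ⟨_, h⟩

/-- The flow as a map depending on variable times and points. -/
lemma contMDiff_flow_comp {F : Type*} [NormedAddCommGroup F] [NormedSpace ℝ F]
    {H : Type*} [TopologicalSpace H] {I : ModelWithCorners ℝ F H}
    {M : Type*} [TopologicalSpace M] [ChartedSpace H M] {τ : M → ℝ} {g : M → V}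
    (hτ : ContMDiff I 𝓘(ℝ, ℝ) ∞ τ) (hg : ContMDiff I 𝓘(ℝ, E) ∞ g) :
    ContMDiff I 𝓘(ℝ, E) ∞ (fun x => flow hc (τ x) (g x)) :=
  (contMDiff_flow hZ hc).comp (hτ.prodMk hg)

/-- The differential of `x ↦ flow (τ x) (g x)`. -/
lemma diff_flow_comp {F : Type*} [NormedAddCommGroup F] [NormedSpace ℝ F]
    {M : Type*} [TopologicalSpace M] [ChartedSpace F M] {τ : M → ℝ} {g : M → V} {x : M}
    (hτ : MDifferentiableAt 𝓘(ℝ, F) 𝓘(ℝ, ℝ) τ x) (hg : MDifferentiableAt 𝓘(ℝ, F) 𝓘(ℝ, E) g x)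
    (v : F) :
    diff F E (fun x => flow hc (τ x) (g x)) x v =
      diff E E (flow hc (τ x)) (g x) (diff F E g x v) +
        diff F ℝ τ x v • Z (flow hc (τ x) (g x)) := by
  have h := mfderiv_comp (I := 𝓘(ℝ, F)) (I' := 𝓘(ℝ, ℝ).prod 𝓘(ℝ, E)) (I'' := 𝓘(ℝ, E)) x
    (g := fun q : ℝ × V => flow hc q.1 q.2) (f := fun x => (τ x, g x))
    ((contMDiff_flow hZ hc _).mdifferentiableAt (by simp)) (hτ.prodMk hg)
  have h2 : diff F E (fun x => flow hc (τ x) (g x)) x v =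
      mfderiv (𝓘(ℝ, ℝ).prod 𝓘(ℝ, E)) 𝓘(ℝ, E) (fun q : ℝ × V => flow hc q.1 q.2) (τ x, g x)
        (diff F ℝ τ x v, diff F E g x v) := by
    change mfderiv 𝓘(ℝ, F) 𝓘(ℝ, E) ((fun q : ℝ × V => flow hc q.1 q.2) ∘ fun x => (τ x, g x)) x v = _
    rw [h, mfderiv_prodMk hτ hg]
    rfl
  have h3 : (diff F ℝ τ x v) • Z (flow hc (τ x) (g x)) =
      diff ℝ E (fun t => flow hc t (g x)) (τ x) (diff F ℝ τ x v) := by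
    rw [← diff_flow_time hc (g x) (τ x), ← map_smul, smul_eq_mul, mul_one]
  rw [h2, h3, add_comm]
  exact mfderiv_prod_eq_add_apply (I := 𝓘(ℝ, ℝ)) (I' := 𝓘(ℝ, E)) (I'' := 𝓘(ℝ, E))
    (f := fun q : ℝ × V => flow hc q.1 q.2) (p := (τ x, g x))
    (v := (diff F ℝ τ x v, diff F E g x v))
    ((contMDiff_flow hZ hc _).mdifferentiableAt (by simp))

end

section Torus

variable {d : ℕ} [MulAction (Torus d) V] (hT : IsHolomorphicTorusAction E V d)
  {Y : Fin d → ℝ} (hc : IsCompleteField (radial (field E V Y)))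
include hT

lemma isHolField_radial (Y : Fin d → ℝ) : IsHolField (radial (field E V Y)) :=
  (isHolField_field hT Y).radial

lemma flow_smul_torus (g : Torus d) (t : ℝ) (p : V) :
    flow hc t (g • p) = g • flow hc t p := by
  have h := isMIntegralCurve_map (fun p => mdiffAt (contMDiff_smul_torus hT g) p)
    (diff_smul_torus_radial hT g Y) ((flow_isMIntegralCurve hc p).isMIntegralCurveOn univ)
  have h2 := flow_eq_of_isMIntegralCurve (isHolField_radial hT Y) hc
    (isMIntegralCurve_iff_isMIntegralCurveOn.2 h) t
  simpa [flow_zero] using h2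

/-- The torus is abelian and acts holomorphically, so the flow of -JY commutes with the action and
preserves every induced field. -/
lemma diff_flow_field (Y' : Fin d → ℝ) (t : ℝ) (p : V) :
    diff E E (flow hc t) p (field E V Y' p) = field E V Y' (flow hc t p) :=
  diff_field_of_commute hT Y' (mdiffAt (contMDiff_flow_right (isHolField_radial hT Y) hc t) p)
    fun _ => flow_smul_torus hT hc _ _ _

lemma diff_flow_radial (Y' : Fin d → ℝ) (t : ℝ) (p : V) :
    diff E E (flow hc t) p (radial (field E V Y') p) = radial (field E V Y') (flow hc t p) := by
  rw [radial, map_neg, diff_flow_J (isHolField_radial hT Y), diff_flow_field hT]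
  rfl

end Torus

/-- The equation `h' = c h` along `ℝ`. -/
lemma eq_exp_of_hasDerivAt {h : ℝ → ℝ} {c : ℝ} (hh : ∀ t, HasDerivAt h (c * h t) t) (t : ℝ) :
    h t = Real.exp (c * t) * h 0 := by
  have h1 (t : ℝ) : HasDerivAt (fun t => Real.exp (-(c * t)) * h t) 0 t := by
    have h2 : HasDerivAt (fun t => Real.exp (-(c * t))) (Real.exp (-(c * t)) * -(c * 1)) t :=
      (((hasDerivAt_id t).const_mul c).neg).exp
    convert! h2.mul (hh t) using 1
    ring
  have h3 := is_const_of_deriv_eq_zero (fun t => (h1 t).differentiableAt) (fun t => (h1 t).deriv) t 0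
  simp only [mul_zero, neg_zero, Real.exp_zero, one_mul] at h3
  rw [← h3, ← mul_assoc, ← Real.exp_add]
  simp

/-- Positive functions which are invariant along `ξ` and homogeneous along `-Jξ`. -/
structure IsConeFn (ξ : VField E V) (r : V → ℝ) : Prop where
  smooth : ContMDiff 𝓘(ℝ, E) 𝓘(ℝ, ℝ) ∞ r
  pos : ∀ p, 0 < r p
  invariant : ∀ p, diff E ℝ r p (ξ p) = 0
  homogeneous : ∀ p, diff E ℝ r p (radial ξ p) = r p

lemma IsConePotential.isConeFn {ξ : VField E V} {r : V → ℝ}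
    (hr : IsConePotential ξ r) : IsConeFn ξ r :=
  ⟨hr.smooth, hr.pos, hr.invariant, hr.homogeneous⟩

lemma IsConeFn.flow_eq {ξ : VField E V} {r : V → ℝ} (hr : IsConeFn ξ r)
    (hc : IsCompleteField (radial ξ)) (t : ℝ) (p : V) :
    r (flow hc t p) = Real.exp t * r p := by
  have h := eq_exp_of_hasDerivAt (h := fun t => r (flow hc t p)) (c := 1) (fun t => by
    rw [one_mul]
    have := hasDerivAt_comp_flow hc (p := p) (t := t) (mdiffAt hr.smooth _)
    rwa [hr.homogeneous] at this) t
  simpa [flow_zero] using h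

lemma IsConeFn.log_flow {ξ : VField E V} {r : V → ℝ} (hr : IsConeFn ξ r)
    (hc : IsCompleteField (radial ξ)) (t : ℝ) (p : V) :
    Real.log (r (flow hc t p)) = t + Real.log (r p) := by
  rw [hr.flow_eq, Real.log_mul (Real.exp_pos t).ne' (hr.pos p).ne', Real.log_exp]

end GlobalFlow

end SasakiCone

end

noncomputable section

set_option linter.unusedSectionVars false

namespace SasakiCone

/-! ### Local sections of submersions and descent of smoothness. -/

section Submersion

variable {F : Type*} [NormedAddCommGroup F] [NormedSpace ℝ F]
variable {F' : Type*} [NormedAddCommGroup F'] [NormedSpace ℝ F'] [FiniteDimensional ℝ F']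
variable {M : Type*} [TopologicalSpace M] [ChartedSpace F M] [IsManifold 𝓘(ℝ, F) ∞ M]
variable {M' : Type*} [TopologicalSpace M'] [ChartedSpace F' M'] [IsManifold 𝓘(ℝ, F') ∞ M']

/-- Submersions have local sections through every point. -/
lemma exists_local_section {π : M → M'} (hπ : ContMDiff 𝓘(ℝ, F) 𝓘(ℝ, F') ∞ π) (p : M)
    (hs : Function.Surjective (diff F F' π p)) :
    ∃ s : M' → M, ContMDiffAt 𝓘(ℝ, F') 𝓘(ℝ, F) ∞ s (π p) ∧ s (π p) = p ∧
      ∀ᶠ x in 𝓝 (π p), π (s x) = x := by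
  have : CompleteSpace F' := FiniteDimensional.complete ℝ F'
  set e := extChartAt 𝓘(ℝ, F) p with he
  set e' := extChartAt 𝓘(ℝ, F') (π p) with he'
  -- A right inverse of dπ gives an affine slice through p on which π has invertible derivative; the
  -- inverse function theorem on this slice yields the section.
  obtain ⟨R, hR⟩ := (diff F F' π p).exists_rightInverse_of_surjective
    (LinearMap.range_eq_top.2 hs)
  have hy : e p ∈ e.target := mem_extChartAt_target p
  have hsymm : e.symm (e p) = p := extChartAt_to_inv p
  have hsrc : π (e.symm (e p)) ∈ e'.source := by rw [hsymm]; exact mem_extChartAt_source (π p)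
  have hG : ContDiffAt ℝ ∞ (fun y => e' (π (e.symm y))) (e p) :=
    contDiffAt_inCharts le_rfl hy (hπ _) hsrc
  have hGd : fderiv ℝ (fun y => e' (π (e.symm y))) (e p) = diff F F' π p := by
    ext v
    rw [← diff_eq_fderiv, diff_comp_apply (g := e') (f := fun y => π (e.symm y))
      (mdiffAt_extChartAt hsrc) ((mdiffAt hπ _).comp _ (mdiffAt_extChartAt_symm hy)),
      diff_comp_apply (g := π) (f := e.symm) (mdiffAt hπ _) (mdiffAt_extChartAt_symm hy)]
    have h1 : diff F F e.symm (e p) v = v := by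
      have := diff_extChartAt_symm_diff (mem_extChartAt_source (I := 𝓘(ℝ, F)) p) v
      rwa [diff_extChartAt_self] at this
    rw [h1, hsymm, he', diff_extChartAt_self]
    rfl
  have hl : HasFDerivAt (fun w => e p + R w) R 0 := R.hasFDerivAt.const_add (e p)
  have h0 : e p + R 0 = e p := by simp
  have hg : ContDiffAt ℝ ∞ (fun w => e' (π (e.symm (e p + R w)))) 0 :=
    ContDiffAt.comp (0 : F') (g := fun y => e' (π (e.symm y))) (f := fun w => e p + R w)
      (by rwa [h0]) (contDiff_const.add R.contDiff).contDiffAt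
  have hgd : HasFDerivAt (fun w => e' (π (e.symm (e p + R w))))
      ((ContinuousLinearEquiv.refl ℝ F' : F' ≃L[ℝ] F') : F' →L[ℝ] F') 0 := by
    have h1 : HasFDerivAt (fun y => e' (π (e.symm y))) (diff F F' π p) (e p + R 0) := by
      rw [h0, ← hGd]; exact (hG.differentiableAt (by simp)).hasFDerivAt
    have h2 := h1.comp (0 : F') hl
    rw [hR] at h2
    exact h2
  have hg0 : e' (π (e.symm (e p + R 0))) = e' (π p) := by rw [h0, hsymm]
  let h := hg.localInverse hgd (by simp)
  have hh : ContDiffAt ℝ ∞ h (e' (π p)) := hg0 ▸ hg.to_localInverse hgd (by simp)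
  have hh0 : h (e' (π p)) = 0 := hg0 ▸ hg.localInverse_apply_image hgd (by simp)
  have hinv : ∀ᶠ z in 𝓝 (e' (π p)), e' (π (e.symm (e p + R (h z)))) = z :=
    hg0 ▸ (hg.hasStrictFDerivAt' hgd (by simp)).eventually_right_inverse
  have he'c : ContMDiffAt 𝓘(ℝ, F') 𝓘(ℝ, F') ∞ e' (π p) := contMDiffAt_extChartAt
  have hkc : ContDiffAt ℝ ∞ (fun z => e p + R (h z)) (e' (π p)) :=
    contDiffAt_const.add (R.contDiff.contDiffAt.comp _ hh)
  have hk0 : e p + R (h (e' (π p))) = e p := by rw [hh0, map_zero, add_zero]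
  have hs1 : ContMDiffAt 𝓘(ℝ, F') 𝓘(ℝ, F) ∞ (fun x => e p + R (h (e' x))) (π p) :=
    (contMDiffAt_iff_contDiffAt.2 hkc).comp (π p) he'c
  have hsm : ContMDiffAt 𝓘(ℝ, F') 𝓘(ℝ, F) ∞ (fun x => e.symm (e p + R (h (e' x)))) (π p) := by
    refine ContMDiffAt.comp (π p) (g := e.symm) ?_ hs1
    rw [hk0]
    exact contMDiffAt_extChartAt_symm hy
  refine ⟨fun x => e.symm (e p + R (h (e' x))), hsm, by simp only [hk0, hsymm], ?_⟩
  have hcont : ContinuousAt (fun x => π (e.symm (e p + R (h (e' x))))) (π p) :=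
    ContinuousAt.comp (g := π) (hπ.continuous.continuousAt) hsm.continuousAt
  have hopen : e'.source ∈ 𝓝 (π (e.symm (e p + R (h (e' (π p)))))) := by
    rw [hk0, hsymm]
    exact (isOpen_extChartAt_source (π p)).mem_nhds (mem_extChartAt_source (π p))
  filter_upwards [he'c.continuousAt.eventually hinv, hcont.eventually hopen,
    (isOpen_extChartAt_source (I := 𝓘(ℝ, F')) (π p)).mem_nhds (mem_extChartAt_source (π p))]
    with x hx hx2 hx3
  exact e'.injOn hx2 hx3 hx

variable {G : Type*} [NormedAddCommGroup G] [NormedSpace ℝ G]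
  {H : Type*} [TopologicalSpace H] {I : ModelWithCorners ℝ G H}
  {Q : Type*} [TopologicalSpace Q] [ChartedSpace H Q]

/-- A map which is smooth after composition with a surjective submersion is smooth. -/
lemma contMDiff_of_comp_submersion {π : M → M'} (hπ : ContMDiff 𝓘(ℝ, F) 𝓘(ℝ, F') ∞ π)
    (hsurj : Function.Surjective π) (hs : ∀ p, Function.Surjective (diff F F' π p)) {f : M' → Q}
    (hf : ContMDiff 𝓘(ℝ, F) I ∞ (fun p => f (π p))) : ContMDiff 𝓘(ℝ, F') I ∞ f := by
  intro x
  obtain ⟨p, rfl⟩ := hsurj x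
  obtain ⟨s, hs1, hs2, hs3⟩ := exists_local_section hπ p (hs p)
  have h : ContMDiffAt 𝓘(ℝ, F') I ∞ (fun x => f (π (s x))) (π p) :=
    ContMDiffAt.comp (π p) (g := fun p => f (π p)) (hf _) hs1
  refine h.congr_of_eventuallyEq ?_
  filter_upwards [hs3] with x hx
  rw [hx]

/-- The version of `contMDiff_of_comp_submersion` for families. -/
lemma smoothFamilyOn_of_comp_submersion {P : Type*} [NormedAddCommGroup P] [NormedSpace ℝ P]
    {U : Set P} (hU : IsOpen U) {π : M → M'} (hπ : ContMDiff 𝓘(ℝ, F) 𝓘(ℝ, F') ∞ π)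
    (hsurj : Function.Surjective π) (hs : ∀ p, Function.Surjective (diff F F' π p))
    {f : P → M' → ℝ} (hf : SmoothFamilyOn F U (fun s p => f s (π p))) : SmoothFamilyOn F' U f := by
  rintro ⟨a, x⟩ ⟨ha, -⟩
  obtain ⟨p, rfl⟩ := hsurj x
  obtain ⟨s, hs1, hs2, hs3⟩ := exists_local_section hπ p (hs p)
  have h1 : ContMDiffAt (𝓘(ℝ, P).prod 𝓘(ℝ, F)) 𝓘(ℝ, ℝ) ∞
      (fun q : P × M => f q.1 (π q.2)) (a, s (π p)) :=
    ContMDiffOn.contMDiffAt hf ((hU.prod isOpen_univ).mem_nhds ⟨ha, trivial⟩)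
  have h2 : ContMDiffAt (𝓘(ℝ, P).prod 𝓘(ℝ, F')) (𝓘(ℝ, P).prod 𝓘(ℝ, F)) ∞
      (fun q : P × M' => (q.1, s q.2)) (a, π p) :=
    contMDiffAt_fst.prodMk (ContMDiffAt.comp (a, π p) hs1 contMDiffAt_snd)
  have h3 := ContMDiffAt.comp (a, π p) (g := fun q : P × M => f q.1 (π q.2)) h1 h2
  refine (h3.congr_of_eventuallyEq ?_).contMDiffWithinAt
  filter_upwards [continuousAt_snd.eventually hs3] with q hq
  simp only [Function.comp_apply]
  rw [hq]

end Submersion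

/-! ### The orbit space realized as the level set r = 1. -/

section OrbitSpace

variable {E : Type*} [NormedAddCommGroup E] [NormedSpace ℂ E] [FiniteDimensional ℂ E]
variable {V : Type*} [TopologicalSpace V] [ChartedSpace E V] [IsManifold 𝓘(ℂ, E) ω V] [T2Space V]
variable {F : Type*} [NormedAddCommGroup F] [NormedSpace ℝ F] [FiniteDimensional ℝ F]
variable {N : Type*} [TopologicalSpace N] [ChartedSpace F N] [IsManifold 𝓘(ℝ, F) ∞ N]
variable {ξ : VField E V} {r : V → ℝ}

lemma IsConeFn.contMDiff_log (hr : IsConeFn ξ r) :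
    ContMDiff 𝓘(ℝ, E) 𝓘(ℝ, ℝ) ∞ (fun p => Real.log (r p)) := fun p =>
  ContMDiffAt.comp p (contMDiffAt_iff_contDiffAt.2 (Real.contDiffAt_log.2 (hr.pos p).ne'))
    (hr.smooth p)

lemma diff_log {f : V → ℝ} {p : V} (hf : MDifferentiableAt 𝓘(ℝ, E) 𝓘(ℝ, ℝ) f p) (h0 : f p ≠ 0)
    (v : E) : diff E ℝ (fun p => Real.log (f p)) p v = diff E ℝ f p v / f p := by
  rw [diff_comp_apply (g := Real.log) (f := f)
    (mdifferentiableAt_iff_differentiableAt.2 (Real.differentiableAt_log h0)) hf, diff_eq_fderiv,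
    (Real.hasDerivAt_log h0).hasFDerivAt.fderiv]
  simp [div_eq_mul_inv]

/-- The retraction onto the level set `r = 1` along the flow of `-Jξ`. -/
def retr (hc : IsCompleteField (radial ξ)) (r : V → ℝ) (p : V) : V := flow hc (-Real.log (r p)) p

section Retr

variable (hξ : IsHolField ξ) (hr : IsConeFn ξ r) (hc : IsCompleteField (radial ξ))
include hr

lemma r_retr (p : V) : r (retr hc r p) = 1 := by
  rw [retr, hr.flow_eq, Real.exp_neg, Real.exp_log (hr.pos p), inv_mul_cancel₀ (hr.pos p).ne']

omit hr in
lemma retr_of_eq_one {p : V} (hp : r p = 1) : retr hc r p = p := by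
  rw [retr, hp, Real.log_one, neg_zero, flow_zero]

include hξ

lemma retr_flow (t : ℝ) (p : V) : retr hc r (flow hc t p) = retr hc r p := by
  rw [retr, retr, ← flow_add hξ.radial, hr.log_flow hc]
  congr 1
  ring

lemma contMDiff_retr : ContMDiff 𝓘(ℝ, E) 𝓘(ℝ, E) ∞ (retr hc r) := by
  have h := hr.contMDiff_log.neg
  exact contMDiff_flow_comp hξ.radial hc h contMDiff_id

lemma diff_retr (p : V) (v : E) :
    diff E E (retr hc r) p v = diff E E (flow hc (-Real.log (r p))) p v -
      (diff E ℝ r p v / r p) • radial ξ (retr hc r p) := by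
  have h1 : ContMDiff 𝓘(ℝ, E) 𝓘(ℝ, ℝ) ∞ (fun p => -Real.log (r p)) := hr.contMDiff_log.neg
  have h2 : diff E ℝ (fun p => -Real.log (r p)) p v = -(diff E ℝ r p v / r p) := by
    rw [← diff_log (mdiffAt hr.smooth p) (hr.pos p).ne']
    have := congrArg (fun A : E →L[ℝ] ℝ => A v)
      (mfderiv_neg (I := 𝓘(ℝ, E)) (f := fun p => Real.log (r p)) (x := p))
    exact this
  have h3 := diff_flow_comp hξ.radial hc (τ := fun p => -Real.log (r p)) (g := fun p => p)
    (mdiffAt h1 p) mdifferentiableAt_id v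
  rw [h2, diff_id, neg_smul] at h3
  rw [sub_eq_add_neg]
  exact h3

end Retr

variable {π : V → N} (hξ : IsHolField ξ) (hr : IsConeFn ξ r)
  (hπ : IsOrbitSpace F (radial ξ) π)

lemma IsOrbitSpace.isCompleteField (hπ : IsOrbitSpace F (radial ξ) π) :
    IsCompleteField (radial ξ) := hπ.complete

section

include hπ
lemma π_flow (t : ℝ) (p : V) : π (flow hπ.isCompleteField t p) = π p :=
  ((hπ.fibre p _).2 ⟨_, flow_isMIntegralCurve hπ.isCompleteField p, flow_zero _ p, t, rfl⟩).symm

lemma diff_π_radial (p : V) : diff E F π p (radial ξ p) = 0 := by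
  have h := diff_comp_apply (g := π) (f := fun t => flow hπ.isCompleteField t p) (x := 0)
    (mdiffAt hπ.smooth _) (mdiffAt_flow _ p 0) 1
  simp only [π_flow hπ, diff_const, diff_flow_time, flow_zero] at h
  exact h.symm

include hξ in
lemma diff_π_flow (t : ℝ) (p : V) (v : E) :
    diff E F π (flow hπ.isCompleteField t p) (diff E E (flow hπ.isCompleteField t) p v) =
      diff E F π p v := by
  rw [← diff_comp_apply (g := π) (mdiffAt hπ.smooth _)
    (mdiffAt (contMDiff_flow_right hξ.radial _ t) p)]
  simp only [π_flow hπ]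

lemma diff_π_J_field (p : V) : diff E F π p (J (ξ p)) = 0 := by
  have := diff_π_radial hπ p
  rwa [radial, map_neg, neg_eq_zero] at this

lemma π_retr (p : V) : π (retr hπ.isCompleteField r p) = π p := π_flow hπ _ _

include hξ in
lemma exists_flow_of_π_eq {p q : V} (h : π p = π q) : ∃ t, flow hπ.isCompleteField t p = q := by
  obtain ⟨γ, hγ, rfl, t, rfl⟩ := (hπ.fibre p q).1 h
  exact ⟨t, flow_eq_of_isMIntegralCurve hξ.radial _ hγ t⟩

end

/-- The section of the orbit space with values in the level set `r = 1`. -/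
def sec (hπ : IsOrbitSpace F (radial ξ) π) (r : V → ℝ) (x : N) : V :=
  retr hπ.isCompleteField r (hπ.surjective x).choose

include hr

lemma r_sec (x : N) : r (sec hπ r x) = 1 := r_retr hr _ _

omit hr in
lemma π_sec (x : N) : π (sec hπ r x) = x :=
  (π_retr hπ _).trans (hπ.surjective x).choose_spec

include hξ

/-- The preimage chosen in `sec` lies on the orbit of `p`, and `retr` is constant along orbits, so
the choice has no effect. -/
lemma sec_π (p : V) : sec hπ r (π p) = retr hπ.isCompleteField r p := by
  obtain ⟨t, ht⟩ := exists_flow_of_π_eq hξ hπ (hπ.surjective (π p)).choose_spec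
  rw [sec, ← retr_flow hξ hr _ t, ht]

lemma sec_π_of_eq_one {p : V} (hp : r p = 1) : sec hπ r (π p) = p := by
  rw [sec_π hξ hr hπ, retr_of_eq_one _ hp]

lemma flow_log_sec (p : V) : flow hπ.isCompleteField (Real.log (r p)) (sec hπ r (π p)) = p := by
  rw [sec_π hξ hr hπ, retr, flow_flow_neg hξ.radial]

/-- Smoothness can be tested after composition with the submersion π, where the section becomes the
retraction. -/
lemma contMDiff_sec : ContMDiff 𝓘(ℝ, F) 𝓘(ℝ, E) ∞ (sec hπ r) := by
  refine contMDiff_of_comp_submersion hπ.smooth hπ.surjective hπ.submersion ?_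
  have : (fun p => sec hπ r (π p)) = retr hπ.isCompleteField r := funext (sec_π hξ hr hπ)
  rw [this]
  exact contMDiff_retr hξ hr _

lemma diff_π_diff_sec (x : N) (w : F) : diff E F π (sec hπ r x) (diff F E (sec hπ r) x w) = w := by
  rw [← diff_comp_apply (g := π) (mdiffAt hπ.smooth _) (mdiffAt (contMDiff_sec hξ hr hπ) x)]
  simp only [π_sec, diff_id]
  rfl

lemma diff_sec_diff_π (p : V) (v : E) :
    diff F E (sec hπ r) (π p) (diff E F π p v) = diff E E (retr hπ.isCompleteField r) p v := by
  rw [← diff_comp_apply (mdiffAt (contMDiff_sec hξ hr hπ) _) (mdiffAt hπ.smooth p)]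
  simp only [sec_π hξ hr hπ]

include hπ

/-- The kernel of `dπ` is spanned by the radial field. -/
lemma eq_smul_radial_of_diff_π_eq_zero {p : V} {v : E} (hv : diff E F π p v = 0) :
    v = (diff E ℝ r p v / r p) • radial ξ p := by
  -- As `sec ∘ π` is the retraction, v is killed by the differential of `retr`. Undoing the flow in
  -- that equation expresses v through the radial field.
  have h := diff_sec_diff_π hξ hr hπ p v
  rw [hv, map_zero, diff_retr hξ hr] at h
  have h2 := congrArg (diff E E (flow hπ.isCompleteField (Real.log (r p)))
    (retr hπ.isCompleteField r p)) h.symm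
  have h3 : diff E E (flow hπ.isCompleteField (Real.log (r p)))
    (retr hπ.isCompleteField r p) (diff E E (flow hπ.isCompleteField (-Real.log (r p))) p v) = v := by
    have := diff_flow_neg_diff_flow hξ.radial hπ.isCompleteField (-Real.log (r p)) p v
    rwa [neg_neg] at this
  have h4 : diff E E (flow hπ.isCompleteField (Real.log (r p)))
    (retr hπ.isCompleteField r p) (radial ξ (retr hπ.isCompleteField r p)) = radial ξ p := by
    have h5 := diff_comp_apply (g := flow hπ.isCompleteField (Real.log (r p)))
      (f := fun t => flow hπ.isCompleteField t p) (x := -Real.log (r p))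
      (mdiffAt (contMDiff_flow_right hξ.radial _ _) _) (mdiffAt_flow _ p _) 1
    rw [diff_flow_time] at h5
    refine Eq.trans h5.symm ?_
    simp only [← flow_add hξ.radial]
    have h6 := diff_comp_apply (g := fun t => flow hπ.isCompleteField t p)
      (f := fun t : ℝ => Real.log (r p) + t) (x := -Real.log (r p)) (mdiffAt_flow _ p _)
      (mdifferentiableAt_iff_differentiableAt.2 (by fun_prop)) 1
    rw [diff_eq_fderiv, fderiv_const_add, fderiv_fun_id, ContinuousLinearMap.id_apply, diff_flow_time,
      add_neg_cancel, flow_zero] at h6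
    exact h6
  rw [map_sub, map_smul, map_zero, h3, h4, sub_eq_zero] at h2
  exact h2

omit hξ hr in
/-- The level set `r = 1` is compact if the orbit space is. -/
lemma isCompact_level [CompactSpace N] (hξ : IsHolField ξ) (hr : IsConeFn ξ r) :
    IsCompact {p | r p = 1} := by
  have : {p | r p = 1} = Set.range (sec hπ r) := by
    ext p
    exact ⟨fun hp => ⟨π p, sec_π_of_eq_one hξ hr hπ hp⟩, by rintro ⟨x, rfl⟩; exact r_sec hr hπ x⟩
  rw [this]
  exact isCompact_range (contMDiff_sec hξ hr hπ).continuous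

end OrbitSpace

end SasakiCone

end

noncomputable section

set_option linter.unusedSectionVars false

namespace SasakiCone

/-! ### Descent of forms and fields to a quotient. -/

section Descent

variable {F : Type*} [NormedAddCommGroup F] [NormedSpace ℝ F]
variable {F' : Type*} [NormedAddCommGroup F'] [NormedSpace ℝ F']
variable {M : Type*} [TopologicalSpace M] [ChartedSpace F M]
variable {M' : Type*} [TopologicalSpace M'] [ChartedSpace F' M']

lemma pullback_injective {π : M → M'} (hs : Function.Surjective π)
    (hd : ∀ p, Function.Surjective (diff F F' π p)) {β β' : OneForm F' M'}
    (h : (OneForm.pullback π β : OneForm F M) = OneForm.pullback π β') : β = β' := by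
  funext x
  obtain ⟨p, rfl⟩ := hs x
  ext w
  obtain ⟨v, rfl⟩ := hd p w
  exact congrArg (fun A : F →L[ℝ] ℝ => A v) (congrFun h p)

/-- Pullback by a surjective submersion is injective, which makes the choice in `OneForm.descend`
irrelevant. -/
lemma descend_eq {π : M → M'} (hs : Function.Surjective π)
    (hd : ∀ p, Function.Surjective (diff F F' π p)) {β : OneForm F' M'} {α : OneForm F M}
    (h : OneForm.pullback π β = α) : OneForm.descend π α = β := by
  have hex : ∃ β : OneForm F' M', OneForm.pullback π β = α := ⟨β, h⟩
  refine pullback_injective hs hd ?_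
  rw [h, OneForm.descend, dif_pos hex]
  exact hex.choose_spec

lemma vfield_descend_eq {π : M → M'} {ζ : VField F M}
    (h : ∃ W : VField F' M', ∀ p : M, W (π p) = diff F F' π p (ζ p)) (p : M) :
    VField.descend π ζ (π p) = diff F F' π p (ζ p) := by
  rw [VField.descend, dif_pos h]
  exact h.choose_spec p

end Descent

/-! ### The Levi form of a homogeneous function. -/

section Levi

variable {E : Type*} [NormedAddCommGroup E] [NormedSpace ℂ E]
variable {V : Type*} [TopologicalSpace V] [ChartedSpace E V] [IsManifold 𝓘(ℂ, E) ω V]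
variable {ξ : VField E V} {r : V → ℝ}

lemma extDer_add_right (α : OneForm E V) (x : V) (v w w' : E) :
    OneForm.extDer α x v (w + w') = OneForm.extDer α x v w + OneForm.extDer α x v w' := by
  rw [extDer_swap, extDer_add_left, extDer_swap α x w, extDer_swap α x w']
  ring

lemma extDer_smul_right (α : OneForm E V) (x : V) (c : ℝ) (v w : E) :
    OneForm.extDer α x v (c • w) = c * OneForm.extDer α x v w := by
  rw [extDer_swap, extDer_smul_left, extDer_swap α x w]
  ring

lemma J_radial (p : V) : J (radial ξ p) = ξ p := by
  rw [radial, map_neg, J_J, neg_neg]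

lemma J_field (p : V) : J (ξ p) = -radial ξ p := by
  rw [radial, neg_neg]

variable (hξ : IsHolField ξ) (hr : IsConeFn ξ r)

include hr

lemma IsConeFn.diff_J_field (p : V) : diff E ℝ r p (J (ξ p)) = -r p := by
  rw [J_field, map_neg, hr.homogeneous]

lemma IsConeFn.diff_J_radial (p : V) : diff E ℝ r p (J (radial ξ p)) = 0 := by
  rw [J_radial, hr.invariant]

include hξ

/-- The contraction formula `extDer_dc_field`, in which homogeneity replaces dr(-Jξ) by r. -/
lemma IsConeFn.extDer_field (p : V) (w : E) :
    OneForm.extDer (dc E r) p (ξ p) w = -diff E ℝ r p w := by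
  rw [extDer_dc_field hr.smooth hξ hr.invariant]
  simp only [hr.homogeneous]

lemma IsConeFn.extDer_radial (p : V) (w : E) :
    OneForm.extDer (dc E r) p (radial ξ p) w = -diff E ℝ r p (J w) := by
  rw [← extDer_dc_J_J hr.smooth, J_radial, hr.extDer_field hξ]

/-- The splitting of `dd^c r` along the distribution `ker dr ∩ ker d^c r` and its complement spanned
by `ξ` and `-Jξ`. -/
lemma IsConeFn.extDer_split (p : V) {u : E} (hu : diff E ℝ r p u = 0)
    (hu' : diff E ℝ r p (J u) = 0) (a b : ℝ) :
    OneForm.extDer (dc E r) p (u + a • ξ p + b • radial ξ p)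
        (J (u + a • ξ p + b • radial ξ p)) =
      OneForm.extDer (dc E r) p u (J u) + r p * (a ^ 2 + b ^ 2) := by
  have h1 (w : E) : OneForm.extDer (dc E r) p w (ξ p) = diff E ℝ r p w := by
    rw [extDer_swap, hr.extDer_field hξ, neg_neg]
  have h2 (w : E) : OneForm.extDer (dc E r) p w (radial ξ p) = diff E ℝ r p (J w) := by
    rw [extDer_swap, hr.extDer_radial hξ, neg_neg]
  have h3 : J (u + a • ξ p + b • radial ξ p) = J u + (-a) • radial ξ p + b • ξ p := by
    rw [map_add, map_add, map_smul, map_smul, J_radial, J_field]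
    simp
  rw [h3]
  simp only [extDer_add_left, extDer_add_right, extDer_smul_left, extDer_smul_right,
    hr.extDer_field hξ, hr.extDer_radial hξ, h1, h2, hu, hu', hr.invariant, hr.homogeneous,
    J_J, map_neg, map_add, map_smul, hr.diff_J_field, hr.diff_J_radial, smul_eq_mul]
  ring

omit hξ in
-- Up to the factor r, the fields ξ and -Jξ are dual to the forms d^c r and dr, which dictates the
-- two coefficients.
lemma IsConeFn.exists_split (p : V) (v : E) : ∃ u : E, diff E ℝ r p u = 0 ∧
    diff E ℝ r p (J u) = 0 ∧
    v = u + (-(diff E ℝ r p (J v) / r p)) • ξ p + (diff E ℝ r p v / r p) • radial ξ p := by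
  have h0 := (hr.pos p).ne'
  refine ⟨v - (-(diff E ℝ r p (J v) / r p)) • ξ p - (diff E ℝ r p v / r p) • radial ξ p, ?_, ?_, ?_⟩
  · simp only [map_sub, map_smul, hr.invariant, hr.homogeneous, smul_eq_mul]
    field_simp
    ring
  · simp only [map_sub, map_smul, hr.diff_J_field, hr.diff_J_radial, smul_eq_mul]
    field_simp
    ring
  · abel

/-- Strict plurisubharmonicity of a homogeneous function can be tested on `ker dr ∩ ker d^c r`. -/
lemma IsConeFn.isConePotential (hpos : ∀ (p : V) (u : E), diff E ℝ r p u = 0 →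
    diff E ℝ r p (J u) = 0 → u ≠ 0 → 0 < OneForm.extDer (dc E r) p u (J u)) :
    IsConePotential ξ r := by
  refine ⟨hr.smooth, hr.pos, hr.invariant, hr.homogeneous, fun p v hv => ?_⟩
  obtain ⟨u, hu, hu', hs⟩ := hr.exists_split p v
  set a := -(diff E ℝ r p (J v) / r p)
  set b := diff E ℝ r p v / r p
  rw [hs, hr.extDer_split hξ p hu hu']
  have hrp := hr.pos p
  by_cases hu0 : u = 0
  · have h1 : OneForm.extDer (dc E r) p u (J u) = 0 := by
      rw [hu0, ← zero_smul ℝ (0 : E), extDer_smul_left, zero_mul]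
    have h2 : 0 < a ^ 2 + b ^ 2 := by
      rcases eq_or_ne a 0 with ha | ha
      · rcases eq_or_ne b 0 with hb | hb
        · rw [ha, hb, hu0] at hs
          exact absurd (by simpa using hs) hv
        · positivity
      · positivity
    rw [h1, zero_add]
    positivity
  · have := hpos p u hu hu' hu0
    positivity

end Levi

/-! ### Contact forms on the orbit space and Sasaki structures. -/

section Contact

variable {E : Type*} [NormedAddCommGroup E] [NormedSpace ℂ E] [FiniteDimensional ℂ E]
variable {V : Type*} [TopologicalSpace V] [ChartedSpace E V] [IsManifold 𝓘(ℂ, E) ω V] [T2Space V]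
variable {F : Type*} [NormedAddCommGroup F] [NormedSpace ℝ F] [FiniteDimensional ℝ F]
variable {N : Type*} [TopologicalSpace N] [ChartedSpace F N] [IsManifold 𝓘(ℝ, F) ∞ N]
variable {ξ : VField E V} {r : V → ℝ} {π : V → N}
variable (hξ : IsHolField ξ) (hr : IsConeFn ξ r) (hπ : IsOrbitSpace F (radial ξ) π)

include hξ hπ

/-- Fields preserved by the flow descend to the orbit space. -/
lemma descend_field {ζ : VField E V} (hζ : ∀ t p, diff E E (flow hπ.isCompleteField t) p (ζ p) =
    ζ (flow hπ.isCompleteField t p)) (p : V) :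
    VField.descend π ζ (π p) = diff E F π p (ζ p) := by
  refine vfield_descend_eq ⟨fun x => diff E F π (hπ.surjective x).choose
    (ζ (hπ.surjective x).choose), fun p => ?_⟩ p
  obtain ⟨t, ht⟩ := exists_flow_of_π_eq hξ hπ (hπ.surjective (π p)).choose_spec.symm
  change diff E F π (hπ.surjective (π p)).choose (ζ (hπ.surjective (π p)).choose) = _
  rw [← ht, ← hζ, diff_π_flow hξ hπ]

include hr

/-- Basic forms are pulled back from the orbit space. -/
lemma pullback_pullback_sec {α : OneForm E V} (h0 : ∀ p, α p (radial ξ p) = 0)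
    (hinv : ∀ t p v, α (flow hπ.isCompleteField t p)
      (diff E E (flow hπ.isCompleteField t) p v) = α p v) :
    OneForm.pullback π (OneForm.pullback (sec hπ r) α : OneForm F N) = α := by
  funext p
  ext v
  change α (sec hπ r (π p)) (diff F E (sec hπ r) (π p) (diff E F π p v)) = α p v
  rw [diff_sec_diff_π hξ hr hπ, diff_retr hξ hr, sec_π hξ hr hπ, map_sub, map_smul, h0, smul_zero,
    sub_zero, retr, hinv]

omit hπ in
lemma IsConeFn.diff_flow (hc : IsCompleteField (radial ξ)) (t : ℝ) (p : V) (v : E) :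
    diff E ℝ r (flow hc t p) (diff E E (flow hc t) p v) = Real.exp t * diff E ℝ r p v := by
  rw [← diff_comp_apply (g := r) (mdiffAt hr.smooth _) (mdiffAt (contMDiff_flow_right hξ.radial _ t) p)]
  simp only [hr.flow_eq hc]
  have h := diff_comp_apply (g := fun x : ℝ => Real.exp t * x) (f := r) (x := p)
    (mdifferentiableAt_iff_differentiableAt.2 (by fun_prop)) (mdiffAt hr.smooth p) v
  rw [h, diff_eq_fderiv, fderiv_const_mul (by fun_prop)]
  simp

lemma pullback_pullback_sec_dc : OneForm.pullback π (OneForm.pullback (sec hπ r)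
    (fun p => (r p)⁻¹ • dc E r p) : OneForm F N) = fun p => (r p)⁻¹ • dc E r p := by
  refine pullback_pullback_sec hξ hr hπ (fun p => ?_) fun t p v => ?_
  · rw [smul_apply, dc_apply, hr.diff_J_radial, neg_zero, smul_zero]
  · rw [smul_apply, smul_apply, dc_apply, dc_apply, ← diff_flow_J hξ.radial, hr.diff_flow hξ,
      hr.flow_eq, mul_inv, smul_eq_mul, smul_eq_mul]
    have := (Real.exp_pos t).ne'
    field_simp

/-- The contact form in terms of the section of the level set. -/
lemma contactForm_eq : contactForm E F π r = OneForm.pullback (sec hπ r)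
    (fun p => (r p)⁻¹ • dc E r p) :=
  descend_eq hπ.surjective hπ.submersion (pullback_pullback_sec_dc hξ hr hπ)

lemma pullback_contactForm :
    OneForm.pullback π (contactForm E F π r) = fun p => (r p)⁻¹ • dc E r p := by
  rw [contactForm_eq hξ hr hπ, pullback_pullback_sec_dc hξ hr hπ]

lemma contactForm_apply (p : V) (v : E) :
    contactForm E F π r (π p) (diff E F π p v) = -(diff E ℝ r p (J v) / r p) := by
  have h := congrArg (fun A : E →L[ℝ] ℝ => A v) (congrFun (pullback_contactForm hξ hr hπ) p)
  refine Eq.trans h ?_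
  simp only [smul_apply, dc_apply, smul_eq_mul]
  ring

omit hξ hπ in
lemma IsConeFn.isSmooth_form : OneForm.IsSmooth (fun p => (r p)⁻¹ • dc E r p : OneForm E V) := by
  refine OneForm.IsSmooth.smul ?_ (isSmooth_dc hr.smooth)
  exact fun p => ContMDiffAt.comp p (contMDiffAt_iff_contDiffAt.2 (contDiffAt_inv ℝ (hr.pos p).ne'))
    (hr.smooth p)

lemma isSmooth_contactForm : OneForm.IsSmooth (contactForm E F π r) := by
  rw [contactForm_eq hξ hr hπ]
  exact hr.isSmooth_form.pullback (contMDiff_sec hξ hr hπ)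

/-- The Leibniz rule for d(d^c r / r), read upstairs on V. The last term is -(dr ∧ d^c r) / r²
written out. -/
lemma extDer_contactForm (p : V) (v w : E) :
    OneForm.extDer (contactForm E F π r) (π p) (diff E F π p v) (diff E F π p w) =
      (r p)⁻¹ * OneForm.extDer (dc E r) p v w + (r p)⁻¹ ^ 2 *
        (diff E ℝ r p v * diff E ℝ r p (J w) - diff E ℝ r p w * diff E ℝ r p (J v)) := by
  have hs : ContMDiff 𝓘(ℝ, E) 𝓘(ℝ, ℝ) ∞ (fun p => (r p)⁻¹) :=
    fun p => ContMDiffAt.comp p (contMDiffAt_iff_contDiffAt.2 (contDiffAt_inv ℝ (hr.pos p).ne'))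
      (hr.smooth p)
  have hd (v : E) : diff E ℝ (fun p => (r p)⁻¹) p v = -((r p)⁻¹ ^ 2) * diff E ℝ r p v := by
    rw [diff_comp_apply (g := fun x : ℝ => x⁻¹) (f := r)
      (mdifferentiableAt_iff_differentiableAt.2 (differentiableAt_inv (hr.pos p).ne'))
      (mdiffAt hr.smooth p), diff_eq_fderiv, (hasDerivAt_inv (hr.pos p).ne').hasFDerivAt.fderiv]
    simp [mul_comm]
  rw [← OneForm.extDer_pullback hπ.smooth (isSmooth_contactForm hξ hr hπ),
    pullback_contactForm hξ hr hπ, OneForm.extDer_smul hs (isSmooth_dc hr.smooth), hd, hd,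
    dc_apply, dc_apply]
  ring

omit hr in
lemma diff_flow_self (hc : IsCompleteField (radial ξ)) (t : ℝ) (p : V) :
    diff E E (flow hc t) p (radial ξ p) = radial ξ (flow hc t p) := by
  have h5 := diff_comp_apply (g := flow hc t)
    (f := fun s => flow hc s p) (x := 0)
    (mdiffAt (contMDiff_flow_right hξ.radial _ _) _) (mdiffAt_flow _ p _) 1
  rw [diff_flow_time, flow_zero] at h5
  refine Eq.trans h5.symm ?_
  simp only [← flow_add hξ.radial]
  have h6 := diff_comp_apply (g := fun t => flow hc t p)
    (f := fun s : ℝ => t + s) (x := 0) (mdiffAt_flow _ p _)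
    (mdifferentiableAt_iff_differentiableAt.2 (by fun_prop)) 1
  rw [diff_eq_fderiv, fderiv_const_add, fderiv_fun_id, ContinuousLinearMap.id_apply, diff_flow_time,
    add_zero] at h6
  exact h6

omit hr in
-- The radial flow preserves -Jξ and is holomorphic, hence it preserves ξ.
lemma descend_reeb (p : V) : VField.descend π ξ (π p) = diff E F π p (ξ p) := by
  refine descend_field hξ hπ (fun t p => ?_) p
  have h := congrArg J (diff_flow_self hξ hπ hπ.isCompleteField t p)
  rwa [← diff_flow_J hξ.radial, J_radial, J_radial] at h

lemma extDer_contactForm_reeb (p : V) (w : F) :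
    OneForm.extDer (contactForm E F π r) (π p) (diff E F π p (ξ p)) w = 0 := by
  obtain ⟨v, rfl⟩ := hπ.submersion p w
  rw [extDer_contactForm hξ hr hπ, hr.diff_J_field, hr.invariant, hr.extDer_field hξ]
  have := (hr.pos p).ne'
  field_simp
  ring

/-- The differential of the contact form only depends on the components transversal to `ξ` and
`-Jξ`. -/
lemma extDer_contactForm_split {p : V} {u v : E} {a b : ℝ}
    (hs : v = u + a • ξ p + b • radial ξ p) :
    OneForm.extDer (contactForm E F π r) (π p) (diff E F π p v) (diff E F π p (J v)) =
      OneForm.extDer (contactForm E F π r) (π p) (diff E F π p u) (diff E F π p (J u)) := by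
  have h1 : diff E F π p v = diff E F π p u + a • diff E F π p (ξ p) := by
    rw [hs, map_add, map_smul _ b, diff_π_radial hπ, smul_zero, add_zero, map_add, map_smul]
  have h2 : diff E F π p (J v) = diff E F π p (J u) + b • diff E F π p (ξ p) := by
    rw [hs, map_add J, map_add J, map_smul J, map_smul J, J_radial, map_add, map_add, map_smul _ a,
      diff_π_J_field hπ, smul_zero, add_zero, map_smul]
  rw [h1, extDer_add_left, extDer_smul_left, extDer_contactForm_reeb hξ hr hπ, mul_zero, add_zero,
    h2, extDer_swap, extDer_add_left, extDer_smul_left, extDer_contactForm_reeb hξ hr hπ, mul_zero,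
    add_zero, ← extDer_swap]

/-- Cone potentials give Sasaki structures on the orbit space. -/
lemma isSasakiForm_contactForm (hpot : IsConePotential ξ r) :
    IsSasakiForm ξ π (contactForm E F π r) where
  smooth := isSmooth_contactForm hξ hr hπ
  reeb x := by
    obtain ⟨p, rfl⟩ := hπ.surjective x
    rw [descend_reeb hξ hπ, contactForm_apply hξ hr hπ, hr.diff_J_field]
    have := (hr.pos p).ne'
    field_simp
  lie x w := by
    obtain ⟨p, rfl⟩ := hπ.surjective x
    rw [descend_reeb hξ hπ, extDer_contactForm_reeb hξ hr hπ]
  invariant p v w := by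
    rw [extDer_contactForm hξ hr hπ, extDer_contactForm hξ hr hπ, extDer_dc_J_J hr.smooth, J_J, J_J]
    simp only [map_neg]
    ring
  positive p v hv := by
    obtain ⟨u, hu, hu', hs⟩ := hr.exists_split p v
    set a := -(diff E ℝ r p (J v) / r p)
    set b := diff E ℝ r p v / r p
    have hu0 : u ≠ 0 := by
      rintro rfl
      refine hv ⟨a, ?_⟩
      rw [descend_reeb hξ hπ, hs, zero_add, map_add, map_smul, map_smul, diff_π_radial hπ,
        smul_zero, add_zero]
    have h3 := hpot.psh p u hu0
    have h4 := hr.pos p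
    rw [extDer_contactForm_split hξ hr hπ hs, extDer_contactForm hξ hr hπ, hu, hu', zero_mul,
      zero_mul, sub_zero, mul_zero, add_zero]
    positivity

/-- Sasaki structures on the orbit space come from cone potentials. -/
lemma isConePotential_of_isSasakiForm (hη : IsSasakiForm ξ π (contactForm E F π r)) :
    IsConePotential ξ r := by
  refine hr.isConePotential hξ fun p u hu hu' hu0 => ?_
  have h := hη.positive p u ?_
  · rw [extDer_contactForm hξ hr hπ, hu, hu'] at h
    have h4 := hr.pos p
    simp only [mul_zero, zero_mul, sub_zero, add_zero] at h
    exact (pos_iff_pos_of_mul_pos h).1 (by positivity)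
  -- If dπ u were a multiple of the Reeb field, u would lie in the span of ξ and -Jξ, which meets
  -- ker dr ∩ ker d^c r only in 0.
  · rintro ⟨c, hc⟩
    rw [descend_reeb hξ hπ, ← map_smul, ← sub_eq_zero, ← map_sub] at hc
    have h1 := eq_smul_radial_of_diff_π_eq_zero hξ hr hπ hc
    have h2 := congrArg (fun v => diff E ℝ r p (J v)) h1
    have h3 := (hr.pos p).ne'
    simp only [map_sub, map_smul, hu', hr.diff_J_field, hr.diff_J_radial,
      smul_eq_mul, mul_zero, zero_sub, mul_neg, neg_neg] at h2
    rw [(mul_eq_zero.1 h2).resolve_right h3, zero_smul, sub_zero, hu, zero_div, zero_smul] at h1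
    exact hu0 h1

end Contact

end SasakiCone

end

noncomputable section

set_option linter.unusedSectionVars false

namespace SasakiCone

/-! ### Sums of forms and derivative conditions at local extrema. -/

section FormSum

variable {F : Type*} [NormedAddCommGroup F] [NormedSpace ℝ F]
variable {M : Type*} [TopologicalSpace M] [ChartedSpace F M]

lemma OneForm.extDer_add {α β : OneForm F M} (hα : OneForm.IsSmooth α) (hβ : OneForm.IsSmooth β)
    (x : M) (v w : F) :
    OneForm.extDer (fun p => α p + β p : OneForm F M) x v w =
      OneForm.extDer α x v w + OneForm.extDer β x v w := by
  have hy := (isOpen_extChartAt_target (I := 𝓘(ℝ, F)) x).mem_nhds (mem_extChartAt_target x)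
  have h1 := ((hα x).contDiffAt hy).differentiableAt (by simp)
  have h2 := ((hβ x).contDiffAt hy).differentiableAt (by simp)
  have h3 : OneForm.inChart (fun p => α p + β p : OneForm F M) x =
      fun y => OneForm.inChart α x y + OneForm.inChart β x y := by
    funext y
    simp [OneForm.inChart, ContinuousLinearMap.add_comp]
  simp only [OneForm.extDer]
  rw [h3, fderiv_fun_add h1 h2]
  simp only [add_apply]
  ring

end FormSum

/-- With a positive second derivative the point would also be a local minimum; the function would be
locally constant and its second derivative zero. -/
lemma IsLocalMax.deriv_deriv_nonpos {f : ℝ → ℝ} {x : ℝ} (h : IsLocalMax f x)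
    (hc : ContinuousAt f x) : deriv (deriv f) x ≤ 0 := by
  by_contra! hpos
  have h1 := isLocalMin_of_deriv_deriv_pos hpos h.deriv_eq_zero hc
  have h2 : f =ᶠ[𝓝 x] fun _ => f x := by
    filter_upwards [h, h1] with y hy hy'
    exact le_antisymm hy hy'
  have h3 : deriv (deriv f) x = 0 := by
    rw [h2.deriv.deriv_eq]
    simp
  exact hpos.ne' h3

section Levi

variable {E : Type*} [NormedAddCommGroup E] [NormedSpace ℂ E]
variable {V : Type*} [TopologicalSpace V] [ChartedSpace E V] [IsManifold 𝓘(ℂ, E) ω V]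

/-- Restriction to a real line in the chart reduces this to one variable. -/
lemma chartHess_nonpos_of_isLocalMax {f : V → ℝ} (hf : ContMDiff 𝓘(ℝ, E) 𝓘(ℝ, ℝ) ∞ f) {x : V}
    (hx : IsLocalMax f x) (v : E) : chartHess f x (extChartAt 𝓘(ℝ, E) x x) v v ≤ 0 := by
  set e := extChartAt 𝓘(ℝ, E) x with he
  set y := e x with hydef
  have hy : y ∈ e.target := mem_extChartAt_target x
  have hsymm : e.symm y = x := extChartAt_to_inv x
  let g : E → ℝ := fun y => f (e.symm y)
  have hg : ContDiffAt ℝ ∞ g y := contDiffAt_comp_extChartAt_symm le_rfl hy (hf _)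
  have hgmax : IsLocalMax g y := by
    have hx' : IsLocalMax f (e.symm y) := by rwa [hsymm]
    exact hx'.comp_continuous (contMDiffAt_extChartAt_symm hy).continuousAt
  let l : ℝ → E := fun s => y + s • v
  have hl0 : l 0 = y := by simp [l]
  have hl (s : ℝ) : HasDerivAt l v s := by
    have := ((hasDerivAt_id s).smul_const v).const_add y
    rwa [one_smul] at this
  have hlc : Filter.Tendsto l (𝓝 0) (𝓝 y) := by
    have := (hl 0).continuousAt.tendsto
    rwa [hl0] at this
  have hev : ∀ᶠ s in 𝓝 (0 : ℝ), HasDerivAt (fun s => g (l s)) (fderiv ℝ g (l s) v) s := by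
    have h1 : ∀ᶠ z in 𝓝 y, DifferentiableAt ℝ g z :=
      ((hg.of_le (m := 1) (WithTop.coe_le_coe.2 le_top)).eventually (by simp)).mono
        fun q hq => hq.differentiableAt one_ne_zero
    filter_upwards [hlc.eventually h1] with s hs
    exact hs.hasFDerivAt.comp_hasDerivAt s (hl s)
  have hd : HasDerivAt (fun s => fderiv ℝ g (l s) v) (fderiv ℝ (fderiv ℝ g) y v v) 0 := by
    have h2 : HasFDerivAt (fderiv ℝ g) (fderiv ℝ (fderiv ℝ g) y) (l 0) := by
      rw [hl0]
      exact ((hg.fderiv_right (m := ∞) (by simp)).differentiableAt (by simp)).hasFDerivAt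
    simpa using (h2.comp_hasDerivAt (0 : ℝ) (hl 0)).clm_apply (hasDerivAt_const (0 : ℝ) v)
  have h3 : deriv (deriv fun s => g (l s)) 0 = fderiv ℝ (fderiv ℝ g) y v v := by
    have h4 : deriv (fun s => g (l s)) =ᶠ[𝓝 0] fun s => fderiv ℝ g (l s) v :=
      hev.mono fun s hs => hs.deriv
    rw [h4.deriv_eq, hd.deriv]
  change fderiv ℝ (fderiv ℝ g) y v v ≤ 0
  rw [← h3]
  refine IsLocalMax.deriv_deriv_nonpos ?_ hev.self_of_nhds.continuousAt
  have h5 : IsLocalMax g (l 0) := by rwa [hl0]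
  exact h5.comp_continuous (hl 0).continuousAt

/-- The Levi form is nonpositive at a local maximum. -/
lemma extDer_dc_nonpos_of_isLocalMax {f : V → ℝ} (hf : ContMDiff 𝓘(ℝ, E) 𝓘(ℝ, ℝ) ∞ f) {x : V}
    (hx : IsLocalMax f x) (v : E) : OneForm.extDer (dc E f) x v (J v) ≤ 0 := by
  rw [extDer_dc hf, J_J, map_neg]
  have h1 := chartHess_nonpos_of_isLocalMax hf hx v
  have h2 := chartHess_nonpos_of_isLocalMax hf hx (J v)
  linarith

lemma diff_eq_zero_of_isLocalMin {f : V → ℝ} (hf : ContMDiff 𝓘(ℝ, E) 𝓘(ℝ, ℝ) ∞ f) {x : V}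
    (hx : IsLocalMin f x) : diff E ℝ f x = 0 := by
  have hy := mem_extChartAt_target (I := 𝓘(ℝ, E)) x
  have hsymm : (extChartAt 𝓘(ℝ, E) x).symm (extChartAt 𝓘(ℝ, E) x x) = x := extChartAt_to_inv x
  have hx' : IsLocalMin f ((extChartAt 𝓘(ℝ, E) x).symm (extChartAt 𝓘(ℝ, E) x x)) := by
    rwa [hsymm]
  have h1 : IsLocalMin (fun y => f ((extChartAt 𝓘(ℝ, E) x).symm y)) (extChartAt 𝓘(ℝ, E) x x) :=
    hx'.comp_continuous (contMDiffAt_extChartAt_symm hy).continuousAt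
  ext v
  have h2 := fderiv_comp_extChartAt_symm hf hy (diff E E (extChartAt 𝓘(ℝ, E) x) x v)
  rw [h1.fderiv_eq_zero, diff_extChartAt_symm_diff (mem_extChartAt_source x), hsymm] at h2
  exact h2.symm

lemma contMDiff_comp_pos {r : V → ℝ} (hr : ContMDiff 𝓘(ℝ, E) 𝓘(ℝ, ℝ) ∞ r) (hpos : ∀ p, 0 < r p)
    {h : ℝ → ℝ} (hh : ContDiffOn ℝ ∞ h (Set.Ioi 0)) :
    ContMDiff 𝓘(ℝ, E) 𝓘(ℝ, ℝ) ∞ (fun p => h (r p)) := fun p =>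
  ContMDiffAt.comp p (contMDiffAt_iff_contDiffAt.2 (hh.contDiffAt (Ioi_mem_nhds (hpos p)))) (hr p)

lemma diff_comp_real {r : V → ℝ} {p : V} (hr : MDifferentiableAt 𝓘(ℝ, E) 𝓘(ℝ, ℝ) r p)
    {h : ℝ → ℝ} {h' : ℝ} (hh : HasDerivAt h h' (r p)) (v : E) :
    diff E ℝ (fun p => h (r p)) p v = h' * diff E ℝ r p v := by
  rw [diff_comp_apply (g := h) (f := r)
    (mdifferentiableAt_iff_differentiableAt.2 hh.differentiableAt) hr, diff_eq_fderiv,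
    hh.hasFDerivAt.fderiv]
  simp [mul_comm]

lemma diff_add {f g : V → ℝ} {p : V} (hf : MDifferentiableAt 𝓘(ℝ, E) 𝓘(ℝ, ℝ) f p)
    (hg : MDifferentiableAt 𝓘(ℝ, E) 𝓘(ℝ, ℝ) g p) :
    diff E ℝ (fun p => f p + g p) p = diff E ℝ f p + diff E ℝ g p :=
  mfderiv_add hf hg

/-- The Levi form of `u + h ∘ r` along `ker dr ∩ ker d^c r`. -/
lemma extDer_dc_add_comp {u r : V → ℝ} (hu : ContMDiff 𝓘(ℝ, E) 𝓘(ℝ, ℝ) ∞ u)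
    (hr : ContMDiff 𝓘(ℝ, E) 𝓘(ℝ, ℝ) ∞ r) (hpos : ∀ p, 0 < r p) {h h' : ℝ → ℝ}
    (hh : ContDiffOn ℝ ∞ h (Set.Ioi 0)) (hh' : ContDiffOn ℝ ∞ h' (Set.Ioi 0))
    (hd : ∀ x > 0, HasDerivAt h (h' x) x) {p : V} {v : E} (hv : diff E ℝ r p v = 0)
    (hv' : diff E ℝ r p (J v) = 0) :
    OneForm.extDer (dc E (fun p => u p + h (r p))) p v (J v) =
      OneForm.extDer (dc E u) p v (J v) + h' (r p) * OneForm.extDer (dc E r) p v (J v) := by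
  have h1 : dc E (fun p => u p + h (r p)) = fun p => dc E u p + h' (r p) • dc E r p := by
    funext p
    ext v
    rw [add_apply, smul_apply, dc_apply, dc_apply, dc_apply, diff_add (mdiffAt hu p)
      (mdiffAt (contMDiff_comp_pos hr hpos hh) p), add_apply,
      diff_comp_real (mdiffAt hr p) (hd _ (hpos p)), smul_eq_mul]
    ring
  have hs := contMDiff_comp_pos hr hpos hh'
  rw [h1, OneForm.extDer_add (isSmooth_dc hu) ((isSmooth_dc hr).smul hs),
    OneForm.extDer_smul hs (isSmooth_dc hr), dc_apply, dc_apply, J_J, map_neg, hv, hv']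
  ring

end Levi

/-! ### A maximum principle on the cone. -/

section Positivity

variable {E : Type*} [NormedAddCommGroup E] [NormedSpace ℂ E] [FiniteDimensional ℂ E]
variable {V : Type*} [TopologicalSpace V] [ChartedSpace E V] [IsManifold 𝓘(ℂ, E) ω V] [T2Space V]
variable {F : Type*} [NormedAddCommGroup F] [NormedSpace ℝ F] [FiniteDimensional ℝ F]
variable {N : Type*} [TopologicalSpace N] [ChartedSpace F N] [IsManifold 𝓘(ℝ, F) ∞ N]
  [CompactSpace N]
variable {ξ : VField E V} {r : V → ℝ} {π : V → N}
variable (hξ : IsHolField ξ) (hr : IsConePotential ξ r) (hπ : IsOrbitSpace F (radial ξ) π)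
include hξ hr hπ

/-- The regions `a ≤ r ≤ b` are compact. -/
lemma isCompact_region {a b : ℝ} (ha : 0 < a) : IsCompact {p | a ≤ r p ∧ r p ≤ b} := by
  have hM := isCompact_level hπ hξ hr.isConeFn
  have h1 := ((isCompact_Icc (a := Real.log a) (b := Real.log b)).prod hM).image
    (contMDiff_flow hξ.radial hπ.isCompleteField).continuous
  refine h1.of_isClosed_subset ?_ ?_
  · exact (isClosed_le continuous_const hr.smooth.continuous).inter
      (isClosed_le hr.smooth.continuous continuous_const)
  · rintro p ⟨hp, hp'⟩
    refine ⟨(Real.log (r p), retr hπ.isCompleteField r p), ⟨⟨Real.log_le_log ha hp,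
      Real.log_le_log (hr.pos p) hp'⟩, r_retr hr.isConeFn _ p⟩, ?_⟩
    exact flow_flow_neg hξ.radial _ (Real.log (r p)) p

/-- A maximum principle on `r ≤ 1`: if `u` is strictly plurisubharmonic in the directions of
`ker dr ∩ ker d^c r`, it is bounded by its maximum on `r = 1`. -/
lemma le_of_le_on_level (hD : ∀ p, ∃ v : E, v ≠ 0 ∧ diff E ℝ r p v = 0 ∧ diff E ℝ r p (J v) = 0)
    {u : V → ℝ} (hu : ContMDiff 𝓘(ℝ, E) 𝓘(ℝ, ℝ) ∞ u)
    (hpsh : ∀ (p : V) (v : E), v ≠ 0 → 0 < OneForm.extDer (dc E u) p v (J v)) {m : ℝ}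
    (hm : ∀ p, r p = 1 → u p ≤ m) {q : V} (hq : r q ≤ 1) : u q ≤ m := by
  by_contra! hlt
  set ρ := r q with hρ
  have hρ0 : 0 < ρ := hr.pos q
  set η := (u q - m) / 2 with hη
  have hη0 : 0 < η := by rw [hη]; linarith
  have hA := isCompact_region hξ hr hπ (a := ρ / 2) (b := 1) (by linarith)
  obtain ⟨B, hB⟩ := hA.bddAbove_image hu.continuous.continuousOn
  have hB' (p : V) (h1 : ρ / 2 ≤ r p) (h2 : r p ≤ 1) : u p ≤ B := hB ⟨p, ⟨h1, h2⟩, rfl⟩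
  obtain ⟨k, hk⟩ := pow_unbounded_of_one_lt ((B - u q + η) / η) (one_lt_two (α := ℝ))
  have hk' : B - η * 2 ^ k < u q - η := by
    rw [div_lt_iff₀ hη0] at hk
    linarith
  -- An increasing negative barrier, normalized by h(ρ) = -η so that it costs little at q. At the
  -- inner radius ρ/2 it equals -η·2^k, and k was chosen so that this outweighs the bound B.
  let h : ℝ → ℝ := fun x => -(η * ρ ^ k) * (x⁻¹) ^ k
  let h' : ℝ → ℝ := fun x => (η * ρ ^ k) * (k * (x⁻¹) ^ (k + 1))
  have hinv : ContDiffOn ℝ ∞ (fun x : ℝ => x⁻¹) (Set.Ioi 0) := fun x hx =>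
    (contDiffAt_inv ℝ (ne_of_gt hx)).contDiffWithinAt
  have hh : ContDiffOn ℝ ∞ h (Set.Ioi 0) := contDiffOn_const.mul (hinv.pow k)
  have hh' : ContDiffOn ℝ ∞ h' (Set.Ioi 0) :=
    contDiffOn_const.mul (contDiffOn_const.mul (hinv.pow (k + 1)))
  have hd : ∀ x > 0, HasDerivAt h (h' x) x := by
    intro x hx
    convert! ((hasDerivAt_inv (ne_of_gt hx)).pow k).const_mul (-(η * ρ ^ k)) using 1
    rcases k with _ | k
    · simp [h']
    · simp only [h', Nat.add_sub_cancel, ← inv_pow]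
      ring
  have hh'0 : ∀ x > 0, 0 ≤ h' x := fun x hx => by
    have : (0 : ℝ) < x := hx
    simp only [h']
    positivity
  let w : V → ℝ := fun p => u p + h (r p)
  have hw : ContMDiff 𝓘(ℝ, E) 𝓘(ℝ, ℝ) ∞ w := hu.add (contMDiff_comp_pos hr.smooth hr.pos hh)
  have hwq : w q = u q - η := by
    simp only [w, h, ← hρ]
    rw [neg_mul, mul_assoc, ← mul_pow, mul_inv_cancel₀ hρ0.ne', one_pow]
    ring
  obtain ⟨y, hyA, hymax⟩ := hA.exists_isMaxOn ⟨q, by constructor <;> linarith⟩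
    hw.continuous.continuousOn
  have hyq : w q ≤ w y := hymax (by constructor <;> linarith)
  have hhneg (p : V) : h (r p) ≤ 0 := by
    have := hr.pos p
    simp only [h, neg_mul, Left.neg_nonpos_iff]
    positivity
  have hy1 : r y < 1 := by
    refine lt_of_le_of_ne hyA.2 fun h1 => ?_
    have h2 := hm y h1
    have h3 := hhneg y
    have : w y ≤ m := by simp only [w]; linarith
    linarith
  have hy2 : ρ / 2 < r y := by
    refine lt_of_le_of_ne hyA.1 fun h1 => ?_
    have h2 := hB' y hyA.1 hyA.2
    have h3 : w y = u y - η * 2 ^ k := by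
      simp only [w, h, ← h1]
      rw [neg_mul, mul_assoc, ← mul_pow]
      have : ρ * (ρ / 2)⁻¹ = 2 := by field_simp
      rw [this]
      ring
    linarith
  -- The maximum of w over the region is therefore interior. The Levi form of w is nonpositive
  -- there, yet in directions of ker dr ∩ ker d^c r it is positive since h' ≥ 0.
  have hloc : IsLocalMax w y := by
    filter_upwards [(isOpen_lt hr.smooth.continuous continuous_const).mem_nhds hy1,
      (isOpen_lt continuous_const hr.smooth.continuous).mem_nhds hy2] with p hp1 hp2
    exact hymax ⟨le_of_lt hp2, le_of_lt hp1⟩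
  obtain ⟨v, hv0, hv, hv'⟩ := hD y
  have h1 := extDer_dc_nonpos_of_isLocalMax hw hloc v
  rw [extDer_dc_add_comp hu hr.smooth hr.pos hh hh' hd hv hv'] at h1
  have h2 := hpsh y v hv0
  have h3 := mul_nonneg (hh'0 _ (hr.pos y)) (hr.psh y v hv0).le
  linarith

end Positivity

/-! ### Nonvanishing of dr(-JK). -/

section FieldRatio

variable {E : Type*} [NormedAddCommGroup E] [NormedSpace ℂ E] [FiniteDimensional ℂ E]
variable {V : Type*} [TopologicalSpace V] [ChartedSpace E V] [IsManifold 𝓘(ℂ, E) ω V] [T2Space V]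
variable {F : Type*} [NormedAddCommGroup F] [NormedSpace ℝ F] [FiniteDimensional ℝ F]
variable {N : Type*} [TopologicalSpace N] [ChartedSpace F N] [IsManifold 𝓘(ℝ, F) ∞ N]
variable {d : ℕ} [MulAction (Torus d) V] (hT : IsHolomorphicTorusAction E V d)
variable {X : Fin d → ℝ} (K : Fin d → ℝ) {r : V → ℝ}
include hT

/-- The flow of -JX preserves -JK and multiplies dr by e^t. -/
lemma diff_radial_flow (hr : IsConeFn (field E V X) r)
    (hc : IsCompleteField (radial (field E V X))) (t : ℝ) (p : V) :
    diff E ℝ r (flow hc t p) (radial (field E V K) (flow hc t p)) =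
      Real.exp t * diff E ℝ r p (radial (field E V K) p) := by
  rw [← diff_flow_radial hT, hr.diff_flow (isHolField_field hT X)]

/-- The function `dr(-JK)` is determined by its values on the level set `r = 1`. -/
lemma diff_radial_retr (hr : IsConeFn (field E V X) r)
    (hc : IsCompleteField (radial (field E V X))) (p : V) :
    diff E ℝ r p (radial (field E V K) p) =
      r p * diff E ℝ r (retr hc r p) (radial (field E V K) (retr hc r p)) := by
  rw [retr, diff_radial_flow hT K hr, Real.exp_neg, Real.exp_log (hr.pos p),
    mul_inv_cancel_left₀ (hr.pos p).ne']

/-- At a minimum of `dr(-JK) / r` the fields induced by `K` and `X` are proportional. -/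
lemma field_eq_smul_of_min (hr : r ∈ conePotentials E V X) {c : ℝ} {x : V}
    (hle : ∀ p, c * r p ≤ diff E ℝ r p (radial (field E V K) p))
    (hx : diff E ℝ r x (radial (field E V K) x) = c * r x) :
    field E V K x = c • field E V X x := by
  have hXf := isHolField_field hT X
  have hKf := isHolField_field hT K
  have hH := contMDiff_diff_apply hr.1.smooth hKf.radial
  have hcr : ContMDiff 𝓘(ℝ, E) 𝓘(ℝ, ℝ) ∞ (fun p => -c * r p) :=
    contMDiff_const.mul hr.1.smooth
  have hmin : IsLocalMin (fun p => diff E ℝ r p (radial (field E V K) p) + -c * r p) x :=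
    Filter.Eventually.of_forall fun p => by linarith [hle p]
  have h1 := (diff_add (mdiffAt hH x) (mdiffAt hcr x)).symm.trans
    (diff_eq_zero_of_isLocalMin (hH.add hcr) hmin)
  have hinv (p : V) : diff E ℝ r p (field E V K p) = 0 :=
    diff_field_of_invariant hT K (mdiffAt hr.1.smooth p) fun g => hr.2 g p
  -- Contracting dd^c r with K gives -d(dr(-JK)), and with X gives -dr. So the contraction with K -
  -- cX is minus the differential of dr(-JK) - cr, which vanishes at the minimum.
  have h2 (w : E) : OneForm.extDer (dc E r) x (field E V K x + (-c) • field E V X x) w = 0 := by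
    have h3 := congrArg (fun A : E →L[ℝ] ℝ => A w) h1
    have h4 : diff E ℝ (fun p => -c * r p) x w = -c * diff E ℝ r x w :=
      diff_comp_real (h := fun y => -c * y) (mdiffAt hr.1.smooth x)
        (by simpa using (hasDerivAt_id (r x)).const_mul (-c)) w
    rw [extDer_add_left, extDer_smul_left, extDer_dc_field hr.1.smooth hKf hinv,
      hr.1.isConeFn.extDer_field hXf]
    simp only [add_apply, h4, zero_apply] at h3
    linarith
  by_contra hne
  have h5 := hr.1.psh x (field E V K x + (-c) • field E V X x) (fun h0 => hne (by
    rw [neg_smul, ← sub_eq_add_neg, sub_eq_zero] at h0; exact h0))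
  rw [h2] at h5
  exact lt_irrefl _ h5

variable {π : V → N} (hπ : IsOrbitSpace F (radial (field E V X)) π)

omit hT in
-- On a curve X and JX span the real tangent space, where dr and d^c r are linearly independent.
lemma eq_zero_of_finrank_le_one (hdim : Module.finrank ℂ E ≤ 1) (hr : IsConeFn (field E V X) r)
    {p : V} {v : E} (hv : diff E ℝ r p v = 0) (hv' : diff E ℝ r p (J v) = 0) : v = 0 := by
  have hX0 : field E V X p ≠ 0 := by
    intro h0
    have := hr.homogeneous p
    rw [radial, h0, map_zero, neg_zero, map_zero] at this
    exact (hr.pos p).ne this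
  have hpos : 0 < Module.finrank ℂ E := Module.finrank_pos_iff_exists_ne_zero.2 ⟨_, hX0⟩
  obtain ⟨z, rfl⟩ := (finrank_eq_one_iff_of_nonzero' _ hX0).1 (le_antisymm hdim hpos) v
  have hz2 : z • field E V X p = z.re • field E V X p + z.im • J (field E V X p) := by
    conv_lhs => rw [← Complex.re_add_im z]
    rw [add_smul, mul_smul, J_apply]
    rfl
  rw [hz2] at hv hv' ⊢
  simp only [map_add, map_smul, hr.invariant, hr.diff_J_field, J_J, map_neg, smul_eq_mul, mul_zero,
    zero_add, neg_zero, add_zero, mul_neg, neg_eq_zero, mul_eq_zero, (hr.pos p).ne', or_false]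
    at hv hv'
  rw [hv, hv', zero_smul, zero_smul, add_zero]

omit hT in
/-- The relation between the two fields at points where they are proportional. -/
lemma eq_mul_diff_of_field_eq {u : V → ℝ} (hu : IsConePotential (field E V K) u) {q : V} {c : ℝ}
    (hq : field E V K q = c • field E V X q) :
    u q = c * diff E ℝ u q (radial (field E V X) q) := by
  rw [← hu.homogeneous, radial, radial, hq, map_smul, ← smul_neg, map_smul, smul_eq_mul]

include hπ in
/-- If `K` admits a cone potential and `V` is not a curve, the function `dr(-JK)` is positive. -/
lemma diff_radial_pos [CompactSpace N] (hdim : ¬ Module.finrank ℂ E ≤ 1)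
    (hr : r ∈ conePotentials E V X) {u : V → ℝ} (hu : IsConePotential (field E V K) u) (p : V) :
    0 < diff E ℝ r p (radial (field E V K) p) := by
  have hXf := isHolField_field hT X
  have hKf := isHolField_field hT K
  have hc := hπ.isCompleteField
  have hrc := hr.1.isConeFn
  have hH := contMDiff_diff_apply hr.1.smooth hKf.radial
  -- In dimension at least two ker dr ∩ ker d^c r is nonzero: otherwise the splitting would make
  -- every vector a complex multiple of X.
  have hD (q : V) : ∃ v : E, v ≠ 0 ∧ diff E ℝ r q v = 0 ∧ diff E ℝ r q (J v) = 0 := by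
    by_contra! hno
    refine hdim ?_
    refine finrank_le_one (field E V X q) fun w => ?_
    obtain ⟨v, hv, hv', hs⟩ := hrc.exists_split q w
    have hv0 : v = 0 := by
      by_contra hv0
      exact hno v hv0 hv hv'
    refine ⟨(-(diff E ℝ r q (J w) / r q) : ℝ) - (diff E ℝ r q w / r q : ℝ) * Complex.I, ?_⟩
    conv_rhs => rw [hs]
    rw [hv0, zero_add, sub_smul, mul_smul, radial, smul_neg, J_apply, sub_eq_add_neg]
    rfl
  have hM := isCompact_level hπ hXf hrc
  obtain ⟨x, hxM, hxmin⟩ := hM.exists_isMinOn ⟨retr hc r p, r_retr hrc hc p⟩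
    hH.continuous.continuousOn
  set c := diff E ℝ r x (radial (field E V K) x) with hcdef
  have hle (q : V) : c * r q ≤ diff E ℝ r q (radial (field E V K) q) := by
    rw [diff_radial_retr hT K hrc hc q, mul_comm]
    exact mul_le_mul_of_nonneg_left (hxmin (r_retr hrc hc q)) (hr.1.pos q).le
  have hfx : field E V K x = c • field E V X x :=
    field_eq_smul_of_min hT K hr hle (by rw [show r x = 1 from hxM, mul_one])
  have hc0 : c ≠ 0 := by
    intro h0
    have := eq_mul_diff_of_field_eq K hu hfx
    rw [h0, zero_mul] at this
    exact (hu.pos x).ne' this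
  rcases lt_or_gt_of_ne hc0 with hneg | hpos
  · exfalso
    -- The relation K = cX persists along the flow of -JX through x, so u satisfies a linear
    -- equation with rate 1/c on this orbit.
    have hflow (t : ℝ) : field E V K (flow hc t x) = c • field E V X (flow hc t x) := by
      rw [← diff_flow_field hT, hfx, map_smul, diff_flow_field hT]
    have hder (t : ℝ) : HasDerivAt (fun t => u (flow hc t x)) (c⁻¹ * u (flow hc t x)) t := by
      have h1 := hasDerivAt_comp_flow hc (p := x) (t := t) (mdiffAt hu.smooth _)
      rwa [eq_mul_diff_of_field_eq K hu (hflow t), inv_mul_cancel_left₀ hc0]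
    have hexp := eq_exp_of_hasDerivAt hder
    obtain ⟨m, hm⟩ := hM.bddAbove_image hu.smooth.continuous.continuousOn
    have hm' (q : V) (hq : r q = 1) : u q ≤ m := hm ⟨q, hq, rfl⟩
    have hux := hu.pos x
    have hs0 : 0 ≤ |m| / u x := by positivity
    -- The time c|m|/u(x) is nonpositive, so this point lies in r ≤ 1. There u equals e^{|m|/u(x)}
    -- u(x) ≥ |m| + u(x) > m.
    have h1 := le_of_le_on_level hXf hr.1 hπ hD hu.smooth hu.psh hm'
      (q := flow hc (c * (|m| / u x)) x) (by
        rw [hrc.flow_eq, show r x = 1 from hxM, mul_one, Real.exp_le_one_iff]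
        exact mul_nonpos_of_nonpos_of_nonneg hneg.le hs0)
    rw [hexp, flow_zero, inv_mul_cancel_left₀ hc0] at h1
    have h2 := Real.add_one_le_exp (|m| / u x)
    have h3 : (|m| / u x + 1) * u x ≤ m := (mul_le_mul_of_nonneg_right h2 hux.le).trans h1
    rw [add_mul, div_mul_cancel₀ _ hux.ne', one_mul] at h3
    linarith [le_abs_self m]
  · have h1 := mul_pos hpos (hr.1.pos p)
    exact h1.trans_le (hle p)

include hπ in
/-- If `K` admits a cone potential, the function `dr(-JK)` has no zeros. -/
lemma diff_radial_ne_zero [CompactSpace N] (hr : r ∈ conePotentials E V X) {u : V → ℝ}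
    (hu : IsConePotential (field E V K) u) (p : V) :
    diff E ℝ r p (radial (field E V K) p) ≠ 0 := by
  by_cases hdim : Module.finrank ℂ E ≤ 1
  -- On a curve K - cX is killed by dr and d^c r for this c, hence is zero. No sign can be claimed:
  -- K may be a negative multiple of X.
  · have hrc := hr.1.isConeFn
    set c := diff E ℝ r p (radial (field E V K) p) / r p with hcdef
    have hinv : diff E ℝ r p (field E V K p) = 0 :=
      diff_field_of_invariant hT K (mdiffAt hr.1.smooth p) fun g => hr.2 g p
    have hJ : diff E ℝ r p (J (field E V K p)) = -(c * r p) := by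
      rw [hcdef, div_mul_cancel₀ _ (hr.1.pos p).ne', J_field, map_neg]
    have hz : field E V K p - c • field E V X p = 0 := by
      refine eq_zero_of_finrank_le_one hdim hrc (p := p) ?_ ?_
      · rw [map_sub, map_smul, hinv, hr.1.invariant, smul_zero, sub_zero]
      · rw [map_sub, map_sub, map_smul, map_smul, hJ, hrc.diff_J_field, smul_eq_mul]
        ring
    intro h0
    have h1 := eq_mul_diff_of_field_eq K hu (sub_eq_zero.1 hz)
    rw [hcdef, h0, zero_div, zero_mul] at h1
    exact (hu.pos p).ne' h1
  · exact (diff_radial_pos hT K hπ hdim hr hu p).ne'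

end FieldRatio

end SasakiCone

end

noncomputable section

set_option linter.unusedSectionVars false

namespace SasakiCone

/-! ### Smoothness of implicitly defined times. -/

section ImplicitTime

variable {E : Type*} [NormedAddCommGroup E] [NormedSpace ℝ E] [FiniteDimensional ℝ E]
variable {V : Type*} [TopologicalSpace V] [ChartedSpace E V] [IsManifold 𝓘(ℝ, E) ∞ V]
variable {P : Type*} [NormedAddCommGroup P] [NormedSpace ℝ P] [FiniteDimensional ℝ P]

/-- Solutions `τ` of equations `G s p τ = 0` depend smoothly on the parameters if they are unique
and nondegenerate. -/
lemma contMDiffOn_implicit_time {U : Set P} (hU : IsOpen U) {G : P → V → ℝ → ℝ}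
    (hG : ContMDiffOn ((𝓘(ℝ, P).prod 𝓘(ℝ, E)).prod 𝓘(ℝ, ℝ)) 𝓘(ℝ, ℝ) ∞
      (fun q : (P × V) × ℝ => G q.1.1 q.1.2 q.2) ((U ×ˢ Set.univ) ×ˢ Set.univ))
    {τ : P → V → ℝ} (hτ : ∀ s ∈ U, ∀ p t, G s p t = 0 ↔ t = τ s p)
    (hd : ∀ s ∈ U, ∀ p, deriv (G s p) (τ s p) ≠ 0) : SmoothFamilyOn E U τ := by
  have : CompleteSpace E := FiniteDimensional.complete ℝ E
  have : CompleteSpace P := FiniteDimensional.complete ℝ P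
  rintro ⟨s₀, p₀⟩ ⟨hs₀ : s₀ ∈ U, -⟩
  set e := extChartAt 𝓘(ℝ, E) p₀ with he
  have hy : e p₀ ∈ e.target := mem_extChartAt_target p₀
  have hsymm : e.symm (e p₀) = p₀ := extChartAt_to_inv p₀
  let H : (P × E) × ℝ → ℝ := fun q => G q.1.1 (e.symm q.1.2) q.2
  set a : (P × E) × ℝ := ((s₀, e p₀), τ s₀ p₀) with ha
  have hH : ContDiffAt ℝ ∞ H a := by
    rw [← contMDiffAt_prod_iff_contDiffAt, modelWithCornersSelf_prod, ← chartedSpaceSelf_prod]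
    have h1 : ContMDiffAt ((𝓘(ℝ, P).prod 𝓘(ℝ, E)).prod 𝓘(ℝ, ℝ))
        ((𝓘(ℝ, P).prod 𝓘(ℝ, E)).prod 𝓘(ℝ, ℝ)) ∞
        (fun q : (P × E) × ℝ => ((q.1.1, e.symm q.1.2), q.2)) a := by
      have h2 : ContMDiffAt ((𝓘(ℝ, P).prod 𝓘(ℝ, E)).prod 𝓘(ℝ, ℝ)) 𝓘(ℝ, E) ∞
          (fun q : (P × E) × ℝ => e.symm q.1.2) a :=
        ContMDiffAt.comp a (contMDiffAt_extChartAt_symm hy)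
          (contMDiffAt_snd.comp a contMDiffAt_fst)
      exact ((contMDiffAt_fst.comp a contMDiffAt_fst).prodMk h2).prodMk contMDiffAt_snd
    refine ContMDiffAt.comp a (hG.contMDiffAt ?_) h1
    exact ((hU.prod isOpen_univ).prod isOpen_univ).mem_nhds ⟨⟨hs₀, trivial⟩, trivial⟩
  have hHa : H a = 0 := by
    simp only [H, ha, hsymm]
    exact (hτ s₀ hs₀ p₀ _).2 rfl
  have hinv : (fderiv ℝ H a ∘L .inr ℝ (P × E) ℝ).IsInvertible := by
    have h1 : HasDerivAt (fun t => H ((s₀, e p₀), t)) (fderiv ℝ H a (0, 1)) (τ s₀ p₀) := by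
      have h2 : HasFDerivAt H (fderiv ℝ H a) ((s₀, e p₀), τ s₀ p₀) :=
        (hH.differentiableAt (by simp)).hasFDerivAt
      exact HasFDerivAt.comp_hasDerivAt (f := fun t : ℝ => ((s₀, e p₀), t)) (τ s₀ p₀) h2
        ((hasDerivAt_const (τ s₀ p₀) (s₀, e p₀)).prodMk (hasDerivAt_id (τ s₀ p₀)))
    have h3 : fderiv ℝ H a (0, 1) ≠ 0 := by
      rw [← h1.deriv]
      simp only [H, hsymm]
      exact hd s₀ hs₀ p₀
    refine ⟨ContinuousLinearEquiv.unitsEquivAut ℝ (Units.mk0 _ h3), ?_⟩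
    ext
    simp
  let g := hH.implicitFunction (by simp) hinv
  have hg : ContDiffAt ℝ ∞ g (s₀, e p₀) := hH.contDiffAt_implicitFunction (by simp) hinv
  have hgeq : ∀ᶠ x in 𝓝 ((s₀, e p₀) : P × E), H (x, g x) = 0 := by
    have := hH.eventually_apply_implicitFunction (by simp) hinv
    rwa [hHa] at this
  have hφ : ContMDiffAt (𝓘(ℝ, P).prod 𝓘(ℝ, E)) (𝓘(ℝ, P).prod 𝓘(ℝ, E)) ∞
      (fun q : P × V => (q.1, e q.2)) (s₀, p₀) :=
    contMDiffAt_fst.prodMk (ContMDiffAt.comp (s₀, p₀) contMDiffAt_extChartAt contMDiffAt_snd)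
  have hgm : ContMDiffAt (𝓘(ℝ, P).prod 𝓘(ℝ, E)) 𝓘(ℝ, ℝ) ∞ (fun q : P × V => g (q.1, e q.2))
      (s₀, p₀) :=
    ContMDiffAt.comp (s₀, p₀) (g := g) (contMDiffAt_prod_iff_contDiffAt.2 hg) hφ
  -- Zeros of G in the last variable are unique, so the implicit function coincides with τ although
  -- τ is not assumed continuous.
  refine (hgm.congr_of_eventuallyEq ?_).contMDiffWithinAt
  have hsrc : ∀ᶠ q : P × V in 𝓝 (s₀, p₀), q.2 ∈ e.source := continuousAt_snd.eventually
    ((isOpen_extChartAt_source p₀).mem_nhds (mem_extChartAt_source p₀))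
  have hUe : ∀ᶠ q : P × V in 𝓝 (s₀, p₀), q.1 ∈ U := continuousAt_fst.eventually (hU.mem_nhds hs₀)
  filter_upwards [hφ.continuousAt.eventually hgeq, hsrc, hUe] with q hq hq2 hq3
  simp only [H, e.left_inv hq2] at hq
  exact ((hτ q.1 hq3 q.2 _).1 hq).symm

end ImplicitTime

/-! ### Bijectivity from a bound on the derivative. -/

section Real

/-- A function with derivative bounded below by a positive constant is bijective. -/
lemma bijective_of_deriv_ge {g g' : ℝ → ℝ} (hg : ∀ t, HasDerivAt g (g' t) t) {c : ℝ} (hc : 0 < c)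
    (h : ∀ t, c ≤ g' t) : Function.Bijective g := by
  have hmono : StrictMono g := strictMono_of_hasDerivAt_pos hg fun t => hc.trans_le (h t)
  -- Comparison with the affine function ct + g(0) makes g unbounded at both ends.
  have hlin : Monotone fun t => g t - c * t := by
    refine monotone_of_hasDerivAt_nonneg (f' := fun t => g' t - c * 1)
      (fun t => (hg t).sub ((hasDerivAt_id t).const_mul c)) fun t => ?_
    simpa using h t
  have hcont : Continuous g := continuous_iff_continuousAt.2 fun t => (hg t).continuousAt
  refine ⟨hmono.injective, hcont.surjective ?_ ?_⟩
  · refine Filter.tendsto_atTop_mono' _ ?_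
      (Filter.tendsto_atTop_add_const_right _ (g 0) (Filter.tendsto_id.const_mul_atTop hc))
    filter_upwards [Filter.eventually_ge_atTop (0 : ℝ)] with t ht
    have := hlin ht
    simp only [mul_zero, sub_zero] at this
    simp only [id]
    linarith
  · refine Filter.tendsto_atBot_mono' _ ?_
      (Filter.tendsto_atBot_add_const_right _ (g 0) (Filter.tendsto_id.const_mul_atBot hc))
    filter_upwards [Filter.eventually_le_atBot (0 : ℝ)] with t ht
    have := hlin ht
    simp only [mul_zero, sub_zero] at this
    simp only [id]
    linarith

lemma bijective_of_deriv_le {g g' : ℝ → ℝ} (hg : ∀ t, HasDerivAt g (g' t) t) {c : ℝ} (hc : 0 < c)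
    (h : ∀ t, g' t ≤ -c) : Function.Bijective g := by
  have h1 := bijective_of_deriv_ge (fun t => (hg t).neg) hc fun t => by linarith [h t]
  have h2 := (Equiv.neg ℝ).bijective.comp h1
  convert! h2 using 1
  funext t
  simp

end Real

/-! ### Completeness of the field -JK. -/

section Completeness

variable {E : Type*} [NormedAddCommGroup E] [NormedSpace ℂ E] [FiniteDimensional ℂ E]
variable {V : Type*} [TopologicalSpace V] [ChartedSpace E V] [IsManifold 𝓘(ℂ, E) ω V] [T2Space V]
variable {F : Type*} [NormedAddCommGroup F] [NormedSpace ℝ F] [FiniteDimensional ℝ F]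
variable {N : Type*} [TopologicalSpace N] [ChartedSpace F N] [IsManifold 𝓘(ℝ, F) ∞ N]
  [CompactSpace N]
variable {d : ℕ} [MulAction (Torus d) V] (hT : IsHolomorphicTorusAction E V d)
variable {X : Fin d → ℝ} (K : Fin d → ℝ) {r : V → ℝ} {π : V → N}
include hT

/-- The radial fields of the torus action are complete on a cone with compact link. -/
lemma isCompleteField_radial (hr : IsConeFn (field E V X) r)
    (hπ : IsOrbitSpace F (radial (field E V X)) π) : IsCompleteField (radial (field E V K)) := by
  have : CompleteSpace E := FiniteDimensional.complete ℂ E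
  have hXf := isHolField_field hT X
  have hKf := isHolField_radial hT K
  have hc := hπ.isCompleteField
  choose ε hε W hW hpW Φ hΦ hflow using fun p => exists_local_flow hKf p 0
  -- Finitely many flow boxes cover the level set, so one lifetime δ serves all orbits starting
  -- there.
  obtain ⟨t, ht⟩ := (isCompact_level hπ hXf hr).elim_nhds_subcover W
    fun p _ => (hW p).mem_nhds (hpW p)
  obtain ⟨δ, hδ, hδt⟩ : ∃ δ > 0, ∀ p ∈ t, δ ≤ ε p := by
    rcases t.eq_empty_or_nonempty with rfl | hne
    · exact ⟨1, one_pos, by simp⟩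
    · exact ⟨t.inf' hne ε, (Finset.lt_inf'_iff hne).2 fun p _ => hε p,
        fun p hp => Finset.inf'_le ε hp⟩
  intro p
  obtain ⟨γ, h0, hγ⟩ := exists_isMIntegralCurve_of_isMIntegralCurveOn hKf.contMDiff hδ
    (fun p => by
      obtain ⟨q, hq, hpq⟩ := Set.mem_iUnion₂.1 (ht.2 (show r (retr hc r p) = 1 from r_retr hr hc p))
      have h1 := (hflow q _ hpq).2.1.mono
        (Set.Ioo_subset_Ioo (neg_le_neg (hδt q hq)) (hδt q hq))
      -- The flow of -JX preserves -JK, so it carries the local orbit through `retr hc r p` to one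
      -- through p with the same lifetime.
      exact ⟨fun s => flow hc (Real.log (r p)) (Φ q s (retr hc r p)), by
        beta_reduce
        rw [(hflow q _ hpq).1, retr, flow_flow_neg hXf.radial],
        isMIntegralCurve_map (fun p' => mdiffAt (contMDiff_flow_right hXf.radial hc _) p')
          (diff_flow_radial hT hc K (Real.log (r p))) h1⟩) p
  exact ⟨γ, hγ, h0⟩

end Completeness

/-! ### The hitting time of the level set and the transferred function. -/

section HitTime

variable {E : Type*} [NormedAddCommGroup E] [NormedSpace ℂ E] [FiniteDimensional ℂ E]
variable {V : Type*} [TopologicalSpace V] [ChartedSpace E V] [IsManifold 𝓘(ℂ, E) ω V] [T2Space V]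

/-- The function `r` grows or decays at a definite rate along the field `Z`. -/
def IsTransverse (Z : VField E V) (r : V → ℝ) : Prop :=
  ∃ c > 0, (∀ p, c * r p ≤ diff E ℝ r p (Z p)) ∨ ∀ p, diff E ℝ r p (Z p) ≤ -(c * r p)

lemma IsTransverse.ne_zero {Z : VField E V} {r : V → ℝ} (ht : IsTransverse Z r)
    (hpos : ∀ p, 0 < r p) (p : V) : diff E ℝ r p (Z p) ≠ 0 := by
  obtain ⟨c, hc, h | h⟩ := ht
  · exact ((mul_pos hc (hpos p)).trans_le (h p)).ne'
  · exact ((h p).trans_lt (neg_neg_of_pos (mul_pos hc (hpos p)))).ne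

open Classical in
/-- The time at which the orbit of `p` meets the level set `r = 1`. -/
def hitTime {Z : VField E V} (hc : IsCompleteField Z) (r : V → ℝ) (p : V) : ℝ :=
  if h : ∃ s, r (flow hc s p) = 1 then h.choose else 0

/-- The function which is homogeneous with respect to the flow of `Z` and has the same unit level
set as `r`. -/
def transfer {Z : VField E V} (hc : IsCompleteField Z) (r : V → ℝ) (p : V) : ℝ :=
  Real.exp (-hitTime hc r p)

variable {Z : VField E V} (hZ : IsHolField Z) (hc : IsCompleteField Z) {r : V → ℝ}
  (hr : ContMDiff 𝓘(ℝ, E) 𝓘(ℝ, ℝ) ∞ r) (hpos : ∀ p, 0 < r p) (ht : IsTransverse Z r)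

include hr hpos

lemma hasDerivAt_log_flow (p : V) (t : ℝ) : HasDerivAt (fun t => Real.log (r (flow hc t p)))
    (diff E ℝ r (flow hc t p) (Z (flow hc t p)) / r (flow hc t p)) t :=
  (hasDerivAt_comp_flow hc (mdiffAt hr _)).log (hpos _).ne'

include ht

/-- Along an orbit the derivative of log r has constant sign and is bounded away from 0, so log r
vanishes exactly once. The default value in `hitTime` is therefore never used. -/
lemma flow_eq_one_iff (p : V) (s : ℝ) : r (flow hc s p) = 1 ↔ s = hitTime hc r p := by
  have hbij : Function.Bijective fun t => Real.log (r (flow hc t p)) := by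
    obtain ⟨c, hc0, h | h⟩ := ht
    · refine bijective_of_deriv_ge (hasDerivAt_log_flow hc hr hpos p) hc0 fun t => ?_
      rw [le_div_iff₀ (hpos _)]
      exact h _
    · refine bijective_of_deriv_le (hasDerivAt_log_flow hc hr hpos p) hc0 fun t => ?_
      rw [div_le_iff₀ (hpos _), neg_mul]
      exact h _
  have hlog (s : ℝ) : Real.log (r (flow hc s p)) = 0 ↔ r (flow hc s p) = 1 :=
    ⟨fun h => Real.eq_one_of_pos_of_log_eq_zero (hpos _) h, fun h => by rw [h, Real.log_one]⟩
  have hex : ∃ s, r (flow hc s p) = 1 := by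
    obtain ⟨s, hs⟩ := hbij.2 0
    exact ⟨s, (hlog s).1 hs⟩
  have hsp : r (flow hc (hitTime hc r p) p) = 1 := by
    rw [hitTime, dif_pos hex]
    exact hex.choose_spec
  constructor
  · intro h
    refine hbij.1 ?_
    simp only [h, hsp]
  · rintro rfl
    exact hsp

lemma transfer_eq_one_iff (p : V) : transfer hc r p = 1 ↔ r p = 1 := by
  rw [transfer, Real.exp_eq_one_iff, neg_eq_zero, eq_comm, ← flow_eq_one_iff hc hr hpos ht,
    flow_zero]

include hZ in
-- Flowing for time t shortens the hitting time by t.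
lemma transfer_flow (t : ℝ) (p : V) :
    transfer hc r (flow hc t p) = Real.exp t * transfer hc r p := by
  have h : hitTime hc r p - t = hitTime hc r (flow hc t p) := by
    rw [← flow_eq_one_iff hc hr hpos ht, ← flow_add hZ, sub_add_cancel,
      flow_eq_one_iff hc hr hpos ht]
  rw [transfer, transfer, ← h, ← Real.exp_add]
  congr 1
  ring

omit hr hpos ht in
include hZ in
/-- The construction maps smooth families to smooth families. -/
lemma smoothFamilyOn_hitTime {P : Type*} [NormedAddCommGroup P] [NormedSpace ℝ P]
    [FiniteDimensional ℝ P] {U : Set P} (hU : IsOpen U) {r : P → V → ℝ}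
    (hr : SmoothFamilyOn E U r) (hrs : ∀ s ∈ U, ContMDiff 𝓘(ℝ, E) 𝓘(ℝ, ℝ) ∞ (r s))
    (hpos : ∀ s ∈ U, ∀ p, 0 < r s p) (ht : ∀ s ∈ U, IsTransverse Z (r s)) :
    SmoothFamilyOn E U (fun s => hitTime hc (r s)) := by
  refine contMDiffOn_implicit_time hU (G := fun s p t => Real.log (r s (flow hc t p))) ?_ ?_ ?_
  · have h1 : ContMDiffOn ((𝓘(ℝ, P).prod 𝓘(ℝ, E)).prod 𝓘(ℝ, ℝ)) (𝓘(ℝ, P).prod 𝓘(ℝ, E)) ∞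
        (fun q : (P × V) × ℝ => (q.1.1, flow hc q.2 q.1.2)) ((U ×ˢ Set.univ) ×ˢ Set.univ) :=
      ((contMDiff_fst.comp contMDiff_fst).prodMk (contMDiff_flow_comp hZ hc contMDiff_snd
        (contMDiff_snd.comp contMDiff_fst))).contMDiffOn
    have h2 : ContMDiffOn ((𝓘(ℝ, P).prod 𝓘(ℝ, E)).prod 𝓘(ℝ, ℝ)) 𝓘(ℝ, ℝ) ∞
        (fun q : (P × V) × ℝ => r q.1.1 (flow hc q.2 q.1.2)) ((U ×ˢ Set.univ) ×ˢ Set.univ) :=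
      ContMDiffOn.comp (g := fun q : P × V => r q.1 q.2) hr h1 fun q hq => ⟨hq.1.1, trivial⟩
    intro q hq
    exact ContMDiffAt.comp_contMDiffWithinAt q (contMDiffAt_iff_contDiffAt.2
      (Real.contDiffAt_log.2 (hpos _ hq.1.1 _).ne')) (h2 q hq)
  · intro s hs p t
    rw [← flow_eq_one_iff hc (hrs s hs) (hpos s hs) (ht s hs)]
    exact ⟨fun h => Real.eq_one_of_pos_of_log_eq_zero (hpos s hs _) h,
      fun h => by rw [h, Real.log_one]⟩
  · intro s hs p
    rw [(hasDerivAt_log_flow hc (hrs s hs) (hpos s hs) p _).deriv]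
    exact div_ne_zero ((ht s hs).ne_zero (hpos s hs) _) (hpos s hs _).ne'

omit hr hpos ht in
include hZ in
lemma smoothFamilyOn_transfer {P : Type*} [NormedAddCommGroup P] [NormedSpace ℝ P]
    [FiniteDimensional ℝ P] {U : Set P} (hU : IsOpen U) {r : P → V → ℝ}
    (hr : SmoothFamilyOn E U r) (hrs : ∀ s ∈ U, ContMDiff 𝓘(ℝ, E) 𝓘(ℝ, ℝ) ∞ (r s))
    (hpos : ∀ s ∈ U, ∀ p, 0 < r s p) (ht : ∀ s ∈ U, IsTransverse Z (r s)) :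
    SmoothFamilyOn E U (fun s => transfer hc (r s)) := by
  have h := smoothFamilyOn_hitTime hZ hc hU hr hrs hpos ht
  have h2 : ContDiff ℝ ∞ (fun x : ℝ => Real.exp (-x)) := Real.contDiff_exp.comp contDiff_neg
  exact (contMDiff_iff_contDiff.2 h2).comp_contMDiffOn h

include hZ in
-- Smoothness for a single function is the case of a constant one-parameter family.
lemma contMDiff_transfer : ContMDiff 𝓘(ℝ, E) 𝓘(ℝ, ℝ) ∞ (transfer hc r) := by
  have h := smoothFamilyOn_transfer (P := ℝ) hZ hc isOpen_univ (r := fun _ => r)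
    (hr.comp contMDiff_snd).contMDiffOn (fun _ _ => hr) (fun _ _ => hpos) (fun _ _ => ht)
  have h2 : ContMDiff (𝓘(ℝ, ℝ).prod 𝓘(ℝ, E)) 𝓘(ℝ, ℝ) ∞ (fun q : ℝ × V => transfer hc r q.2) := by
    rw [← contMDiffOn_univ, ← Set.univ_prod_univ]
    exact h
  exact h2.comp (contMDiff_const (c := (0 : ℝ)).prodMk contMDiff_id)

end HitTime

/-! ### Invariance and homogeneity of the transferred function. -/

section Transfer

variable {E : Type*} [NormedAddCommGroup E] [NormedSpace ℂ E] [FiniteDimensional ℂ E]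
variable {V : Type*} [TopologicalSpace V] [ChartedSpace E V] [IsManifold 𝓘(ℂ, E) ω V] [T2Space V]
variable {d : ℕ} [MulAction (Torus d) V] (hT : IsHolomorphicTorusAction E V d)
variable {X K : Fin d → ℝ} {r : V → ℝ} (hc : IsCompleteField (radial (field E V K)))
  (hr : ContMDiff 𝓘(ℝ, E) 𝓘(ℝ, ℝ) ∞ r) (hpos : ∀ p, 0 < r p)
  (ht : IsTransverse (radial (field E V K)) r) (hinv : ∀ (g : Torus d) (p : V), r (g • p) = r p)
include hT hr hpos ht hinv

/-- The action commutes with the flow and preserves r, hence preserves hitting times. -/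
lemma transfer_smul (g : Torus d) (p : V) : transfer hc r (g • p) = transfer hc r p := by
  rw [transfer, transfer]
  congr 2
  rw [← flow_eq_one_iff hc hr hpos ht, ← hinv g, ← flow_smul_torus hT,
    flow_eq_one_iff hc hr hpos ht]

lemma isConeFn_transfer : IsConeFn (field E V K) (transfer hc r) := by
  have hs := contMDiff_transfer (isHolField_radial hT K) hc hr hpos ht
  refine ⟨hs, fun p => Real.exp_pos _, fun p => ?_, fun p => ?_⟩
  · exact diff_field_of_invariant hT K (mdiffAt hs p) fun g =>
      transfer_smul hT hc hr hpos ht hinv g p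
  · have h1 := hasDerivAt_comp_flow hc (p := p) (t := 0) (mdiffAt hs _)
    simp only [transfer_flow (isHolField_radial hT K) hc hr hpos ht, flow_zero] at h1
    have h2 := (Real.hasDerivAt_exp 0).mul_const (transfer hc r p)
    rw [Real.exp_zero, one_mul] at h2
    exact h1.unique h2

end Transfer

end SasakiCone

end

noncomputable section

set_option linter.unusedSectionVars false

namespace SasakiCone

/-! ### Comparison of Levi forms on a common level set. -/

section Linked

variable {E : Type*} [NormedAddCommGroup E] [NormedSpace ℂ E] [FiniteDimensional ℂ E]
variable {V : Type*} [TopologicalSpace V] [ChartedSpace E V] [IsManifold 𝓘(ℂ, E) ω V] [T2Space V]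
variable {ζ : VField E V} {r r' : V → ℝ}
variable (hζ : IsHolField ζ) (hr : ContMDiff 𝓘(ℝ, E) 𝓘(ℝ, ℝ) ∞ r) (hr' : IsConeFn ζ r')
  (hc : IsCompleteField (radial ζ)) (hl : ∀ p, r' p = 1 → r p = 1)
include hζ hr'

/-- The retraction fixes the level set r' = 1 pointwise, so its differential is the identity on
tangent vectors of that set. -/
lemma diff_retr_of_eq_one {p : V} (hp : r' p = 1) {v : E} (hv : diff E ℝ r' p v = 0) :
    diff E E (retr hc r') p v = v := by
  have h0 : flow hc 0 = fun p => p := funext (flow_zero hc)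
  rw [diff_retr hζ hr', hv, hp, Real.log_one, neg_zero, zero_div, zero_smul, sub_zero, h0, diff_id]
  rfl

include hr hl hc

/-- On a common level set of `r` and `r'` the differentials are proportional. -/
lemma diff_eq_of_level {p : V} (hp : r' p = 1) (v : E) :
    diff E ℝ r p v = diff E ℝ r p (radial ζ p) * diff E ℝ r' p v := by
  -- The composite of r with the retraction is constant, and the differential of the retraction
  -- fixes w.
  have hker (w : E) (hw : diff E ℝ r' p w = 0) : diff E ℝ r p w = 0 := by
    have h1 := diff_comp_apply (g := r) (f := retr hc r') (x := p) (mdiffAt hr _)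
      (mdiffAt (contMDiff_retr hζ hr' hc) p) w
    rw [diff_retr_of_eq_one hζ hr' hc hp hw, retr_of_eq_one hc hp] at h1
    rw [← h1]
    simp only [hl _ (r_retr hr' hc _), diff_const]
    rfl
  have h2 := hker (v - diff E ℝ r' p v • radial ζ p) (by
    rw [map_sub, map_smul, hr'.homogeneous, hp, smul_eq_mul, mul_one, sub_self])
  rw [map_sub, map_smul, smul_eq_mul, sub_eq_zero] at h2
  rw [h2, mul_comm]

/-- On a common level set of `r` and `r'` the Levi forms along the CR distribution are
proportional. -/
lemma extDer_eq_of_level {p : V} (hp : r' p = 1) {u : E} (hu : diff E ℝ r' p u = 0)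
    (hu' : diff E ℝ r' p (J u) = 0) :
    OneForm.extDer (dc E r) p u (J u) =
      diff E ℝ r p (radial ζ p) * OneForm.extDer (dc E r') p u (J u) := by
  have hρ := contMDiff_retr hζ hr' hc
  have hH : ContMDiff 𝓘(ℝ, E) 𝓘(ℝ, ℝ) ∞
      (fun q => diff E ℝ r (retr hc r' q) (radial ζ (retr hc r' q))) :=
    (contMDiff_diff_apply hr hζ.radial).comp hρ
  -- Pullback by the retraction plays the role of restriction to the hypersurface r' = 1: the
  -- proportionality of d^c r and d^c r' becomes an identity on V that can be differentiated. The
  -- derivative of the factor drops out later because d^c r' vanishes on u and Ju.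
  have h1 : (OneForm.pullback (retr hc r') (dc E r) : OneForm E V) =
      fun q => diff E ℝ r (retr hc r' q) (radial ζ (retr hc r' q)) •
        (OneForm.pullback (retr hc r') (dc E r') : OneForm E V) q := by
    funext q
    ext v
    change dc E r (retr hc r' q) _ = _ * dc E r' (retr hc r' q) _
    rw [dc_apply, dc_apply, diff_eq_of_level hζ hr hr' hc hl (r_retr hr' hc q)]
    ring
  have h2 := OneForm.extDer_pullback hρ (isSmooth_dc hr) p u (J u)
  rw [h1, OneForm.extDer_smul hH ((isSmooth_dc hr'.smooth).pullback hρ),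
    OneForm.extDer_pullback hρ (isSmooth_dc hr'.smooth), diff_retr_of_eq_one hζ hr' hc hp hu,
    diff_retr_of_eq_one hζ hr' hc hp hu', retr_of_eq_one hc hp] at h2
  have h3 (w : E) (hw : diff E ℝ r' p w = 0) (hw' : diff E ℝ r' p (J w) = 0) :
      (OneForm.pullback (retr hc r') (dc E r') : OneForm E V) p w = 0 := by
    change dc E r' (retr hc r' p) (diff E E (retr hc r') p w) = 0
    rw [diff_retr_of_eq_one hζ hr' hc hp hw, retr_of_eq_one hc hp, dc_apply, hw', neg_zero]
  rw [h3 u hu hu', h3 (J u) hu' (by rw [J_J, map_neg, hu, neg_zero])] at h2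
  rw [← h2]
  ring

omit hr hl in
-- The flow is holomorphic and scales r' by e^t, so it scales d^c r' by the same constant.
lemma extDer_flow (t : ℝ) (p : V) (v w : E) :
    OneForm.extDer (dc E r') (flow hc t p) (diff E E (flow hc t) p v) (diff E E (flow hc t) p w) =
      Real.exp t * OneForm.extDer (dc E r') p v w := by
  have hφ := contMDiff_flow_right hζ.radial hc t
  have h1 : (OneForm.pullback (flow hc t) (dc E r') : OneForm E V) =
      fun q => (fun _ : V => Real.exp t) q • dc E r' q := by
    funext q
    ext v
    change dc E r' (flow hc t q) (diff E E (flow hc t) q v) = Real.exp t * dc E r' q v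
    rw [dc_apply, dc_apply, ← diff_flow_J hζ.radial, hr'.diff_flow hζ]
    ring
  rw [← OneForm.extDer_pullback hφ (isSmooth_dc hr'.smooth), h1,
    OneForm.extDer_smul contMDiff_const (isSmooth_dc hr'.smooth), diff_const]
  simp

/-- Strict plurisubharmonicity of `r` passes to `r'`. -/
lemma isConePotential_of_level
    (hpsh : ∀ (p : V) (v : E), v ≠ 0 → 0 < OneForm.extDer (dc E r) p v (J v))
    (hpos : ∀ (p : V) (v : E), v ≠ 0 → diff E ℝ r p v = 0 → diff E ℝ r p (J v) = 0 →
      0 < diff E ℝ r p (radial ζ p)) : IsConePotential ζ r' := by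
  refine hr'.isConePotential hζ fun p u hu hu' hu0 => ?_
  -- Positivity is proved on the level set, at the point where the orbit of p meets it, and carried
  -- back by the flow.
  set t := -Real.log (r' p) with ht
  have hq : r' (flow hc t p) = 1 := r_retr hr' hc p
  set u₀ := diff E E (flow hc t) p u with hu₀
  have h1 : diff E ℝ r' (flow hc t p) u₀ = 0 := by rw [hr'.diff_flow hζ, hu, mul_zero]
  have h2 : diff E ℝ r' (flow hc t p) (J u₀) = 0 := by
    rw [← diff_flow_J hζ.radial, hr'.diff_flow hζ, hu', mul_zero]
  have h3 : u₀ ≠ 0 := by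
    intro h0
    have := diff_flow_neg_diff_flow hζ.radial hc t p u
    rw [← hu₀, h0, map_zero] at this
    exact hu0 this.symm
  have h4 := hpsh (flow hc t p) u₀ h3
  have h5 := hpos (flow hc t p) u₀ h3
    (by rw [diff_eq_of_level hζ hr hr' hc hl hq, h1, mul_zero])
    (by rw [diff_eq_of_level hζ hr hr' hc hl hq, h2, mul_zero])
  rw [extDer_eq_of_level hζ hr hr' hc hl hq h1 h2] at h4
  have h6 := (pos_iff_pos_of_mul_pos h4).1 h5
  rw [← diff_flow_J hζ.radial, extDer_flow hζ hr' hc] at h6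
  exact (pos_iff_pos_of_mul_pos h6).1 (Real.exp_pos t)

end Linked

/-! ### The orbit space of the second field. -/

section Orbit

variable {E : Type*} [NormedAddCommGroup E] [NormedSpace ℂ E] [FiniteDimensional ℂ E]
variable {V : Type*} [TopologicalSpace V] [ChartedSpace E V] [IsManifold 𝓘(ℂ, E) ω V] [T2Space V]
variable {F : Type*} [NormedAddCommGroup F] [NormedSpace ℝ F] [FiniteDimensional ℝ F]
variable {N : Type*} [TopologicalSpace N] [ChartedSpace F N] [IsManifold 𝓘(ℝ, F) ∞ N]
variable {ξ ζ : VField E V} {r r' : V → ℝ} {π : V → N}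

/-- A homogeneous function for another field, with the same unit level set, gives another orbit
space structure. -/
lemma isOrbitSpace_of_level (hξ : IsHolField ξ) (hζ : IsHolField ζ) (hr : IsConeFn ξ r)
    (hr' : IsConeFn ζ r') (hl : ∀ p, r' p = 1 ↔ r p = 1) (hπ : IsOrbitSpace F (radial ξ) π)
    (hc : IsCompleteField (radial ζ)) :
    IsOrbitSpace F (radial ζ) (fun p => π (retr hc r' p)) := by
  have hs : ContMDiff 𝓘(ℝ, E) 𝓘(ℝ, F) ∞ (fun p => π (retr hc r' p)) :=
    hπ.smooth.comp (contMDiff_retr hζ hr' hc)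
  -- The new projection agrees with π on the common level set, so the old section is a section of it
  -- too.
  have hsec (x : N) : π (retr hc r' (sec hπ r x)) = x := by
    rw [retr_of_eq_one hc ((hl _).2 (r_sec hr hπ x)), π_sec hπ]
  have hsub (x : N) : Function.Surjective (diff E F (fun p => π (retr hc r' p)) (sec hπ r x)) := by
    intro w
    refine ⟨diff F E (sec hπ r) x w, ?_⟩
    have h := diff_comp_apply (g := fun p => π (retr hc r' p)) (f := sec hπ r) (x := x)
      (mdiffAt hs _) (mdiffAt (contMDiff_sec hξ hr hπ) x) w
    rw [← h]
    simp only [hsec, diff_id]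
    rfl
  refine ⟨hs, fun x => ⟨sec hπ r x, hsec x⟩, fun p w => ?_, hc, fun p q => ⟨fun h => ?_, ?_⟩⟩
  · have hx := sec_π_of_eq_one hξ hr hπ ((hl _).1 (r_retr hr' hc p))
    obtain ⟨v₀, hv₀⟩ := hsub (π (retr hc r' p)) w
    obtain ⟨v, rfl⟩ := diff_flow_surjective hζ.radial hc (-Real.log (r' p)) p v₀
    refine ⟨v, ?_⟩
    rw [hx] at hv₀
    rw [← hv₀]
    have h := diff_comp_apply (g := fun p => π (retr hc r' p)) (f := flow hc (-Real.log (r' p)))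
      (x := p) (mdiffAt hs _) (mdiffAt (contMDiff_flow_right hζ.radial hc _) p) v
    refine Eq.trans ?_ h
    simp only [retr_flow hζ hr' hc]
  · have h1 : retr hc r' p = retr hc r' q := by
      rw [← sec_π_of_eq_one hξ hr hπ ((hl _).1 (r_retr hr' hc p)), h,
        sec_π_of_eq_one hξ hr hπ ((hl _).1 (r_retr hr' hc q))]
    refine ⟨fun t => flow hc t p, flow_isMIntegralCurve hc p, flow_zero hc p,
      Real.log (r' q) + -Real.log (r' p), ?_⟩
    beta_reduce
    rw [flow_add hζ.radial]
    change flow hc (Real.log (r' q)) (retr hc r' p) = q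
    rw [h1, retr, flow_flow_neg hζ.radial]
  · rintro ⟨γ, hγ, rfl, t, rfl⟩
    rw [← flow_eq_of_isMIntegralCurve hζ.radial hc hγ t, retr_flow hζ hr' hc]

end Orbit

/-! ### Transversality, and positivity of the transferred function. -/

section Potentials

variable {E : Type*} [NormedAddCommGroup E] [NormedSpace ℂ E] [FiniteDimensional ℂ E]
variable {V : Type*} [TopologicalSpace V] [ChartedSpace E V] [IsManifold 𝓘(ℂ, E) ω V] [T2Space V]
variable {F : Type*} [NormedAddCommGroup F] [NormedSpace ℝ F] [FiniteDimensional ℝ F]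
variable {N : Type*} [TopologicalSpace N] [ChartedSpace F N] [IsManifold 𝓘(ℝ, F) ∞ N]
  [CompactSpace N]
variable {d : ℕ} [MulAction (Torus d) V] (hT : IsHolomorphicTorusAction E V d)
variable {X K : Fin d → ℝ} {r : V → ℝ} {π : V → N}
  (hπ : IsOrbitSpace F (radial (field E V X)) π)
include hT hπ

/-- The nonvanishing function dr(-JK) has constant sign as V is connected. Its absolute value
divided by r is bounded below, being determined by its values on the compact level set. -/
lemma isTransverse_radial [ConnectedSpace V] (hr : r ∈ conePotentials E V X) {u : V → ℝ}
    (hu : IsConePotential (field E V K) u) : IsTransverse (radial (field E V K)) r := by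
  have hXf := isHolField_field hT X
  have hrc := hr.1.isConeFn
  have hc := hπ.isCompleteField
  set H : V → ℝ := fun p => diff E ℝ r p (radial (field E V K) p) with hHdef
  have hH : Continuous H :=
    (contMDiff_diff_apply hr.1.smooth (isHolField_radial hT K)).continuous
  have hne (p : V) : H p ≠ 0 := diff_radial_ne_zero hT K hπ hr hu p
  obtain ⟨p₀⟩ : Nonempty V := inferInstance
  obtain ⟨x, -, hxmin⟩ := (isCompact_level hπ hXf hrc).exists_isMinOn
    ⟨retr hc r p₀, r_retr hrc hc p₀⟩ hH.abs.continuousOn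
  have habs (p : V) : |H x| * r p ≤ |H p| := by
    have h1 : H p = r p * H (retr hc r p) := diff_radial_retr hT K hrc hc p
    rw [h1, abs_mul, abs_of_pos (hr.1.pos p), mul_comm]
    exact mul_le_mul_of_nonneg_left (hxmin (r_retr hrc hc p)) (hr.1.pos p).le
  refine ⟨|H x|, abs_pos.2 (hne x), ?_⟩
  have hsign : (∀ p, 0 < H p) ∨ ∀ p, H p < 0 := by
    by_contra! hcon
    obtain ⟨⟨p, hp⟩, q, hq⟩ := hcon
    obtain ⟨z, hz⟩ := mem_range_of_exists_le_of_exists_ge hH ⟨p, hp⟩ ⟨q, hq⟩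
    exact hne z hz
  refine hsign.imp (fun h p => ?_) fun h p => ?_
  · have := habs p
    rwa [abs_of_pos (h p)] at this
  · have := habs p
    rw [abs_of_neg (h p)] at this
    exact le_neg.1 this

/-- The transferred function is a cone potential. -/
lemma transfer_mem_conePotentials [ConnectedSpace V] (hr : r ∈ conePotentials E V X) {u : V → ℝ}
    (hu : IsConePotential (field E V K) u) (hc : IsCompleteField (radial (field E V K))) :
    transfer hc r ∈ conePotentials E V K := by
  have ht := isTransverse_radial hT hπ hr hu
  have hcone := isConeFn_transfer hT hc hr.1.smooth hr.1.pos ht hr.2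
  refine ⟨isConePotential_of_level (isHolField_field hT K) hr.1.smooth hcone hc
    (fun p hp => (transfer_eq_one_iff hc hr.1.smooth hr.1.pos ht p).1 hp) hr.1.psh
    fun p v hv0 hv hv' => ?_, transfer_smul hT hc hr.1.smooth hr.1.pos ht hr.2⟩
  -- A nonzero vector in ker dr ∩ ker d^c r excludes the case of a curve, the only one in which
  -- dr(-JK) may be negative.
  refine diff_radial_pos hT K hπ (fun hdim => hv0 ?_) hr hu p
  exact eq_zero_of_finrank_le_one hdim hr.1.isConeFn hv hv'

end Potentials

section Unique

variable {E : Type*} [NormedAddCommGroup E] [NormedSpace ℂ E] [FiniteDimensional ℂ E]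
variable {V : Type*} [TopologicalSpace V] [ChartedSpace E V] [IsManifold 𝓘(ℂ, E) ω V] [T2Space V]

/-- Homogeneous functions are determined by their unit level set. -/
lemma eq_of_level_eq {ζ : VField E V} {r r' : V → ℝ} (hr : IsConeFn ζ r) (hr' : IsConeFn ζ r')
    (hc : IsCompleteField (radial ζ)) (hl : ∀ p, r p = 1 → r' p = 1) : r = r' := by
  funext p
  have h1 := hl _ (r_retr hr hc p)
  rw [retr, hr'.flow_eq, Real.exp_neg, Real.exp_log (hr.pos p)] at h1
  have := (hr.pos p).ne'
  field_simp at h1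
  exact h1.symm

end Unique

end SasakiCone

end

noncomputable section

set_option linter.unusedSectionVars false

namespace SasakiCone

/-! ### CR structures in terms of ker dr ∩ ker d^c r. -/

section CR

variable {E : Type*} [NormedAddCommGroup E] [NormedSpace ℂ E] [FiniteDimensional ℂ E]
variable {V : Type*} [TopologicalSpace V] [ChartedSpace E V] [IsManifold 𝓘(ℂ, E) ω V] [T2Space V]
variable {F : Type*} [NormedAddCommGroup F] [NormedSpace ℝ F] [FiniteDimensional ℝ F]
variable {N : Type*} [TopologicalSpace N] [ChartedSpace F N] [IsManifold 𝓘(ℝ, F) ∞ N]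
variable {ξ : VField E V} {r : V → ℝ} {π : V → N}
variable (hξ : IsHolField ξ) (hr : IsConeFn ξ r) (hπ : IsOrbitSpace F (radial ξ) π)

/-- The CR structure at `p` in terms of `ker dr ∩ ker d^c r`. -/
def CRLift (π : V → N) (r : V → ℝ) (p : V) (w w' : F) : Prop :=
  ∃ v : E, diff E ℝ r p v = 0 ∧ diff E ℝ r p (J v) = 0 ∧ w = diff E F π p v ∧
    w' = diff E F π p (J v)

include hξ hr hπ

/-- A lift of w is determined only modulo -Jξ. Removing its radial component yields dr(v) = 0 and
absorbs the coefficient of ξ in w', so a single vector carries all conditions. -/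
lemma crRelated_iff (p : V) (w w' : F) :
    CRRelated ξ π (contactForm E F π r) p w w' ↔ CRLift (E := E) π r p w w' := by
  have h0 := (hr.pos p).ne'
  constructor
  · rintro ⟨h1, h2, v, c, rfl, rfl⟩
    rw [contactForm_apply hξ hr hπ, neg_eq_zero, div_eq_zero_iff, or_iff_left h0] at h1
    rw [← map_smul, ← map_add, contactForm_apply hξ hr hπ, neg_eq_zero, div_eq_zero_iff,
      or_iff_left h0, map_add, J_J, map_smul, map_add, map_neg, map_smul, hr.diff_J_field,
      smul_eq_mul] at h2
    have hc : c = -(diff E ℝ r p v / r p) := by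
      field_simp
      linarith
    refine ⟨v - (diff E ℝ r p v / r p) • radial ξ p, ?_, ?_, ?_, ?_⟩
    · rw [map_sub, map_smul, hr.homogeneous, smul_eq_mul, div_mul_cancel₀ _ h0, sub_self]
    · rw [map_sub, map_smul, map_sub, map_smul, hr.diff_J_radial, smul_zero, sub_zero, h1]
    · rw [map_sub, map_smul, diff_π_radial hπ, smul_zero, sub_zero]
    · rw [map_sub, map_smul, map_sub, map_smul, J_radial, hc, neg_smul, sub_eq_add_neg]
  · rintro ⟨v, h1, h2, rfl, rfl⟩
    refine ⟨?_, ?_, v, 0, rfl, by rw [zero_smul, add_zero]⟩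
    · rw [contactForm_apply hξ hr hπ, h2, zero_div, neg_zero]
    · rw [contactForm_apply hξ hr hπ, J_J, map_neg, h1, neg_zero, zero_div, neg_zero]

lemma crLift_flow {p : V} {w w' : F} (t : ℝ) (h : CRLift (E := E) π r p w w') :
    CRLift (E := E) π r (flow hπ.isCompleteField t p) w w' := by
  obtain ⟨v, h1, h2, rfl, rfl⟩ := h
  refine ⟨diff E E (flow hπ.isCompleteField t) p v, ?_, ?_, ?_, ?_⟩
  · rw [hr.diff_flow hξ, h1, mul_zero]
  · rw [← diff_flow_J hξ.radial, hr.diff_flow hξ, h2, mul_zero]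
  · rw [diff_π_flow hξ hπ]
  · rw [← diff_flow_J hξ.radial, diff_π_flow hξ hπ]

/-- Lifts are carried along by the flow, so the CR structure may be tested on the level set. -/
lemma crLift_iff_sec (p : V) (w w' : F) :
    CRLift (E := E) π r p w w' ↔ CRLift (E := E) π r (sec hπ r (π p)) w w' := by
  constructor
  · intro h
    rw [sec_π hξ hr hπ]
    exact crLift_flow hξ hr hπ _ h
  · intro h
    have := crLift_flow hξ hr hπ (Real.log (r p)) h
    rwa [flow_log_sec hξ hr hπ] at this

end CR

/-! ### The diffeomorphism between the two orbit spaces. -/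

section Psi

variable {E : Type*} [NormedAddCommGroup E] [NormedSpace ℂ E] [FiniteDimensional ℂ E]
variable {V : Type*} [TopologicalSpace V] [ChartedSpace E V] [IsManifold 𝓘(ℂ, E) ω V] [T2Space V]
variable {F : Type*} [NormedAddCommGroup F] [NormedSpace ℝ F] [FiniteDimensional ℝ F]
variable {N : Type*} [TopologicalSpace N] [ChartedSpace F N] [IsManifold 𝓘(ℝ, F) ∞ N]
variable {N' : Type*} [TopologicalSpace N'] [ChartedSpace F N'] [IsManifold 𝓘(ℝ, F) ∞ N']
variable {ξ ζ : VField E V} {r r' : V → ℝ} {π : V → N} {π' : V → N'}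

variable (hξ : IsHolField ξ) (hζ : IsHolField ζ) (hr : IsConeFn ξ r) (hr' : IsConeFn ζ r')
  (hl : ∀ p, r' p = 1 ↔ r p = 1) (hπ : IsOrbitSpace F (radial ξ) π)
  (hπ' : IsOrbitSpace F (radial ζ) π')

/-- The diffeomorphism of orbit spaces given by a common level set. -/
def levelDiffeo : N' ≃ₘ^∞⟮𝓘(ℝ, F), 𝓘(ℝ, F)⟯ N where
  toFun y := π (sec hπ' r' y)
  invFun x := π' (sec hπ r x)
  left_inv y := by
    beta_reduce
    rw [sec_π_of_eq_one hξ hr hπ ((hl _).1 (r_sec hr' hπ' y)), π_sec hπ']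
  right_inv x := by
    beta_reduce
    rw [sec_π_of_eq_one hζ hr' hπ' ((hl _).2 (r_sec hr hπ x)), π_sec hπ]
  contMDiff_toFun := hπ.smooth.comp (contMDiff_sec hζ hr' hπ')
  contMDiff_invFun := hπ'.smooth.comp (contMDiff_sec hξ hr hπ)

lemma levelDiffeo_π (p : V) :
    levelDiffeo hξ hζ hr hr' hl hπ hπ' (π' p) = π (retr hπ'.isCompleteField r' p) :=
  congrArg π (sec_π hζ hr' hπ' p)

lemma levelDiffeo_of_eq_one {p : V} (hp : r p = 1) :
    levelDiffeo hξ hζ hr hr' hl hπ hπ' (π' p) = π p := by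
  rw [levelDiffeo_π, retr_of_eq_one _ ((hl p).2 hp)]

/-- The composite Ψ ∘ π' is π ∘ `retr`, and the differential of `retr` fixes vectors tangent to the
level set. -/
lemma diff_levelDiffeo {p : V} (hp : r' p = 1) {v : E} (hv : diff E ℝ r' p v = 0) :
    diff F F (levelDiffeo hξ hζ hr hr' hl hπ hπ') (π' p) (diff E F π' p v) = diff E F π p v := by
  have h1 := diff_comp_apply (g := levelDiffeo hξ hζ hr hr' hl hπ hπ') (f := π') (x := p)
    (mdiffAt (levelDiffeo hξ hζ hr hr' hl hπ hπ').contMDiff_toFun _) (mdiffAt hπ'.smooth p) v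
  rw [← h1]
  simp only [levelDiffeo_π]
  rw [diff_comp_apply (g := π) (f := retr hπ'.isCompleteField r') (mdiffAt hπ.smooth _)
    (mdiffAt (contMDiff_retr hζ hr' _) p), diff_retr_of_eq_one hζ hr' _ hp hv, retr_of_eq_one _ hp]

lemma diff_levelDiffeo_injective (y : N') :
    Function.Injective (diff F F (levelDiffeo hξ hζ hr hr' hl hπ hπ') y) := by
  intro w w' h
  set Ψ := levelDiffeo hξ hζ hr hr' hl hπ hπ' with hΨ
  have h1 (w : F) : diff F F Ψ.symm (Ψ y) (diff F F Ψ y w) = w := by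
    rw [← diff_comp_apply (g := Ψ.symm) (f := Ψ) (mdiffAt Ψ.symm.contMDiff_toFun _)
      (mdiffAt Ψ.contMDiff_toFun y)]
    simp only [Diffeomorph.symm_apply_apply, diff_id]
    rfl
  rw [← h1 w, h, h1]

/-- The diffeomorphism given by a common level set is an isomorphism of CR structures. -/
lemma isCRIso_levelDiffeo (hne : ∀ p, diff E ℝ r p (radial ζ p) ≠ 0) :
    IsCRIso ζ π' (contactForm E F π' r') ξ π (contactForm E F π r)
      (levelDiffeo hξ hζ hr hr' hl hπ hπ') := by
  intro p q hpq w w'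
  rw [crRelated_iff hζ hr' hπ', crRelated_iff hξ hr hπ, crLift_iff_sec hζ hr' hπ',
    crLift_iff_sec hξ hr hπ q, ← hpq]
  have hone : r' (sec hπ' r' (π' p)) = 1 := r_sec hr' hπ' _
  have hbase : sec hπ r (levelDiffeo hξ hζ hr hr' hl hπ hπ' (π' p)) = sec hπ' r' (π' p) :=
    sec_π_of_eq_one hξ hr hπ ((hl _).1 hone)
  rw [hbase]
  set x := sec hπ' r' (π' p) with hx
  have hπx : π' x = π' p := π_sec hπ' _
  -- On the common level set dr and dr' are proportional with nonzero factor, so the two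
  -- distributions upstairs coincide.
  have hd (v : E) : diff E ℝ r x v = 0 ↔ diff E ℝ r' x v = 0 := by
    rw [diff_eq_of_level hζ hr.smooth hr' hπ'.isCompleteField (fun p => (hl p).1) hone v,
      mul_eq_zero, or_iff_right (hne x)]
  have hinj := diff_levelDiffeo_injective hξ hζ hr hr' hl hπ hπ' (π' p)
  constructor
  · rintro ⟨v, h1, h2, rfl, rfl⟩
    refine ⟨v, (hd _).2 h1, (hd _).2 h2, ?_, ?_⟩
    · rw [← hπx, diff_levelDiffeo hξ hζ hr hr' hl hπ hπ' hone h1]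
    · rw [← hπx, diff_levelDiffeo hξ hζ hr hr' hl hπ hπ' hone h2]
  · rintro ⟨v, h1, h2, h3, h4⟩
    refine ⟨v, (hd _).1 h1, (hd _).1 h2, hinj ?_, hinj ?_⟩
    · rw [h3, ← hπx, diff_levelDiffeo hξ hζ hr hr' hl hπ hπ' hone ((hd _).1 h1)]
    · rw [h4, ← hπx, diff_levelDiffeo hξ hζ hr hr' hl hπ hπ' hone ((hd _).1 h2)]

end Psi

/-! ### The function η(K) and the change of contact form. -/

section Torus

variable {E : Type*} [NormedAddCommGroup E] [NormedSpace ℂ E] [FiniteDimensional ℂ E]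
variable {V : Type*} [TopologicalSpace V] [ChartedSpace E V] [IsManifold 𝓘(ℂ, E) ω V] [T2Space V]
variable {F : Type*} [NormedAddCommGroup F] [NormedSpace ℝ F] [FiniteDimensional ℝ F]
variable {N : Type*} [TopologicalSpace N] [ChartedSpace F N] [IsManifold 𝓘(ℝ, F) ∞ N]
variable {N' : Type*} [TopologicalSpace N'] [ChartedSpace F N'] [IsManifold 𝓘(ℝ, F) ∞ N']
variable {d : ℕ} [MulAction (Torus d) V] (hT : IsHolomorphicTorusAction E V d)
variable {X K : Fin d → ℝ} {r r' : V → ℝ} {π : V → N} {π' : V → N'}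
variable (hr : IsConeFn (field E V X) r) (hr' : IsConeFn (field E V K) r')
  (hl : ∀ p, r' p = 1 ↔ r p = 1) (hπ : IsOrbitSpace F (radial (field E V X)) π)
  (hπ' : IsOrbitSpace F (radial (field E V K)) π')

include hT hr hπ in
/-- The function `η_r(K)`. -/
lemma evalField_contactForm (p : V) :
    evalField π (contactForm E F π r) (field E V K) (π p) =
      diff E ℝ r p (radial (field E V K) p) / r p := by
  have hXf := isHolField_field hT X
  rw [evalField, descend_field hXf hπ (diff_flow_field hT hπ.isCompleteField K),
    contactForm_apply hXf hr hπ, radial, map_neg, neg_div]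

include hT hr hπ in
lemma evalField_ne_zero (hne : ∀ p, diff E ℝ r p (radial (field E V K) p) ≠ 0) (x : N) :
    evalField π (contactForm E F π r) (field E V K) x ≠ 0 := by
  obtain ⟨p, rfl⟩ := hπ.surjective x
  rw [evalField_contactForm hT hr hπ]
  exact div_ne_zero (hne p) (hr.pos p).ne'

/-- Tangent vectors of N' lift to vectors tangent to the common level set, on which Ψ is covered by
the identity. There d^c r = dr(-JK) d^c r', and the factor is η_r(K) because r = 1. -/
lemma contactForm_eq_pullback (hne : ∀ p, diff E ℝ r p (radial (field E V K) p) ≠ 0) :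
    contactForm E F π' r' = OneForm.pullback
      (levelDiffeo (isHolField_field hT X) (isHolField_field hT K) hr hr' hl hπ hπ')
      (rescale π (contactForm E F π r) (field E V K)) := by
  have hXf := isHolField_field hT X
  have hKf := isHolField_field hT K
  funext y
  ext w
  set p := sec hπ' r' y with hp
  have hone : r' p = 1 := r_sec hr' hπ' y
  have hone' : r p = 1 := (hl p).1 hone
  have hy : π' p = y := π_sec hπ' y
  obtain ⟨v, hv, hw⟩ : ∃ v, diff E ℝ r' p v = 0 ∧ diff E F π' p v = w := by
    obtain ⟨v, hv⟩ := hπ'.submersion p w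
    refine ⟨v - diff E ℝ r' p v • radial (field E V K) p, ?_, ?_⟩
    · rw [map_sub, map_smul, hr'.homogeneous, hone, smul_eq_mul, mul_one, sub_self]
    · rw [map_sub, map_smul, diff_π_radial hπ', smul_zero, sub_zero, hv]
  rw [← hy, ← hw, contactForm_apply hKf hr' hπ', hone, div_one]
  change _ = rescale π (contactForm E F π r) (field E V K)
    (levelDiffeo hXf hKf hr hr' hl hπ hπ' (π' p))
    (diff F F (levelDiffeo hXf hKf hr hr' hl hπ hπ') (π' p) (diff E F π' p v))
  rw [diff_levelDiffeo hXf hKf hr hr' hl hπ hπ' hone hv,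
    levelDiffeo_of_eq_one hXf hKf hr hr' hl hπ hπ' hone', rescale, smul_apply,
    evalField_contactForm hT hr hπ, contactForm_apply hXf hr hπ, hone', div_one, div_one,
    diff_eq_of_level hKf hr.smooth hr' hπ'.isCompleteField (fun p => (hl p).1) hone (J v),
    smul_eq_mul, mul_neg, inv_mul_cancel_left₀ (hne p)]

end Torus

end SasakiCone

end

noncomputable section

set_option linter.unusedSectionVars false

namespace SasakiCone

/-! ### Smooth families and their parameter derivatives. -/

section Families

variable {E : Type*} [NormedAddCommGroup E] [NormedSpace ℂ E]
variable {V : Type*} [TopologicalSpace V] [ChartedSpace E V] [IsManifold 𝓘(ℂ, E) ω V]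

lemma SmoothFamilyOn.contMDiffAt {F : Type*} [NormedAddCommGroup F] [NormedSpace ℝ F]
    {M : Type*} [TopologicalSpace M] [ChartedSpace F M]
    {P : Type*} [NormedAddCommGroup P] [NormedSpace ℝ P] {U : Set P} (hU : IsOpen U)
    {g : P → M → ℝ} (hg : SmoothFamilyOn F U g) {t : P} (ht : t ∈ U) (p : M) :
    ContMDiffAt (𝓘(ℝ, P).prod 𝓘(ℝ, F)) 𝓘(ℝ, ℝ) ∞ (fun q : P × M => g q.1 q.2) (t, p) :=
  ContMDiffOn.contMDiffAt hg ((hU.prod isOpen_univ).mem_nhds ⟨ht, trivial⟩)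

lemma SmoothFamilyOn.contDiffAt {F : Type*} [NormedAddCommGroup F] [NormedSpace ℝ F]
    {M : Type*} [TopologicalSpace M] [ChartedSpace F M]
    {P : Type*} [NormedAddCommGroup P] [NormedSpace ℝ P] {U : Set P} (hU : IsOpen U)
    {g : P → M → ℝ} (hg : SmoothFamilyOn F U g) {t : P} (ht : t ∈ U) (p : M) :
    ContDiffAt ℝ ∞ (fun s => g s p) t := by
  rw [← contMDiffAt_iff_contDiffAt]
  exact ContMDiffAt.comp t (g := fun q : P × M => g q.1 q.2) (hg.contMDiffAt hU ht p)
    (contMDiffAt_id.prodMk contMDiffAt_const)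

/-- The derivative of a smooth family with respect to the parameter is smooth. -/
lemma SmoothFamilyOn.contMDiff_deriv {U : Set ℝ} (hU : IsOpen U) {g : ℝ → V → ℝ}
    (hg : SmoothFamilyOn E U g) {t : ℝ} (ht : t ∈ U) :
    ContMDiff 𝓘(ℝ, E) 𝓘(ℝ, ℝ) ∞ (fun p => deriv (fun s => g s p) t) := by
  refine contMDiff_of_charts fun x => ?_
  set e := extChartAt 𝓘(ℝ, E) x with he
  have hG {y : E} (hy : y ∈ e.target) :
      ContDiffAt ℝ ∞ (fun q : ℝ × E => g q.1 (e.symm q.2)) (t, y) := by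
    rw [← contMDiffAt_prod_iff_contDiffAt]
    exact ContMDiffAt.comp (t, y) (g := fun q : ℝ × V => g q.1 q.2) (hg.contMDiffAt hU ht _)
      (contMDiffAt_fst.prodMk (ContMDiffAt.comp (t, y) (contMDiffAt_extChartAt_symm hy)
        contMDiffAt_snd))
  have hder {y : E} (hy : y ∈ e.target) : deriv (fun s => g s (e.symm y)) t =
      fderiv ℝ (fun q : ℝ × E => g q.1 (e.symm q.2)) (t, y) (1, 0) :=
    (HasFDerivAt.comp_hasDerivAt (f := fun s : ℝ => (s, y)) t
      ((hG hy).differentiableAt (by simp)).hasFDerivAt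
      ((hasDerivAt_id t).prodMk (hasDerivAt_const t y))).deriv
  have hy := mem_extChartAt_target (I := 𝓘(ℝ, E)) x
  have h1 : ContDiffAt ℝ ∞ (fun y => fderiv ℝ (fun q : ℝ × E => g q.1 (e.symm q.2)) (t, y))
      (e x) :=
    ContDiffAt.comp (f := fun y : E => (t, y)) (e x)
      ((hG hy).fderiv_right (m := ∞) (by simp)) (contDiffAt_const.prodMk contDiffAt_id)
  refine (h1.clm_apply (contDiffAt_const (c := ((1 : ℝ), (0 : E))))).congr_of_eventuallyEq ?_
  filter_upwards [(isOpen_extChartAt_target x).mem_nhds hy] with y' hy'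
  exact hder hy'

lemma SmoothFamilyOn.log {F : Type*} [NormedAddCommGroup F] [NormedSpace ℝ F]
    {M : Type*} [TopologicalSpace M] [ChartedSpace F M]
    {P : Type*} [NormedAddCommGroup P] [NormedSpace ℝ P] {U : Set P} {g : P → M → ℝ}
    (hg : SmoothFamilyOn F U g) (hpos : ∀ s p, 0 < g s p) :
    SmoothFamilyOn F U (fun s p => Real.log (g s p)) := fun q hq =>
  ContMDiffAt.comp_contMDiffWithinAt q (contMDiffAt_iff_contDiffAt.2
    (Real.contDiffAt_log.2 (hpos q.1 q.2).ne')) (hg q hq)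

end Families

/-! ### Derivatives of cone potentials and of the transfer map. -/

section Derivative

variable {E : Type*} [NormedAddCommGroup E] [NormedSpace ℂ E] [FiniteDimensional ℂ E]
variable {V : Type*} [TopologicalSpace V] [ChartedSpace E V] [IsManifold 𝓘(ℂ, E) ω V] [T2Space V]
variable {F : Type*} [NormedAddCommGroup F] [NormedSpace ℝ F] [FiniteDimensional ℝ F]
variable {N : Type*} [TopologicalSpace N] [ChartedSpace F N] [IsManifold 𝓘(ℝ, F) ∞ N]

/-- The logarithmic derivative of a curve of cone potentials descends to the orbit space. -/
lemma exists_deriv_log {d : ℕ} [MulAction (Torus d) V] {ξ : VField E V}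
    {π : V → N} (hπ : IsOrbitSpace F (radial ξ) π)
    {U : Set ℝ} (hU : IsOpen U) {r : ℝ → V → ℝ} (hr : SmoothFamilyOn E U r)
    (hcone : ∀ s, IsConeFn ξ (r s)) (hinv : ∀ s (g : Torus d) p, r s (g • p) = r s p)
    {t : ℝ} (ht : t ∈ U) : ∃ f ∈ invariantFunctions F d π,
      ∀ p, HasDerivAt (fun s => Real.log (r s p)) (f (π p)) t := by
  have hlog := hr.log fun s p => (hcone s).pos p
  have hd (p : V) : HasDerivAt (fun s => Real.log (r s p))
      (deriv (fun s => Real.log (r s p)) t) t :=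
    ((hlog.contDiffAt hU ht p).differentiableAt (by simp)).hasDerivAt
  -- Along an orbit log r_s grows by the elapsed time, whatever s is. So the derivative in s is
  -- constant on orbits and the chosen preimage does not matter.
  have hf (p : V) : deriv (fun s => Real.log (r s (hπ.surjective (π p)).choose)) t =
      deriv (fun s => Real.log (r s p)) t := by
    obtain ⟨γ, hγ, h0, τ, hτ⟩ := (hπ.fibre _ _).1 (hπ.surjective (π p)).choose_spec.symm
    have h1 (s : ℝ) : Real.log (r s (γ τ)) = τ + Real.log (r s (γ 0)) := by
      have h2 := eq_exp_of_hasDerivAt (h := fun t => r s (γ t)) (c := 1) (fun x => by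
        have h3 := hasDerivAt_comp_curve (mdiffAt (hcone s).smooth (γ x)) (hγ x).mdifferentiableAt
        have h4 : diff ℝ E γ x 1 = radial ξ (γ x) := by
          rw [diff, (hγ x).mfderiv]
          exact one_smul ℝ (radial ξ (γ x))
        rwa [h4, (hcone s).homogeneous, ← one_mul (r s (γ x))] at h3) τ
      simp only [one_mul] at h2
      rw [h2, Real.log_mul (Real.exp_pos _).ne' ((hcone s).pos _).ne', Real.log_exp]
    rw [← hτ]
    simp only [h1]
    rw [deriv_const_add, h0]
  refine ⟨fun x => deriv (fun s => Real.log (r s (hπ.surjective x).choose)) t, ⟨?_, fun g p => ?_⟩,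
    fun p => ?_⟩
  · refine contMDiff_of_comp_submersion hπ.smooth hπ.surjective hπ.submersion ?_
    simp only [hf]
    exact hlog.contMDiff_deriv hU ht
  · simp only [hf, hinv]
  · simp only [hf]
    exact hd p

/-- The derivative of the transfer of a curve of functions. -/
lemma hasDerivAt_log_transfer {Z : VField E V} (hZ : IsHolField Z) (hc : IsCompleteField Z)
    {U : Set ℝ} (hU : IsOpen U) {r : ℝ → V → ℝ} (hr : SmoothFamilyOn E U r)
    (hrs : ∀ s, ContMDiff 𝓘(ℝ, E) 𝓘(ℝ, ℝ) ∞ (r s)) (hpos : ∀ s p, 0 < r s p)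
    (htr : ∀ s, IsTransverse Z (r s)) {t : ℝ} (ht : t ∈ U) {p q : V}
    (hq : flow hc (hitTime hc (r t) p) p = q) {g' : ℝ}
    (hg : HasDerivAt (fun s => Real.log (r s q)) g' t) :
    HasDerivAt (fun s => Real.log (transfer hc (r s) p))
      (g' / (diff E ℝ (r t) q (Z q) / r t q)) t := by
  subst hq
  set τ : ℝ → ℝ := fun s => hitTime hc (r s) p with hτ
  have hτd : HasDerivAt τ (deriv τ t) t :=
    ((((smoothFamilyOn_hitTime hZ hc hU hr (fun s _ => hrs s) (fun s _ => hpos s)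
      fun s _ => htr s).contDiffAt hU ht p).differentiableAt (by simp))).hasDerivAt
  let h : ℝ × ℝ → ℝ := fun x => Real.log (r x.1 (flow hc x.2 p))
  have hh : ContDiffAt ℝ ∞ h (t, τ t) := by
    rw [← contMDiffAt_prod_iff_contDiffAt]
    exact ContMDiffAt.comp (t, τ t) (g := fun q : ℝ × V => Real.log (r q.1 q.2))
      ((hr.log hpos).contMDiffAt hU ht _)
      (contMDiffAt_fst.prodMk ((contMDiff_flow_comp hZ hc contMDiff_snd contMDiff_const) _))
  have hD : HasFDerivAt h (fderiv ℝ h (t, τ t)) (t, τ t) :=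
    (hh.differentiableAt (by simp)).hasFDerivAt
  have h1 : fderiv ℝ h (t, τ t) (1, 0) = g' :=
    (HasFDerivAt.comp_hasDerivAt (f := fun s : ℝ => (s, τ t)) t hD
      ((hasDerivAt_id t).prodMk (hasDerivAt_const t (τ t)))).unique hg
  have h2 : fderiv ℝ h (t, τ t) (0, 1) = diff E ℝ (r t) (flow hc (τ t) p)
      (Z (flow hc (τ t) p)) / r t (flow hc (τ t) p) :=
    (HasFDerivAt.comp_hasDerivAt (f := fun x : ℝ => (t, x)) (τ t) hD
      ((hasDerivAt_const (τ t) t).prodMk (hasDerivAt_id (τ t)))).unique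
      (hasDerivAt_log_flow hc (hrs t) (hpos t) p (τ t))
  have h3 : HasDerivAt (fun s => h (s, τ s)) (fderiv ℝ h (t, τ t) (1, deriv τ t)) t :=
    HasFDerivAt.comp_hasDerivAt (f := fun s : ℝ => (s, τ s)) t hD ((hasDerivAt_id t).prodMk hτd)
  -- The defining relation of the hitting time. Differentiating it gives ∂_s log r + τ'·dr(Z)/r = 0,
  -- and the logarithm of the transfer is -τ.
  have h4 : (fun s => h (s, τ s)) = fun _ => 0 := by
    funext s
    simp only [h]
    rw [(flow_eq_one_iff hc (hrs s) (hpos s) (htr s) p (τ s)).2 rfl, Real.log_one]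
  rw [h4] at h3
  have h5 := h3.unique (hasDerivAt_const t (0 : ℝ))
  have h6 : ((1 : ℝ), deriv τ t) = (1, 0) + deriv τ t • ((0 : ℝ), (1 : ℝ)) := by simp
  rw [h6, map_add, map_smul, h1, h2, smul_eq_mul] at h5
  have h7 : (fun s => Real.log (transfer hc (r s) p)) = fun s => -τ s := by
    funext s
    rw [transfer, Real.log_exp]
  rw [h7]
  have hne : diff E ℝ (r t) (flow hc (τ t) p) (Z (flow hc (τ t) p)) / r t (flow hc (τ t) p) ≠ 0 :=
    div_ne_zero ((htr t).ne_zero (hpos t) _) (hpos t _).ne'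
  convert! hτd.neg using 1
  rw [div_eq_iff hne]
  linarith

end Derivative

end SasakiCone

end

noncomputable section

set_option linter.unusedSectionVars false

namespace SasakiCone

/-! ### Bounding Levi forms by a strictly plurisubharmonic one. -/

section LeviBound

variable {E : Type*} [NormedAddCommGroup E] [NormedSpace ℂ E] [FiniteDimensional ℂ E]
variable {V : Type*} [TopologicalSpace V] [ChartedSpace E V] [IsManifold 𝓘(ℂ, E) ω V]

lemma norm_J (w : E) : ‖(J : E →L[ℝ] E) w‖ = ‖w‖ := by
  rw [J_apply, norm_smul, Complex.norm_I, one_mul]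

/-- The quadratic form `w ↦ B (w, w) + B (Jw, Jw)`. -/
def leviQuad (B : E →L[ℝ] E →L[ℝ] ℝ) (w : E) : ℝ := B (J w) (J w) + B w w

lemma abs_leviQuad_le (B : E →L[ℝ] E →L[ℝ] ℝ) (w : E) : |leviQuad B w| ≤ 2 * ‖B‖ * ‖w‖ ^ 2 := by
  have h1 := B.le_opNorm₂ (J w) (J w)
  have h2 := B.le_opNorm₂ w w
  rw [norm_J] at h1
  rw [Real.norm_eq_abs] at h1 h2
  refine (abs_add_le _ _).trans ?_
  linarith [sq ‖w‖]

lemma extDer_dc_leviQuad {f : V → ℝ} (hf : ContMDiff 𝓘(ℝ, E) 𝓘(ℝ, ℝ) ∞ f) {x₀ x : V}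
    (hx : x ∈ (extChartAt 𝓘(ℝ, E) x₀).source) (v : E) :
    OneForm.extDer (dc E f) x v (J v) = leviQuad (chartHess f x₀ (extChartAt 𝓘(ℝ, E) x₀ x))
      (diff E E (extChartAt 𝓘(ℝ, E) x₀) x v) := by
  rw [extDer_dc_chart hf hx, diff_extChartAt_J hx, J_J, map_neg, leviQuad, sub_neg_eq_add]

lemma continuousAt_chartHess {f : V → ℝ} (hf : ContMDiff 𝓘(ℝ, E) 𝓘(ℝ, ℝ) ∞ f) (x₀ : V) :
    ContinuousAt (chartHess f x₀) (extChartAt 𝓘(ℝ, E) x₀ x₀) :=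
  (((contDiffAt_comp_extChartAt_symm le_rfl (mem_extChartAt_target x₀) (hf _)).fderiv_right
    (m := ∞) (by simp)).fderiv_right (m := ∞) (by simp)).continuousAt

/-- Locally the Levi form of a function is bounded by the Levi form of a strictly plurisubharmonic
function. -/
lemma exists_levi_bound_near {h r : V → ℝ} (hh : ContMDiff 𝓘(ℝ, E) 𝓘(ℝ, ℝ) ∞ h)
    (hr : ContMDiff 𝓘(ℝ, E) 𝓘(ℝ, ℝ) ∞ r)
    (hpsh : ∀ (p : V) (v : E), v ≠ 0 → 0 < OneForm.extDer (dc E r) p v (J v)) (p₀ : V) :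
    ∃ C > 0, ∀ᶠ p in 𝓝 p₀, ∀ v, |OneForm.extDer (dc E h) p v (J v)| ≤
      C * OneForm.extDer (dc E r) p v (J v) := by
  have : ProperSpace E := FiniteDimensional.proper_rclike ℂ E
  set e := extChartAt 𝓘(ℝ, E) p₀ with he
  set B := chartHess r p₀ (e p₀) with hB
  have hB0 (w : E) (hw : w ≠ 0) : 0 < leviQuad B w := by
    have h1 := hpsh p₀ w hw
    rw [extDer_dc_leviQuad hr (mem_extChartAt_source p₀), diff_extChartAt_self] at h1
    exact h1
  have hcont : Continuous (leviQuad B) := by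
    unfold leviQuad
    fun_prop
  obtain ⟨c, hc, hcB⟩ := (isCompact_sphere (0 : E) 1).exists_forall_le' (a := 0)
    hcont.continuousOn fun w hw => hB0 w (ne_zero_of_mem_unit_sphere ⟨w, hw⟩)
  have hcB' (w : E) : c * ‖w‖ ^ 2 ≤ leviQuad B w := by
    rcases eq_or_ne w 0 with rfl | hw
    · simp [leviQuad]
    · have hn : ‖w‖ ≠ 0 := norm_ne_zero_iff.2 hw
      have h1 := hcB (‖w‖⁻¹ • w) (by
        rw [mem_sphere_zero_iff_norm, norm_smul, norm_inv, norm_norm, inv_mul_cancel₀ hn])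
      have h2 : leviQuad B (‖w‖⁻¹ • w) = (‖w‖⁻¹) ^ 2 * leviQuad B w := by
        simp only [leviQuad, map_smul, smul_apply, smul_eq_mul]
        ring
      rw [h2] at h1
      have h3 := mul_le_mul_of_nonneg_right h1 (sq_nonneg ‖w‖)
      have h4 : ‖w‖⁻¹ ^ 2 * leviQuad B w * ‖w‖ ^ 2 = leviQuad B w := by field_simp
      rwa [h4] at h3
  have hr1 : ∀ᶠ y in 𝓝 (e p₀), ‖chartHess r p₀ y - B‖ < c / 4 := by
    filter_upwards [(Metric.continuousAt_iff' (α := E →L[ℝ] E →L[ℝ] ℝ)).1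
      (continuousAt_chartHess hr p₀) (c / 4) (by linarith)] with y hy
    exact (dist_eq_norm (E := E →L[ℝ] E →L[ℝ] ℝ) _ _).symm.trans_lt hy
  have hh1 : ∀ᶠ y in 𝓝 (e p₀), ‖chartHess h p₀ y‖ < ‖chartHess h p₀ (e p₀)‖ + 1 := by
    have h1 : ContinuousAt (fun y => ‖chartHess h p₀ y‖) (e p₀) :=
      ContinuousAt.norm (E := E →L[ℝ] E →L[ℝ] ℝ) (continuousAt_chartHess hh p₀)
    exact h1.eventually (gt_mem_nhds (lt_add_one _))
  set A := ‖chartHess h p₀ (e p₀)‖ + 1 with hA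
  have hA0 : 0 < A := by positivity
  -- Near p₀ the Hessian of r moves by less than c/4, so its Levi form, a sum of two Hessian terms,
  -- loses at most half of the lower bound c‖w‖². The constant compares the remaining c/2 with the
  -- upper bound 2A for h.
  refine ⟨4 * A / c, by positivity, ?_⟩
  have hec : ContinuousAt e p₀ := continuousAt_extChartAt p₀
  filter_upwards [hec.eventually hr1, hec.eventually hh1,
    (isOpen_extChartAt_source (I := 𝓘(ℝ, E)) p₀).mem_nhds (mem_extChartAt_source p₀)]
    with p hp1 hp2 hp3 v
  rw [extDer_dc_leviQuad hh hp3, extDer_dc_leviQuad hr hp3]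
  set w := diff E E (extChartAt 𝓘(ℝ, E) p₀) p v
  have h1 := abs_leviQuad_le (chartHess h p₀ (e p)) w
  have h2 := abs_leviQuad_le (chartHess r p₀ (e p) - B) w
  have h3 : leviQuad (chartHess r p₀ (e p) - B) w =
      leviQuad (chartHess r p₀ (e p)) w - leviQuad B w := by
    simp only [leviQuad, sub_apply]
    ring
  rw [h3] at h2
  have h4 := hcB' w
  have hw := sq_nonneg ‖w‖
  have h5 : 2 * ‖chartHess r p₀ (e p) - B‖ * ‖w‖ ^ 2 ≤ c / 2 * ‖w‖ ^ 2 :=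
    mul_le_mul_of_nonneg_right (by linarith) hw
  have h6 : c / 2 * ‖w‖ ^ 2 ≤ leviQuad (chartHess r p₀ (e p)) w := by
    have := (abs_le.1 h2).1
    linarith
  have h7 : 2 * ‖chartHess h p₀ (e p)‖ * ‖w‖ ^ 2 ≤ 2 * A * ‖w‖ ^ 2 :=
    mul_le_mul_of_nonneg_right (by linarith) hw
  have h8 : 4 * A / c * (c / 2 * ‖w‖ ^ 2) = 2 * A * ‖w‖ ^ 2 := by
    field_simp
    ring
  calc |leviQuad (chartHess h p₀ (e p)) w| ≤ 2 * A * ‖w‖ ^ 2 := h1.trans h7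
    _ = 4 * A / c * (c / 2 * ‖w‖ ^ 2) := h8.symm
    _ ≤ _ := mul_le_mul_of_nonneg_left h6 (by positivity)

/-- The bound of the Levi form on a compact set. -/
lemma exists_levi_bound {h r : V → ℝ} (hh : ContMDiff 𝓘(ℝ, E) 𝓘(ℝ, ℝ) ∞ h)
    (hr : ContMDiff 𝓘(ℝ, E) 𝓘(ℝ, ℝ) ∞ r)
    (hpsh : ∀ (p : V) (v : E), v ≠ 0 → 0 < OneForm.extDer (dc E r) p v (J v)) {M : Set V}
    (hM : IsCompact M) :
    ∃ C > 0, ∀ p ∈ M, ∀ v, |OneForm.extDer (dc E h) p v (J v)| ≤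
      C * OneForm.extDer (dc E r) p v (J v) := by
  have hnn (p : V) (v : E) : 0 ≤ OneForm.extDer (dc E r) p v (J v) := by
    rcases eq_or_ne v 0 with rfl | hv
    · rw [← zero_smul ℝ (0 : E), extDer_smul_left, zero_mul]
    · exact (hpsh p v hv).le
  refine hM.induction_on (p := fun s => ∃ C > 0, ∀ p ∈ s, ∀ v, |OneForm.extDer (dc E h) p v (J v)| ≤
      C * OneForm.extDer (dc E r) p v (J v)) ⟨1, one_pos, by simp⟩ ?_ ?_ ?_
  · rintro s t hst ⟨C, hC, hCt⟩
    exact ⟨C, hC, fun p hp => hCt p (hst hp)⟩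
  · rintro s t ⟨C, hC, hCs⟩ ⟨C', hC', hCt⟩
    refine ⟨max C C', lt_max_of_lt_left hC, fun p hp v => ?_⟩
    rcases hp with hp | hp
    · exact (hCs p hp v).trans (mul_le_mul_of_nonneg_right (le_max_left _ _) (hnn p v))
    · exact (hCt p hp v).trans (mul_le_mul_of_nonneg_right (le_max_right _ _) (hnn p v))
  · intro p _
    obtain ⟨C, hC, hev⟩ := exists_levi_bound_near hh hr hpsh p
    exact ⟨_, mem_nhdsWithin_of_mem_nhds hev, C, hC, fun q hq => hq⟩

end LeviBound

/-! ### The functions e^{π^*φ} r and Sasaki potentials. -/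

section Twist

variable {E : Type*} [NormedAddCommGroup E] [NormedSpace ℂ E] [FiniteDimensional ℂ E]
variable {V : Type*} [TopologicalSpace V] [ChartedSpace E V] [IsManifold 𝓘(ℂ, E) ω V] [T2Space V]
variable {F : Type*} [NormedAddCommGroup F] [NormedSpace ℝ F] [FiniteDimensional ℝ F]
variable {N : Type*} [TopologicalSpace N] [ChartedSpace F N] [IsManifold 𝓘(ℝ, F) ∞ N]
variable {d : ℕ} [MulAction (Torus d) V]

/-- The homogeneous function `e^{π^* φ} r`. -/
def twist (π : V → N) (φ : N → ℝ) (r : V → ℝ) (p : V) : ℝ := Real.exp (φ (π p)) * r p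

variable (hT : IsHolomorphicTorusAction E V d) {Y : Fin d → ℝ} {r : V → ℝ} {π : V → N} {φ : N → ℝ}
  (hr : IsConeFn (field E V Y) r) (hinv : ∀ (g : Torus d) p, r (g • p) = r p)
  (hπ : IsOrbitSpace F (radial (field E V Y)) π) (hφ : φ ∈ invariantFunctions F d π)

include hr hπ hφ

lemma contMDiff_twist : ContMDiff 𝓘(ℝ, E) 𝓘(ℝ, ℝ) ∞ (twist π φ r) := by
  have h1 : ContMDiff 𝓘(ℝ, E) 𝓘(ℝ, ℝ) ∞ (fun p => Real.exp (φ (π p))) :=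
    (contMDiff_iff_contDiff.2 Real.contDiff_exp).comp (hφ.1.comp hπ.smooth)
  exact h1.mul hr.smooth

lemma diff_twist (p : V) (v : E) : diff E ℝ (twist π φ r) p v =
    twist π φ r p * (diff E ℝ (fun p => φ (π p)) p v + diff E ℝ r p v / r p) := by
  have hs : ContMDiff 𝓘(ℝ, E) 𝓘(ℝ, ℝ) ∞ (fun p => φ (π p)) := hφ.1.comp hπ.smooth
  have h1 : twist π φ r = fun p => Real.exp (φ (π p) + Real.log (r p)) := by
    funext p
    rw [twist, Real.exp_add, Real.exp_log (hr.pos p)]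
  have h2 := diff_comp_real (h := Real.exp) (r := fun p => φ (π p) + Real.log (r p)) (p := p)
    (mdiffAt (hs.add hr.contMDiff_log) p) (Real.hasDerivAt_exp _) v
  have h3 := congrArg (fun A : E →L[ℝ] ℝ => A v) (diff_add (mdiffAt hs p)
    (mdiffAt hr.contMDiff_log p))
  rw [add_apply, diff_log (mdiffAt hr.smooth p) (hr.pos p).ne'] at h3
  rw [h1, h2, h3]

omit hr in
lemma diff_comp_π_radial (p : V) :
    diff E ℝ (fun p => φ (π p)) p (radial (field E V Y) p) = 0 := by
  rw [diff_comp_apply (g := φ) (f := π) (mdiffAt hφ.1 _) (mdiffAt hπ.smooth p), diff_π_radial hπ,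
    map_zero]

omit hr in
include hT in
lemma diff_comp_π_field (p : V) :
    diff E ℝ (fun p => φ (π p)) p (field E V Y p) = 0 :=
  diff_field_of_invariant hT Y (mdiffAt (hφ.1.comp hπ.smooth) p) fun g => hφ.2 g p

include hT

lemma isConeFn_twist : IsConeFn (field E V Y) (twist π φ r) := by
  refine ⟨contMDiff_twist hr hπ hφ, fun p => mul_pos (Real.exp_pos _) (hr.pos p), fun p => ?_,
    fun p => ?_⟩
  · rw [diff_twist hr hπ hφ, diff_comp_π_field hT hπ hφ, hr.invariant, zero_div, add_zero, mul_zero]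
  · rw [diff_twist hr hπ hφ, diff_comp_π_radial hπ hφ, hr.homogeneous, div_self (hr.pos p).ne',
      zero_add, mul_one]

/-- The form `d^c φ` on the orbit space. -/
lemma dcQuot_eq (x : N) :
    dcQuot E F π φ x = contactForm E F π (twist π φ r) x - contactForm E F π r x := by
  have hYf := isHolField_field hT Y
  have ht := isConeFn_twist hT hr hπ hφ
  refine congrFun (descend_eq hπ.surjective hπ.submersion
    (β := fun x => contactForm E F π (twist π φ r) x - contactForm E F π r x) ?_) x
  funext p
  ext v
  change contactForm E F π (twist π φ r) (π p) (diff E F π p v) -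
    contactForm E F π r (π p) (diff E F π p v) = _
  rw [contactForm_apply hYf ht hπ, contactForm_apply hYf hr hπ, dc_apply, diff_twist hr hπ hφ,
    mul_div_cancel_left₀ _ (ht.pos p).ne']
  ring

lemma potentialForm_eq :
    potentialForm E π (contactForm E F π r) φ = contactForm E F π (twist π φ r) := by
  funext x
  rw [potentialForm, dcQuot_eq hT hr hπ hφ, add_sub_cancel]

lemma diff_descend_field (x : N) :
    diff F ℝ φ x (VField.descend π (field E V Y) x) = 0 := by
  obtain ⟨p, rfl⟩ := hπ.surjective x
  rw [descend_reeb (isHolField_field hT Y) hπ, ← diff_comp_apply (mdiffAt hφ.1 _)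
    (mdiffAt hπ.smooth p), diff_comp_π_field hT hπ hφ]

omit hφ in
include hinv in
/-- Sasaki potentials correspond to cone potentials. -/
lemma mem_sasakiPotentials_iff : φ ∈ sasakiPotentials E Y π (contactForm E F π r) ↔
    φ ∈ invariantFunctions F d π ∧ twist π φ r ∈ conePotentials E V Y := by
  have hYf := isHolField_field hT Y
  constructor
  · rintro ⟨hφ, -, h⟩
    refine ⟨hφ, ?_, fun g p => ?_⟩
    · rw [potentialForm_eq hT hr hπ hφ] at h
      exact isConePotential_of_isSasakiForm hYf (isConeFn_twist hT hr hπ hφ) hπ h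
    · rw [twist, twist, hφ.2, hinv]
  · rintro ⟨hφ, h⟩
    refine ⟨hφ, diff_descend_field hT hr hπ hφ, ?_⟩
    rw [potentialForm_eq hT hr hπ hφ]
    exact isSasakiForm_contactForm hYf h.1.isConeFn hπ h.1

end Twist

/-! ### Sasaki potentials as logarithmic ratios, and small perturbations. -/

section Quotient

variable {E : Type*} [NormedAddCommGroup E] [NormedSpace ℂ E] [FiniteDimensional ℂ E]
variable {V : Type*} [TopologicalSpace V] [ChartedSpace E V] [IsManifold 𝓘(ℂ, E) ω V] [T2Space V]
variable {F : Type*} [NormedAddCommGroup F] [NormedSpace ℝ F] [FiniteDimensional ℝ F]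
variable {N : Type*} [TopologicalSpace N] [ChartedSpace F N] [IsManifold 𝓘(ℝ, F) ∞ N]
variable {d : ℕ} [MulAction (Torus d) V]
variable (hT : IsHolomorphicTorusAction E V d) {Y : Fin d → ℝ} {π : V → N}
  (hπ : IsOrbitSpace F (radial (field E V Y)) π)
include hT

/-- The function `log (r / r₀)` on the orbit space. -/
def logRatio (hπ : IsOrbitSpace F (radial (field E V Y)) π) (r₀ r : V → ℝ) (x : N) : ℝ :=
  Real.log (r (sec hπ r₀ x))

lemma logRatio_π {r₀ r : V → ℝ} (hr₀ : IsConeFn (field E V Y) r₀) (hr : IsConeFn (field E V Y) r)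
    (p : V) : logRatio hπ r₀ r (π p) = Real.log (r p) - Real.log (r₀ p) := by
  rw [logRatio, sec_π (isHolField_field hT Y) hr₀ hπ, retr, hr.log_flow]
  ring

lemma twist_logRatio {r₀ r : V → ℝ} (hr₀ : IsConeFn (field E V Y) r₀)
    (hr : IsConeFn (field E V Y) r) : twist π (logRatio hπ r₀ r) r₀ = r := by
  funext p
  rw [twist, logRatio_π hT hπ hr₀ hr, Real.exp_sub, Real.exp_log (hr.pos p),
    Real.exp_log (hr₀.pos p), div_mul_cancel₀ _ (hr₀.pos p).ne']

omit hT in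
lemma logRatio_twist {r₀ : V → ℝ} (hr₀ : IsConeFn (field E V Y) r₀) (φ : N → ℝ) :
    logRatio hπ r₀ (twist π φ r₀) = φ := by
  funext x
  rw [logRatio, twist, π_sec hπ, r_sec hr₀, mul_one, Real.log_exp]

lemma logRatio_mem {r₀ r : V → ℝ} (hr₀ : r₀ ∈ conePotentials E V Y)
    (hr : r ∈ conePotentials E V Y) : logRatio hπ r₀ r ∈ invariantFunctions F d π := by
  refine ⟨?_, fun g p => ?_⟩
  · refine contMDiff_of_comp_submersion hπ.smooth hπ.surjective hπ.submersion ?_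
    simp only [logRatio_π hT hπ hr₀.1.isConeFn hr.1.isConeFn]
    exact hr.1.isConeFn.contMDiff_log.sub hr₀.1.isConeFn.contMDiff_log
  · rw [logRatio_π hT hπ hr₀.1.isConeFn hr.1.isConeFn,
      logRatio_π hT hπ hr₀.1.isConeFn hr.1.isConeFn, hr.2, hr₀.2]

/-- The bijection between Sasaki potentials and cone potentials. -/
def sasakiEquiv (r₀ : conePotentials E V Y) :
    sasakiPotentials E Y π (contactForm E F π r₀.1) ≃ conePotentials E V Y where
  toFun φ := ⟨twist π φ.1 r₀.1,
    ((mem_sasakiPotentials_iff hT r₀.2.1.isConeFn r₀.2.2 hπ).1 φ.2).2⟩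
  invFun r := ⟨logRatio hπ r₀.1 r.1, (mem_sasakiPotentials_iff hT r₀.2.1.isConeFn r₀.2.2 hπ).2
    ⟨logRatio_mem hT hπ r₀.2 r.2, by
      rw [twist_logRatio hT hπ r₀.2.1.isConeFn r.2.1.isConeFn]; exact r.2⟩⟩
  left_inv φ := Subtype.ext (logRatio_twist hπ r₀.2.1.isConeFn φ.1)
  right_inv r := Subtype.ext (twist_logRatio hT hπ r₀.2.1.isConeFn r.2.1.isConeFn)

omit hT in
lemma twist_add (φ ψ : N → ℝ) (r : V → ℝ) :
    twist π (φ + ψ) r = twist π ψ (twist π φ r) := by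
  funext p
  simp only [twist, Pi.add_apply, Real.exp_add]
  ring

include hπ in
/-- Small multiples of an invariant function preserve cone potentials. -/
lemma eventually_twist_mem [CompactSpace N] {r : V → ℝ} (hr : r ∈ conePotentials E V Y) {f : N → ℝ}
    (hf : f ∈ invariantFunctions F d π) :
    ∀ᶠ s : ℝ in 𝓝 0, twist π (s • f) r ∈ conePotentials E V Y := by
  have hYf := isHolField_field hT Y
  have hrc := hr.1.isConeFn
  have hfs : ContMDiff 𝓘(ℝ, E) 𝓘(ℝ, ℝ) ∞ (fun p => f (π p)) := hf.1.comp hπ.smooth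
  have hsf (s : ℝ) : s • f ∈ invariantFunctions F d π :=
    ⟨(contMDiff_const (c := s)).mul hf.1, fun g p => by simp only [Pi.smul_apply, hf.2]⟩
  obtain ⟨C, hC, hbound⟩ := exists_levi_bound hfs hr.1.smooth hr.1.psh
    (isCompact_level hπ hYf hrc)
  have hpull : (OneForm.pullback π (dcQuot E F π f) : OneForm E V) = dc E (fun p => f (π p)) := by
    funext p
    ext v
    change dcQuot E F π f (π p) (diff E F π p v) = _
    have ht := isConeFn_twist hT hrc hπ hf
    rw [dcQuot_eq hT hrc hπ hf, sub_apply, contactForm_apply hYf ht hπ, contactForm_apply hYf hrc hπ,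
      dc_apply, diff_twist hrc hπ hf, mul_div_cancel_left₀ _ (ht.pos p).ne']
    ring
  have hβ : OneForm.IsSmooth (dcQuot E F π f) := by
    have h1 : dcQuot E F π f = OneForm.pullback (sec hπ r) (dc E (fun p => f (π p))) := by
      rw [← hpull]
      funext x
      ext w
      change _ = dcQuot E F π f (π (sec hπ r x))
        (diff E F π (sec hπ r x) (diff F E (sec hπ r) x w))
      rw [diff_π_diff_sec hYf hrc hπ, π_sec hπ]
    rw [h1]
    exact (isSmooth_dc hfs).pullback (contMDiff_sec hYf hrc hπ)
  have hdβ (p : V) (v w : E) : OneForm.extDer (dcQuot E F π f) (π p) (diff E F π p v)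
      (diff E F π p w) = OneForm.extDer (dc E (fun p => f (π p))) p v w := by
    rw [← OneForm.extDer_pullback hπ.smooth hβ, hpull]
  -- Both sides are pulled back from N, so the bound on the compact level set holds everywhere. On
  -- that set dη agrees with dd^c r along ker dr ∩ ker d^c r, because r = 1.
  have hflow (p : V) (u : E) (hu : diff E ℝ r p u = 0) (hu' : diff E ℝ r p (J u) = 0) :
      |OneForm.extDer (dc E (fun p => f (π p))) p u (J u)| ≤
        C * OneForm.extDer (contactForm E F π r) (π p) (diff E F π p u) (diff E F π p (J u)) := by
    set t := -Real.log (r p) with ht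
    have hq : r (flow hπ.isCompleteField t p) = 1 := r_retr hrc _ p
    set v := diff E E (flow hπ.isCompleteField t) p u with hv
    have h1 := hbound _ hq v
    have h2 : diff E F π (flow hπ.isCompleteField t p) v = diff E F π p u := diff_π_flow hYf hπ t p u
    have h3 : diff E F π (flow hπ.isCompleteField t p) (J v) = diff E F π p (J u) := by
      rw [hv, ← diff_flow_J hYf.radial, diff_π_flow hYf hπ t p]
    have h4 : diff E ℝ r (flow hπ.isCompleteField t p) v = 0 := by
      rw [hv, hrc.diff_flow hYf, hu, mul_zero]
    have h5 : diff E ℝ r (flow hπ.isCompleteField t p) (J v) = 0 := by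
      rw [hv, ← diff_flow_J hYf.radial, hrc.diff_flow hYf, hu', mul_zero]
    rw [← hdβ, ← π_flow hπ t p, ← h2, ← h3, hdβ, extDer_contactForm hYf hrc hπ, h4, h5, hq]
    simpa using h1
  -- The contact form is affine in s, so positivity for small s only needs |s|·C < 1.
  have hform (s : ℝ) : contactForm E F π (twist π (s • f) r) =
      fun x => contactForm E F π r x + (fun _ : N => s) x • dcQuot E F π f x := by
    rw [← potentialForm_eq hT hrc hπ (hsf s)]
    funext x
    obtain ⟨p, rfl⟩ := hπ.surjective x
    ext w
    obtain ⟨v, rfl⟩ := hπ.submersion p w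
    have h1 (φ : N → ℝ) (hφ : φ ∈ invariantFunctions F d π) :
        dcQuot E F π φ (π p) (diff E F π p v) = -diff E ℝ (fun p => φ (π p)) p (J v) := by
      have ht := isConeFn_twist hT hrc hπ hφ
      rw [dcQuot_eq hT hrc hπ hφ, sub_apply, contactForm_apply hYf ht hπ,
        contactForm_apply hYf hrc hπ, diff_twist hrc hπ hφ, mul_div_cancel_left₀ _ (ht.pos p).ne']
      ring
    rw [potentialForm, add_apply, add_apply, smul_apply, h1 _ (hsf s), h1 f hf]
    have h2 := diff_comp_real (h := fun y => s * y) (mdiffAt hfs p)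
      (by simpa using (hasDerivAt_id (f (π p))).const_mul s) (J v)
    simp only [Pi.smul_apply, smul_eq_mul]
    rw [h2]
    ring
  have hsmall : ∀ᶠ s : ℝ in 𝓝 0, |s| * C < 1 := by
    have h1 : Filter.Tendsto (fun s : ℝ => |s| * C) (𝓝 0) (𝓝 0) := by
      have := (continuous_abs.tendsto (0 : ℝ)).mul_const C
      rwa [abs_zero, zero_mul] at this
    exact h1.eventually (gt_mem_nhds one_pos)
  filter_upwards [hsmall] with s hs
  have ht := isConeFn_twist hT hrc hπ (hsf s)
  refine ⟨ht.isConePotential hYf fun p v hv hv' hv0 => ?_, fun g p => ?_⟩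
  -- The vector v is adapted to the twisted function and u to r. They differ by multiples of the
  -- field and its radial field, which the differentials of both contact forms ignore.
  · obtain ⟨u, hu, hu', hsplit⟩ := hrc.exists_split p v
    have hu0 : u ≠ 0 := by
      rintro rfl
      have hp := (ht.pos p).ne'
      rw [zero_add] at hsplit
      have h1 := hv
      have h2 := hv'
      rw [hsplit] at h1 h2
      simp only [map_add, map_smul, ht.invariant, ht.homogeneous, ht.diff_J_field, ht.diff_J_radial,
        smul_eq_mul, mul_zero, zero_add, add_zero, mul_neg, neg_eq_zero, mul_eq_zero, hp,
        or_false] at h1 h2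
      rw [h1, h2, zero_smul, neg_zero, zero_smul, add_zero] at hsplit
      exact hv0 hsplit
    have h1 : OneForm.extDer (contactForm E F π (twist π (s • f) r)) (π p) (diff E F π p v)
        (diff E F π p (J v)) =
        (twist π (s • f) r p)⁻¹ * OneForm.extDer (dc E (twist π (s • f) r)) p v (J v) := by
      rw [extDer_contactForm hYf ht hπ, hv, hv']
      ring
    have h2 := extDer_contactForm_split hYf ht hπ hsplit
    have h3 : OneForm.extDer (contactForm E F π (twist π (s • f) r)) (π p) (diff E F π p u)
        (diff E F π p (J u)) = OneForm.extDer (contactForm E F π r) (π p) (diff E F π p u)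
        (diff E F π p (J u)) + s * OneForm.extDer (dc E (fun p => f (π p))) p u (J u) := by
      rw [hform, OneForm.extDer_add (isSmooth_contactForm hYf hrc hπ) (hβ.smul contMDiff_const),
        OneForm.extDer_smul contMDiff_const hβ, diff_const, hdβ]
      simp
    have h4 : 0 < OneForm.extDer (contactForm E F π r) (π p) (diff E F π p u)
        (diff E F π p (J u)) := by
      rw [extDer_contactForm hYf hrc hπ, hu, hu', zero_mul, zero_mul, sub_zero, mul_zero, add_zero]
      exact mul_pos (inv_pos.2 (hrc.pos p)) (hr.1.psh p u hu0)
    have h5 := hflow p u hu hu'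
    have h6 : |s * OneForm.extDer (dc E (fun p => f (π p))) p u (J u)| <
        OneForm.extDer (contactForm E F π r) (π p) (diff E F π p u) (diff E F π p (J u)) := by
      rw [abs_mul]
      calc _ ≤ |s| * (C * _) := mul_le_mul_of_nonneg_left h5 (abs_nonneg s)
        _ = (|s| * C) * _ := by ring
        _ < 1 * _ := mul_lt_mul_of_pos_right hs h4
        _ = _ := one_mul _
    have h7 := (abs_lt.1 h6).1
    have h8 : 0 < (twist π (s • f) r p)⁻¹ *
        OneForm.extDer (dc E (twist π (s • f) r)) p v (J v) := by
      rw [← h1, h2, h3]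
      linarith
    exact (pos_iff_pos_of_mul_pos h8).1 (inv_pos.2 (ht.pos p))
  · rw [twist, twist, (hsf s).2, hr.2]

end Quotient

end SasakiCone

end

noncomputable section

set_option linter.unusedSectionVars false

namespace SasakiCone

/-! ### The bijection Θ and its derivative. -/

section Bijection

variable {E : Type*} [NormedAddCommGroup E] [NormedSpace ℂ E] [FiniteDimensional ℂ E]
variable {V : Type*} [TopologicalSpace V] [ChartedSpace E V] [IsManifold 𝓘(ℂ, E) ω V] [T2Space V]
  [ConnectedSpace V]
variable {F : Type*} [NormedAddCommGroup F] [NormedSpace ℝ F] [FiniteDimensional ℝ F]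
variable {N : Type*} [TopologicalSpace N] [ChartedSpace F N] [IsManifold 𝓘(ℝ, F) ∞ N]
  [CompactSpace N]
variable {d : ℕ} [MulAction (Torus d) V] (hT : IsHolomorphicTorusAction E V d)
variable {X K : Fin d → ℝ} {πX πK : V → N} (hπX : IsOrbitSpace F (radial (field E V X)) πX)
  (hπK : IsOrbitSpace F (radial (field E V K)) πK)

include hT hπX in
lemma transfer_eq_one_iff_of_mem {r u : V → ℝ} (hr : r ∈ conePotentials E V X)
    (hu : IsConePotential (field E V K) u) (hc : IsCompleteField (radial (field E V K))) (p : V) :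
    transfer hc r p = 1 ↔ r p = 1 :=
  transfer_eq_one_iff hc hr.1.smooth hr.1.pos (isTransverse_radial hT hπX hr hu) p

include hT hπX in
/-- The orbit spaces of two polarizations are models of the same manifold. -/
lemma exists_isOrbitSpace {r u : V → ℝ} (hr : r ∈ conePotentials E V X)
    (hu : IsConePotential (field E V K) u) :
    ∃ πK : V → N, IsOrbitSpace F (radial (field E V K)) πK := by
  have hc := isCompleteField_radial hT K hr.1.isConeFn hπX
  exact ⟨_, isOrbitSpace_of_level (isHolField_field hT X) (isHolField_field hT K) hr.1.isConeFn
    (transfer_mem_conePotentials hT hπX hr hu hc).1.isConeFn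
    (transfer_eq_one_iff_of_mem hT hπX hr hu hc) hπX hc⟩

/-- The bijection between the cone potentials of two polarizations given by the unit level sets. -/
def transferEquiv {u v : V → ℝ} (hu : IsConePotential (field E V X) u)
    (hv : IsConePotential (field E V K) v) : conePotentials E V X ≃ conePotentials E V K where
  toFun r := ⟨transfer hπK.isCompleteField r.1,
    transfer_mem_conePotentials hT hπX r.2 hv hπK.isCompleteField⟩
  invFun r := ⟨transfer hπX.isCompleteField r.1,
    transfer_mem_conePotentials hT hπK r.2 hu hπX.isCompleteField⟩
  left_inv r := by
    -- Both transfers keep the unit level set, and a homogeneous function is determined by it.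
    have h1 := transfer_mem_conePotentials hT hπX r.2 hv hπK.isCompleteField
    refine Subtype.ext (eq_of_level_eq
      (transfer_mem_conePotentials hT hπK h1 hu hπX.isCompleteField).1.isConeFn
      r.2.1.isConeFn hπX.isCompleteField fun p hp => ?_)
    exact (transfer_eq_one_iff_of_mem hT hπX r.2 hv _ p).1
      ((transfer_eq_one_iff_of_mem hT hπK h1 hu _ p).1 hp)
  right_inv r := by
    have h1 := transfer_mem_conePotentials hT hπK r.2 hu hπX.isCompleteField
    refine Subtype.ext (eq_of_level_eq
      (transfer_mem_conePotentials hT hπX h1 hv hπK.isCompleteField).1.isConeFn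
      r.2.1.isConeFn hπK.isCompleteField fun p hp => ?_)
    exact (transfer_eq_one_iff_of_mem hT hπK r.2 hu _ p).1
      ((transfer_eq_one_iff_of_mem hT hπX h1 hv _ p).1 hp)

omit [ConnectedSpace V] [CompactSpace N] in
include hT hπX in
/-- The derivative of the transfer map in terms of the contact form on the orbit space. -/
lemma hasDerivAt_log_transfer_retr (hc : IsCompleteField (radial (field E V K))) {U : Set ℝ}
    (hU : IsOpen U) {r : ℝ → V → ℝ} (hr : SmoothFamilyOn E U r)
    (hcone : ∀ s, IsConeFn (field E V X) (r s))
    (htr : ∀ s, IsTransverse (radial (field E V K)) (r s)) {t : ℝ} (ht : t ∈ U) {f : N → ℝ}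
    (hf : ∀ p, HasDerivAt (fun s => Real.log (r s p)) (f (πX p)) t) (p : V) :
    HasDerivAt (fun s => Real.log (transfer hc (r s) p))
      (f (πX (retr hc (transfer hc (r t)) p)) / evalField πX (contactForm E F πX (r t))
        (field E V K) (πX (retr hc (transfer hc (r t)) p))) t := by
  rw [evalField_contactForm hT (hcone t) hπX]
  refine hasDerivAt_log_transfer (isHolField_radial hT K) hc hU hr (fun s => (hcone s).smooth)
    (fun s => (hcone s).pos) htr ht ?_ (hf _)
  rw [retr, transfer, Real.log_exp, neg_neg]

end Bijection

section Families

variable {F : Type*} [NormedAddCommGroup F] [NormedSpace ℝ F]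
variable {M : Type*} [TopologicalSpace M] [ChartedSpace F M]
variable {P : Type*} [NormedAddCommGroup P] [NormedSpace ℝ P] {U : Set P}

lemma SmoothFamilyOn.sub_const {g : P → M → ℝ} (hg : SmoothFamilyOn F U g) {h : M → ℝ}
    (hh : ContMDiff 𝓘(ℝ, F) 𝓘(ℝ, ℝ) ∞ h) : SmoothFamilyOn F U (fun s p => g s p - h p) :=
  ContMDiffOn.sub (f := fun q : P × M => g q.1 q.2)
    (g := fun q : P × M => h q.2) hg (hh.comp contMDiff_snd).contMDiffOn

/-- The family `e^{π^* φ_s} r` of homogeneous functions. -/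
lemma SmoothFamilyOn.twist {F' : Type*} [NormedAddCommGroup F'] [NormedSpace ℝ F']
    {M' : Type*} [TopologicalSpace M'] [ChartedSpace F' M'] {π : M → M'}
    (hπ : ContMDiff 𝓘(ℝ, F) 𝓘(ℝ, F') ∞ π) {φ : P → M' → ℝ} (hφ : SmoothFamilyOn F' U φ)
    {r : M → ℝ} (hr : ContMDiff 𝓘(ℝ, F) 𝓘(ℝ, ℝ) ∞ r) :
    SmoothFamilyOn F U (fun s => SasakiCone.twist π (φ s) r) := by
  have h1 : ContMDiffOn (𝓘(ℝ, P).prod 𝓘(ℝ, F)) (𝓘(ℝ, P).prod 𝓘(ℝ, F')) ∞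
      (fun q : P × M => (q.1, π q.2)) (U ×ˢ Set.univ) :=
    (contMDiff_fst.prodMk (hπ.comp contMDiff_snd)).contMDiffOn
  have h2 : ContMDiffOn (𝓘(ℝ, P).prod 𝓘(ℝ, F)) 𝓘(ℝ, ℝ) ∞
      (fun q : P × M => φ q.1 (π q.2)) (U ×ˢ Set.univ) :=
    ContMDiffOn.comp (g := fun q : P × M' => φ q.1 q.2) hφ h1 fun q hq => ⟨hq.1, trivial⟩
  exact ((contMDiff_iff_contDiff.2 Real.contDiff_exp).comp_contMDiffOn h2).mul
    (hr.comp contMDiff_snd).contMDiffOn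

end Families

end SasakiCone

end

/-! ### The main theorem. -/

theorem corollary2p13
    {E : Type*} [NormedAddCommGroup E] [NormedSpace ℂ E] [FiniteDimensional ℂ E]
    {V : Type*} [TopologicalSpace V] [T2Space V] [SecondCountableTopology V] [ConnectedSpace V]
    [ChartedSpace E V] [IsManifold 𝓘(ℂ, E) ω V]
    {F : Type*} [NormedAddCommGroup F] [NormedSpace ℝ F] [FiniteDimensional ℝ F]
    {N : Type*} [TopologicalSpace N] [T2Space N] [CompactSpace N]
    [ChartedSpace F N] [IsManifold 𝓘(ℝ, F) ∞ N]
    -- a holomorphic action of a compact torus on the complex manifold `V`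
    {d : ℕ} [MulAction (Torus d) V] (hT : IsHolomorphicTorusAction E V d)
    -- `V` is the polarized complex cone, with respect to `X`, of a compact torus-invariant
    -- Sasaki manifold `N`
    (X : Fin d → ℝ) (πX : V → N) (hπX : IsOrbitSpace F (radial (field E V X)) πX)
    (hX : (conePotentials E V X).Nonempty)
    (K : Fin d → ℝ) (hK : K ∈ reebCone E V d) :
    -- the bijection of cone potentials
    ∃ Θ : conePotentials E V X ≃ conePotentials E V K,
      (∀ (r : conePotentials E V X) (r' : conePotentials E V K),
        Θ r = r' ↔ r'.1 ⁻¹' {1} = r.1 ⁻¹' {1}) ∧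
      -- the quotient manifold of `V` with respect to `K` exists, and is a copy of `N`
      (∃ πK : V → N, IsOrbitSpace F (radial (field E V K)) πK) ∧
      -- for every model `NK` of the quotient manifold of `V` with respect to `K`
      ∀ (NK : Type*) [TopologicalSpace NK] [T2Space NK] [ChartedSpace F NK]
        [IsManifold 𝓘(ℝ, F) ∞ NK] (πK : V → NK),
        IsOrbitSpace F (radial (field E V K)) πK →
        -- the diffeomorphisms `Ψ r` from `NK` to `N` given by the level sets `r = 1`
        ∃ Ψ : conePotentials E V X → (NK ≃ₘ^∞⟮𝓘(ℝ, F), 𝓘(ℝ, F)⟯ N),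
          (∀ (r : conePotentials E V X) (p : V), r.1 p = 1 → Ψ r (πK p) = πX p) ∧
          -- contact forms and CR structures
          (∀ r : conePotentials E V X,
            (∀ x, evalField πX (contactForm E F πX r.1) (field E V K) x ≠ 0) ∧
            contactForm E F πK (Θ r).1 =
              OneForm.pullback (Ψ r) (rescale πX (contactForm E F πX r.1) (field E V K)) ∧
            IsCRIso (field E V K) πK (contactForm E F πK (Θ r).1)
              (field E V X) πX (contactForm E F πX r.1) (Ψ r)) ∧
          -- `Θ` maps smooth families (in particular smooth curves) to smooth families
          (∀ (P : Type) [NormedAddCommGroup P] [NormedSpace ℝ P] [FiniteDimensional ℝ P]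
            (U : Set P), IsOpen U → ∀ c : P → conePotentials E V X,
              SmoothFamilyOn E U (fun s => (c s).1) →
              SmoothFamilyOn E U (fun s => (Θ (c s)).1)) ∧
          -- the derivative of `Θ` along smooth curves
          (∀ U : Set ℝ, IsOpen U → ∀ c : ℝ → conePotentials E V X,
            SmoothFamilyOn E U (fun s => (c s).1) →
            ∀ t ∈ U, ∃ f ∈ invariantFunctions F d πX,
              (∀ p : V, HasDerivAt (fun s => Real.log ((c s).1 p)) (f (πX p)) t) ∧
              (∀ p : V, HasDerivAt (fun s => Real.log ((Θ (c s)).1 p))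
                (f (Ψ (c t) (πK p)) /
                  evalField πX (contactForm E F πX (c t).1) (field E V K)
                    (Ψ (c t) (πK p))) t)) ∧
          -- the induced bijection of Sasaki potentials, for any base point `r₀`
          ∀ (r₀ : conePotentials E V X) (η₀ : OneForm F N) (η₀' : OneForm F NK),
            η₀ = contactForm E F πX r₀.1 → η₀' = contactForm E F πK (Θ r₀).1 →
            ∃ Θ' : sasakiPotentials E X πX η₀ ≃ sasakiPotentials E K πK η₀',
              (∀ φ : sasakiPotentials E X πX η₀,
                ∃ r : conePotentials E V X,
                  (∀ p, r.1 p = Real.exp (φ.1 (πX p)) * r₀.1 p) ∧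
                  (∀ p, (Θ r).1 p = Real.exp ((Θ' φ).1 (πK p)) * (Θ r₀).1 p) ∧
                  -- contact forms and CR structures of corresponding Sasaki potentials
                  (∀ x, evalField πX (potentialForm E πX η₀ φ.1) (field E V K) x ≠ 0) ∧
                  potentialForm E πK η₀' (Θ' φ).1 =
                    OneForm.pullback (Ψ r)
                      (rescale πX (potentialForm E πX η₀ φ.1) (field E V K)) ∧
                  IsCRIso (field E V K) πK (potentialForm E πK η₀' (Θ' φ).1)
                    (field E V X) πX (potentialForm E πX η₀ φ.1) (Ψ r) ∧
                  -- every invariant function `f` is tangent to the space of Sasaki potentials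
                  (∀ f ∈ invariantFunctions F d πX, ∀ᶠ s : ℝ in 𝓝 0,
                    φ.1 + s • f ∈ sasakiPotentials E X πX η₀) ∧
                  -- the derivative of `Θ'` at `φ` in the direction `f`
                  (∀ f ∈ invariantFunctions F d πX, ∀ U : Set ℝ, IsOpen U → ∀ t ∈ U,
                    ∀ c : ℝ → sasakiPotentials E X πX η₀,
                      SmoothFamilyOn F U (fun s => (c s).1) → c t = φ →
                      (∀ x, HasDerivAt (fun s => (c s).1 x) (f x) t) →
                      ∀ y, HasDerivAt (fun s => (Θ' (c s)).1 y)
                        (f (Ψ r y) /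
                          evalField πX (potentialForm E πX η₀ φ.1) (field E V K)
                            (Ψ r y)) t)) ∧
              -- `Θ'` is smooth: it maps smooth families to smooth families
              (∀ (P : Type) [NormedAddCommGroup P] [NormedSpace ℝ P] [FiniteDimensional ℝ P]
                (U : Set P), IsOpen U → ∀ c : P → sasakiPotentials E X πX η₀,
                  SmoothFamilyOn F U (fun s => (c s).1) →
                  SmoothFamilyOn F U (fun s => (Θ' (c s)).1)) := by
  obtain ⟨u, hu⟩ := hX
  obtain ⟨v, hv, -⟩ := hK
  -- A model of the quotient by -JK on N itself, used to define Θ before any other model `NK` is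
  -- given.
  obtain ⟨π₀, hπ₀⟩ := exists_isOrbitSpace hT hπX hu hv
  have hXf := isHolField_field hT X
  have hKf := isHolField_field hT K
  have hc := hπ₀.isCompleteField
  have htr (r : conePotentials E V X) : IsTransverse (radial (field E V K)) r.1 :=
    isTransverse_radial hT hπX r.2 hv
  have hne (r : conePotentials E V X) := (htr r).ne_zero r.2.1.pos
  set Θ := transferEquiv hT hπX hπ₀ hu.1 hv with hΘ
  have hΘ_val (r : conePotentials E V X) : (Θ r).1 = transfer hc r.1 := rfl
  have hlevel (r : conePotentials E V X) (p : V) : (Θ r).1 p = 1 ↔ r.1 p = 1 :=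
    transfer_eq_one_iff_of_mem hT hπX r.2 hv hc p
  have hfam (P : Type) [NormedAddCommGroup P] [NormedSpace ℝ P] [FiniteDimensional ℝ P]
      (U : Set P) (hU : IsOpen U) (c : P → conePotentials E V X)
      (hs : SmoothFamilyOn E U (fun s => (c s).1)) :
      SmoothFamilyOn E U (fun s => (Θ (c s)).1) :=
    smoothFamilyOn_transfer hKf.radial hc hU hs (fun s _ => (c s).2.1.smooth)
      (fun s _ => (c s).2.1.pos) (fun s _ => htr (c s))
  refine ⟨Θ, fun r r' => ⟨?_, fun h => ?_⟩, ⟨π₀, hπ₀⟩, ?_⟩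
  · rintro rfl
    ext p
    exact hlevel r p
  · refine Subtype.ext (eq_of_level_eq (Θ r).2.1.isConeFn r'.2.1.isConeFn hc fun p hp => ?_)
    have h1 : p ∈ r.1 ⁻¹' {1} := (hlevel r p).1 hp
    rwa [← h] at h1
  intro NK _ _ _ _ πK hπK
  set Ψ : conePotentials E V X → (NK ≃ₘ^∞⟮𝓘(ℝ, F), 𝓘(ℝ, F)⟯ N) := fun r =>
    levelDiffeo hXf hKf r.2.1.isConeFn (Θ r).2.1.isConeFn (hlevel r) hπX hπK with hΨ
  have hΨ_π (r : conePotentials E V X) (p : V) : Ψ r (πK p) = πX (retr hc (transfer hc r.1) p) :=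
    levelDiffeo_π hXf hKf r.2.1.isConeFn (Θ r).2.1.isConeFn (hlevel r) hπX hπK p
  have hderiv (U : Set ℝ) (hU : IsOpen U) (c : ℝ → conePotentials E V X)
      (hs : SmoothFamilyOn E U (fun s => (c s).1)) (t : ℝ) (ht : t ∈ U) (f : N → ℝ)
      (hf : ∀ p : V, HasDerivAt (fun s => Real.log ((c s).1 p)) (f (πX p)) t) (p : V) :
      HasDerivAt (fun s => Real.log ((Θ (c s)).1 p)) (f (Ψ (c t) (πK p)) /
        evalField πX (contactForm E F πX (c t).1) (field E V K) (Ψ (c t) (πK p))) t := by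
    rw [hΨ_π]
    exact hasDerivAt_log_transfer_retr hT hπX hc hU hs (fun s => (c s).2.1.isConeFn)
      (fun s => htr (c s)) ht hf p
  have hcontact (r : conePotentials E V X) :
      (∀ x, evalField πX (contactForm E F πX r.1) (field E V K) x ≠ 0) ∧
      contactForm E F πK (Θ r).1 =
        OneForm.pullback (Ψ r) (rescale πX (contactForm E F πX r.1) (field E V K)) ∧
      IsCRIso (field E V K) πK (contactForm E F πK (Θ r).1)
        (field E V X) πX (contactForm E F πX r.1) (Ψ r) :=
    ⟨evalField_ne_zero hT r.2.1.isConeFn hπX (hne r),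
      contactForm_eq_pullback hT r.2.1.isConeFn (Θ r).2.1.isConeFn (hlevel r) hπX hπK (hne r),
      isCRIso_levelDiffeo hXf hKf r.2.1.isConeFn (Θ r).2.1.isConeFn (hlevel r) hπX hπK (hne r)⟩
  refine ⟨Ψ, fun r p hp => levelDiffeo_of_eq_one hXf hKf r.2.1.isConeFn (Θ r).2.1.isConeFn
    (hlevel r) hπX hπK hp, hcontact, hfam, fun U hU c hs t ht => ?_, ?_⟩
  · obtain ⟨f, hf, hf'⟩ := exists_deriv_log (d := d) hπX hU hs (fun s => (c s).2.1.isConeFn)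
      (fun s => (c s).2.2) ht
    exact ⟨f, hf, hf', hderiv U hU c hs t ht f hf'⟩
  rintro r₀ _ _ rfl rfl
  have hr₀ := r₀.2.1.isConeFn
  have hr₀' := (Θ r₀).2.1.isConeFn
  set ΦX := sasakiEquiv hT hπX r₀ with hΦX
  set ΦK := sasakiEquiv hT hπK (Θ r₀) with hΦK
  -- The logarithmic ratio with the base potential identifies Sasaki potentials with cone potentials
  -- on either side; under these identifications the map is Θ.
  set Θ' := ΦX.trans (Θ.trans ΦK.symm) with hΘ'
  have hΘ'_π (φ : sasakiPotentials E X πX (contactForm E F πX r₀.1)) (p : V) :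
      (Θ' φ).1 (πK p) = Real.log ((Θ (ΦX φ)).1 p) - Real.log ((Θ r₀).1 p) :=
    logRatio_π hT hπK hr₀' (Θ (ΦX φ)).2.1.isConeFn p
  have hΘ'_Φ (φ : sasakiPotentials E X πX (contactForm E F πX r₀.1)) : ΦK (Θ' φ) = Θ (ΦX φ) :=
    ΦK.apply_symm_apply _
  have hX_form (φ : sasakiPotentials E X πX (contactForm E F πX r₀.1)) :
      potentialForm E πX (contactForm E F πX r₀.1) φ.1 = contactForm E F πX (ΦX φ).1 :=
    potentialForm_eq hT hr₀ hπX φ.2.1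
  have hK_form (φ : sasakiPotentials E X πX (contactForm E F πX r₀.1)) :
      potentialForm E πK (contactForm E F πK (Θ r₀).1) (Θ' φ).1 =
        contactForm E F πK (Θ (ΦX φ)).1 := by
    rw [← hΘ'_Φ]
    exact potentialForm_eq hT hr₀' hπK (Θ' φ).2.1
  have hfamX {P : Type} [NormedAddCommGroup P] [NormedSpace ℝ P] {U : Set P}
      {c : P → sasakiPotentials E X πX (contactForm E F πX r₀.1)}
      (hs : SmoothFamilyOn F U (fun s => (c s).1)) :
      SmoothFamilyOn E U (fun s => (ΦX (c s)).1) :=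
    hs.twist hπX.smooth r₀.2.1.smooth
  refine ⟨Θ', fun φ => ⟨ΦX φ, fun p => rfl, fun p => ?_, ?_⟩, ?_⟩
  · rw [← hΘ'_Φ]
    rfl
  · obtain ⟨h1, h2, h3⟩ := hcontact (ΦX φ)
    rw [hX_form, hK_form]
    refine ⟨h1, h2, h3, fun f hf => ?_, fun f hf U hU t ht c hs hct hd y => ?_⟩
    · filter_upwards [eventually_twist_mem hT hπX (ΦX φ).2 hf] with s hs
      refine (mem_sasakiPotentials_iff hT hr₀ r₀.2.2 hπX).2 ⟨⟨?_, fun g p => ?_⟩, ?_⟩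
      · exact φ.2.1.1.add ((contMDiff_const (c := s)).mul hf.1)
      · simp only [Pi.add_apply, Pi.smul_apply, hf.2, φ.2.1.2]
      · rw [twist_add]
        exact hs
    -- The base potentials do not depend on s, so φ and log r have the same derivative, as do ψ and
    -- log Θ(r).
    · obtain ⟨p, rfl⟩ := hπK.surjective y
      have hlog (q : V) : HasDerivAt (fun s => Real.log ((ΦX (c s)).1 q)) (f (πX q)) t := by
        have h4 (s : ℝ) : Real.log ((ΦX (c s)).1 q) = (c s).1 (πX q) + Real.log (r₀.1 q) := by
          change Real.log (Real.exp ((c s).1 (πX q)) * r₀.1 q) = _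
          rw [Real.log_mul (Real.exp_ne_zero _) (hr₀.pos q).ne', Real.log_exp]
        simp only [h4]
        exact (hd (πX q)).add_const _
      have h5 := hderiv U hU (fun s => ΦX (c s)) (hfamX hs) t ht f hlog p
      simp only [hct] at h5
      simp only [hΘ'_π]
      exact h5.sub_const _
  · intro P _ _ _ U hU c hs
    refine smoothFamilyOn_of_comp_submersion hU hπK.smooth hπK.surjective hπK.submersion ?_
    simp only [hΘ'_π]
    exact ((hfam P U hU _ (hfamX hs)).log fun s p => (Θ (ΦX (c s))).2.1.pos p).sub_const
      hr₀'.contMDiff_log
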